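/- **Theorem.** Let a Monotone 2-SAT formula be a conjunction of clauses $x_i\lor x_j$ over variables $x_1,\dots,x_\nu$; its size is polynomially related to $\nu+\mu$, where $\mu$ is its number of clauses. A weighted graph is a finite simple undirected graph whose edges $e$ carry weights $\gamma_e$; the weight of a perfect matching $M$ is $\prod_{e\in M}\gamma_e$. There exists a polynomial-time algorithm $\mathcal A$ which, when given as input a Monotone 2-SAT formula $\phi$, outputs a weighted graph $G$ with the following properties: 1. The edge weights of $G$ are drawn from the set $\{1,2,3\}$. 2. Suppose that $\phi$ has $\nu$ variables and $\mu$ clauses, and let $W$ be the total weight of the perfect matchings of $G$ (the sum of their weights). Then the number of satisfying assignments of $\phi$ can be determined in polynomial time from $W$, $\mu$ and $\nu$; that is, there is a single algorithm $\mathcal B$, the same for all $\phi$, which takes three natural numbers written in binary, runs in time polynomial in the length of this input, and on input $(W,\mu,\nu)$ outputs the number of satisfying assignments of $\phi$ among the $2^\nu$ assignments to its variables. 3. $G$ contains a Hamiltonian path, i.e. a path that visits every vertex exactly once. -/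

import Mathlib

open Computability

/-- A Monotone 2-SAT formula: a conjunction of `clauses.length` clauses, the clause `(i, j)` being
`x i ∨ x j`, over the `numVars` variables `x 0, …, x (numVars - 1)`. -/
structure MonotoneTwoSat where
  numVars : ℕ
  clauses : List (Fin numVars × Fin numVars)

namespace MonotoneTwoSat

/-- The truth assignment `a` satisfies every clause of `φ`. -/
def Satisfies (φ : MonotoneTwoSat) (a : Fin φ.numVars → Bool) : Prop :=
  ∀ c ∈ φ.clauses, a c.1 = true ∨ a c.2 = true

instance (φ : MonotoneTwoSat) : DecidablePred φ.Satisfies := fun a =>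
  inferInstanceAs (Decidable (∀ c ∈ φ.clauses, a c.1 = true ∨ a c.2 = true))

/-- The number of satisfying assignments of `φ`. -/
def numSat (φ : MonotoneTwoSat) : ℕ :=
  (Finset.univ.filter fun a : Fin φ.numVars → Bool => φ.Satisfies a).card

end MonotoneTwoSat

/-- The total weight of the perfect matchings of a finite graph `G` with edge weights `γ`: a perfect
matching is a set `M` of edges such that every vertex lies on exactly one edge of `M`, and its
weight is the product of the weights of its edges. -/
noncomputable def SimpleGraph.perfectMatchingWeight {V : Type*} [Fintype V]
    (G : SimpleGraph V) (γ : Sym2 V → ℕ) : ℕ :=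
  open Classical in
  ∑ M ∈ Finset.univ.filter (fun M : Finset (Sym2 V) =>
      (M : Set (Sym2 V)) ⊆ G.edgeSet ∧ ∀ v : V, ∃! e, e ∈ M ∧ v ∈ e),
    ∏ e ∈ M, γ e

/-- A finite simple graph with edge weights, presented as a list of weighted edges: the vertices
are `0, …, numVertices - 1`, and the entry `(u, v, w)` is the edge `{u, v}` with weight `w`.
There are no loops, and no edge is listed twice. -/
structure WeightedGraph where
  numVertices : ℕ
  edges : List (Fin numVertices × Fin numVertices × ℕ)
  ne_of_mem : ∀ e ∈ edges, e.1 ≠ e.2.1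
  nodup : (edges.map fun e => s(e.1, e.2.1)).Nodup

namespace WeightedGraph

/-- The underlying simple graph. -/
def graph (G : WeightedGraph) : SimpleGraph (Fin G.numVertices) :=
  SimpleGraph.fromEdgeSet {e | e ∈ G.edges.map fun e => s(e.1, e.2.1)}

/-- The weight of the edge `e`. As every edge is listed once, the sum has one term if `e` is an
edge of the graph, and none otherwise. -/
def weight (G : WeightedGraph) (e : Sym2 (Fin G.numVertices)) : ℕ :=
  ((G.edges.filter fun x => s(x.1, x.2.1) = e).map fun x => x.2.2).sum

/-- The total weight of the perfect matchings of `G`. -/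
noncomputable def totalWeight (G : WeightedGraph) : ℕ :=
  G.graph.perfectMatchingWeight G.weight

/-- `G` contains a Hamiltonian path. -/
def HasHamiltonianPath (G : WeightedGraph) : Prop :=
  ∃ (u v : Fin G.numVertices) (p : G.graph.Walk u v), p.IsHamiltonian

end WeightedGraph

/-! ### Representation of the inputs and outputs as words -/

/-- A list of numbers as a word: each number `n` is written as `n` times `true`, then `false`. -/
def encodeTally (l : List ℕ) : List Bool :=
  l.flatMap fun n => List.replicate n true ++ [false]

/-- A formula is written as its number of variables, followed by the indices of the two variables
of each clause. All of these numbers are at most the number of variables, so that the length of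
this word is polynomially related to the number of variables plus the number of clauses. -/
def MonotoneTwoSat.encode (φ : MonotoneTwoSat) : List Bool :=
  encodeTally (φ.numVars :: φ.clauses.flatMap fun c => [(c.1 : ℕ), (c.2 : ℕ)])

/-- A weighted graph is written as its number of vertices, followed by its weighted edges. -/
def WeightedGraph.encode (G : WeightedGraph) : List Bool :=
  encodeTally (G.numVertices :: G.edges.flatMap fun e => [(e.1 : ℕ), (e.2.1 : ℕ), e.2.2])

/-- A triple of numbers is written in binary, with the separator `none`. -/
def encodeTriple (x : ℕ × ℕ × ℕ) : List (Option Bool) :=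
  (encodeNat x.1).map some ++ none :: ((encodeNat x.2.1).map some ++
    none :: (encodeNat x.2.2).map some)

/-- `f` is computed by a multi-tape (multi-stack) Turing machine in a number of steps that is
polynomial in the length of the word that represents the input. -/
def PolyTimeComputable {α β Γ₀ Γ₁ : Type} (ea : α → List Γ₀) (eb : β → List Γ₁) (f : α → β) :
    Prop :=
  Nonempty (Turing.TM2ComputableInPolyTime ea eb f)

/-! The representations are faithful. -/

theorem encodeTally_injective : Function.Injective encodeTally := by
  have key : ∀ (m n : ℕ) (s t : List Bool),
      List.replicate m true ++ false :: s = List.replicate n true ++ false :: t →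
        m = n ∧ s = t := by
    intro m
    induction m with
    | zero =>
      intro n s t h
      cases n with
      | zero => simpa using h
      | succ n => simp [List.replicate_succ] at h
    | succ m ih =>
      intro n s t h
      cases n with
      | zero => simp [List.replicate_succ] at h
      | succ n =>
        simp only [List.replicate_succ, List.cons_append, List.cons.injEq, true_and] at h
        obtain ⟨h1, h2⟩ := ih n s t h
        exact ⟨by rw [h1], h2⟩
  intro l
  induction l with
  | nil =>
    intro l' h
    cases l' with
    | nil => rfl
    | cons b l' => simp [encodeTally] at h
  | cons a l ih =>
    intro l' h
    cases l' with
    | nil => simp [encodeTally] at h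
    | cons b l' =>
      simp only [encodeTally, List.flatMap_cons, List.append_assoc, List.cons_append,
        List.nil_append] at h
      obtain ⟨h1, h2⟩ := key _ _ _ _ h
      rw [h1, ih h2]

theorem MonotoneTwoSat.encode_injective : Function.Injective MonotoneTwoSat.encode := by
  rintro ⟨n, l⟩ ⟨n', l'⟩ h
  replace h := encodeTally_injective h
  simp only [List.cons.injEq] at h
  obtain ⟨rfl, h⟩ := h
  congr 1
  induction l generalizing l' with
  | nil =>
    cases l' with
    | nil => rfl
    | cons b l' => simp at h
  | cons a l ih =>
    cases l' with
    | nil => simp at h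
    | cons b l' =>
      simp only [List.flatMap_cons, List.cons_append, List.nil_append, List.cons.injEq] at h
      obtain ⟨h1, h2, h3⟩ := h
      rw [ih l' h3, Prod.ext (Fin.ext h1) (Fin.ext h2)]

theorem WeightedGraph.encode_injective : Function.Injective WeightedGraph.encode := by
  rintro ⟨n, l, p, q⟩ ⟨n', l', p', q'⟩ h
  replace h := encodeTally_injective h
  simp only [List.cons.injEq] at h
  obtain ⟨rfl, h⟩ := h
  congr 1
  clear p q p' q'
  induction l generalizing l' with
  | nil =>
    cases l' with
    | nil => rfl
    | cons b l' => simp at h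
  | cons a l ih =>
    cases l' with
    | nil => simp at h
    | cons b l' =>
      simp only [List.flatMap_cons, List.cons_append, List.nil_append, List.cons.injEq] at h
      obtain ⟨h1, h2, h3, h4⟩ := h
      rw [ih l' h4, Prod.ext (Fin.ext h1) (Prod.ext (Fin.ext h2) h3)]

theorem encodeTriple_injective : Function.Injective encodeTriple := by
  have key : ∀ (a b : List Bool) (s t : List (Option Bool)),
      a.map some ++ none :: s = b.map some ++ none :: t → a = b ∧ s = t := by
    intro a
    induction a with
    | nil =>
      intro b s t h
      cases b with
      | nil => simpa using h
      | cons y b => simp at h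
    | cons x a ih =>
      intro b s t h
      cases b with
      | nil => simp at h
      | cons y b =>
        simp only [List.map_cons, List.cons_append, List.cons.injEq, Option.some.injEq] at h
        obtain ⟨h1, h2⟩ := ih b s t h.2
        exact ⟨by rw [h.1, h1], h2⟩
  have inj : Function.Injective encodeNat := encodingNatBool.encode_injective
  rintro ⟨a, b, c⟩ ⟨a', b', c'⟩ h
  obtain ⟨h1, h⟩ := key _ _ _ _ h
  obtain ⟨h2, h⟩ := key _ _ _ _ h
  have h3 := List.map_injective_iff.2 (Option.some_injective Bool) h
  exact Prod.ext (inj h1) (Prod.ext (inj h2) (inj h3))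

/-! The graph has two layers. A core graph with edge weights -1, 0 and 1 counts satisfying
assignments by its perfect matchings; then the edges of a path through all core vertices are
replaced by ladders with weights 1, 2, 3 that imitate them modulo a power of 2.

Ladders. Describe a piece of a graph with ends `a`, `b` by the pair (α, β) of total weights of its
matchings that cover all inner vertices and neither, respectively both, of the ends. Surrounding the
piece with one more level whose rung has weight w changes (α, β) into (β, 2α + wβ)
(`ActsAsEdge.level`). A single edge, a rung 3 and then k rungs 1 give α = 2^(k+1) - (-1)^k and β =
2^(k+2) + (-1)^k, since for w = 1 the recursion has the eigenvalues 2 and -1. For even k an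
outermost rung r therefore gives (1, r - 2) modulo 2^(k+2): an edge of weight -1, 0 or 1 for r = 1,
2, 3 (`actsAsEdge_ladder`). Every ladder contains a path through all its vertices from end to end,
even when it imitates an absent edge. Ladders join each core vertex to the next one, so their paths
form a Hamiltonian path. The remaining core edges have weight 1 and are kept. `matchSum_expand`
reduces the sum over matchings to the core graph.

Core graph. The first row has a pair of vertices for each variable, and the set X of the variables
whose pair is not matched internally is arbitrary; it is the set of false variables. Every later row
is forced to copy X (`matchSum_shift`), and the last row closes up with the first one. In a row that
belongs to a literal of a clause, the edge of its variable is cut and rerouted through two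
terminals: a false variable covers both terminals, a true one leaves both to the gadget of the
clause (`matchSum_litRow`). Signs in the gadget make all unwanted matchings cancel, and what remains
covers the first pair of terminals, the second, or both, each with weight 2 (`matchSum_clause`). So
a clause contributes the factor 2 if it is satisfied and 0 otherwise, and the core sum is 2^μ N,
where N is the number of satisfying assignments (`matchSum_formulaParts`).

Decoding. The total weight is 2^μ N modulo 2^(k+2). As N is at most 2^ν and k is twice the length of
the input, N is a window in the binary digits of the total weight (`extractBits_of_mod`).

Complexity. Both algorithms are programs in a small structured language on stacks, whose compilation
to Turing machines is verified once (`StackProg.polyTimeComputable`). The graph is written with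
unary counters (`Counters.run_graphProg`), and the window of bits is found by decrementing binary
numbers (`BitReg.run_extractProg`). -/

/-! ### Structured programs on stacks -/

/-- Structured programs that operate on stacks, the stack `k` holding letters of `Γ k`. The program
`loop k body again` pops the stack `k`, runs `body o` for the outcome `o`, and starts again if
`again o` holds. -/
inductive StackProg {K : Type} (Γ : K → Type) : Type
  | skip : StackProg Γ
  | push (k : K) (g : Γ k) : StackProg Γ
  | seq (p q : StackProg Γ) : StackProg Γ
  | loop (k : K) (body : Option (Γ k) → StackProg Γ) (again : Option (Γ k) → Bool) : StackProg Γ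

namespace StackProg

variable {K : Type} {Γ : K → Type}

/-- `Run p S S' t`: the program `p` turns the stacks `S` into `S'` in at most `t` steps. -/
inductive Run [DecidableEq K] :
    StackProg Γ → (∀ k, List (Γ k)) → (∀ k, List (Γ k)) → ℕ → Prop
  | skip (S) : Run skip S S 1
  | push (k g S) : Run (push k g) S (Function.update S k (g :: S k)) 1
  | seq {p q S S' S'' t t'} : Run p S S' t → Run q S' S'' t' → Run (seq p q) S S'' (t + t')
  | loop_exit {k body again S S' t} : again (S k).head? = false →
      Run (body (S k).head?) (Function.update S k (S k).tail) S' t →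
      Run (loop k body again) S S' (t + 1)
  | loop_again {k body again S S' S'' t t'} : again (S k).head? = true →
      Run (body (S k).head?) (Function.update S k (S k).tail) S' t →
      Run (loop k body again) S' S'' t' →
      Run (loop k body again) S S'' (t + 1 + t')
  | mono {p S S' t t'} : Run p S S' t → t ≤ t' → Run p S S' t'

/-- The control locations of a program. -/
def Loc : StackProg Γ → Type
  | skip => Unit
  | push _ _ => Unit
  | seq p q => p.Loc ⊕ q.Loc
  | loop k body _ => Option (Σ o : Option (Γ k), (body o).Loc)

/-- The location at which a program starts. -/
def start : (p : StackProg Γ) → p.Loc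
  | skip => ()
  | push _ _ => ()
  | seq p _ => Sum.inl p.start
  | loop _ _ _ => none

/-- A loop holds one copy of the locations of its body for each outcome of the pop, so finiteness
rests on that of the alphabets. -/
theorem finite_loc [∀ k, Finite (Γ k)] (p : StackProg Γ) : Finite p.Loc := by
  induction p with
  | skip => exact inferInstanceAs (Finite Unit)
  | push => exact inferInstanceAs (Finite Unit)
  | seq p q hp hq => exact inferInstanceAs (Finite (p.Loc ⊕ q.Loc))
  | loop k body again h =>
    exact inferInstanceAs (Finite (Option (Σ o : Option (Γ k), (body o).Loc)))

variable [DecidableEq K] {Λ : Type}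

/-- The machine code of a program whose locations are placed by `emb` and which continues at `out`.
-/
def code : (p : StackProg Γ) → (p.Loc → Λ) → Λ → p.Loc →
    Turing.TM2.Stmt Γ Λ (∀ k, Option (Γ k))
  | skip, _, out, _ => .goto fun _ => out
  | push k g, _, out, _ => .push k (fun _ => g) (.goto fun _ => out)
  | seq p q, emb, _, Sum.inl l => p.code (emb ∘ Sum.inl) (emb (Sum.inr q.start)) l
  | seq _ q, emb, out, Sum.inr l => q.code (emb ∘ Sum.inr) out l
  | loop k body _, emb, _, none => .pop k (fun v s => Function.update v k s)
      (.goto fun v => emb (some ⟨v k, (body (v k)).start⟩))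
  | loop _ body again, emb, out, some ⟨o, l⟩ =>
      (body o).code (fun l => emb (some ⟨o, l⟩)) (bif again o then emb none else out) l

/-- The machine `M` gets from location `l` and stacks `S` to location `l'` and stacks `S'` in at
most `t` steps. -/
def Reach (M : Λ → Turing.TM2.Stmt Γ Λ (∀ k, Option (Γ k))) (l : Λ) (S : ∀ k, List (Γ k))
    (l' : Λ) (S' : ∀ k, List (Γ k)) (t : ℕ) : Prop :=
  ∀ v, ∃ v', ∃ s ≤ t, (flip bind (Turing.TM2.step M))^[s] (some ⟨some l, v, S⟩) =
    some ⟨some l', v', S'⟩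

theorem Reach.trans {M : Λ → Turing.TM2.Stmt Γ Λ (∀ k, Option (Γ k))} {l l' l'' : Λ}
    {S S' S'' : ∀ k, List (Γ k)} {t t' : ℕ} (h : Reach M l S l' S' t)
    (h' : Reach M l' S' l'' S'' t') : Reach M l S l'' S'' (t + t') := by
  intro v
  obtain ⟨v', s, hs, e⟩ := h v
  obtain ⟨v'', s', hs', e'⟩ := h' v'
  refine ⟨v'', s' + s, by omega, ?_⟩
  rw [Function.iterate_add_apply, e, e']

theorem Reach.mono {M : Λ → Turing.TM2.Stmt Γ Λ (∀ k, Option (Γ k))} {l l' : Λ}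
    {S S' : ∀ k, List (Γ k)} {t t' : ℕ} (h : Reach M l S l' S' t) (ht : t ≤ t') :
    Reach M l S l' S' t' := fun v => by
  obtain ⟨v', s, hs, e⟩ := h v
  exact ⟨v', s, hs.trans ht, e⟩

/-- The pop and the branching on its outcome are one machine step: the letter passes through the
internal state and at once selects a copy of the body. Nothing else in that state is ever read,
which is why `Reach` may quantify over it. -/
theorem reach_loop {k : K} {body : Option (Γ k) → StackProg Γ} {again : Option (Γ k) → Bool}
    (M : Λ → Turing.TM2.Stmt Γ Λ (∀ k, Option (Γ k))) (S : ∀ k, List (Γ k))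
    (emb : (loop k body again).Loc → Λ) (out : Λ)
    (hM : ∀ l, M (emb l) = (loop k body again).code emb out l) :
    Reach M (emb (loop k body again).start) S
      (emb (some ⟨(S k).head?, (body (S k).head?).start⟩)) (Function.update S k (S k).tail) 1 := by
  intro v
  refine ⟨Function.update v k (S k).head?, 1, le_rfl, ?_⟩
  have hn : M (emb none) = _ := hM none
  simp [flip, Turing.TM2.step, hn, code, start]
  rw [Function.update_self]

/-- The machine is only required to contain the code of `p` at the places `emb`, so that the
induction applies to subprograms. The exit stays general, because a loop body returns either to the
head of the loop or to its exit. -/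
theorem Run.reach {p : StackProg Γ} {S S' : ∀ k, List (Γ k)} {t : ℕ} (h : Run p S S' t)
    (M : Λ → Turing.TM2.Stmt Γ Λ (∀ k, Option (Γ k))) (emb : p.Loc → Λ) (out : Λ)
    (hM : ∀ l, M (emb l) = p.code emb out l) : Reach M (emb p.start) S out S' t := by
  induction h generalizing out with
  | skip S =>
    intro v
    refine ⟨v, 1, le_rfl, ?_⟩
    simp [flip, Turing.TM2.step, hM, code]
  | push k g S =>
    intro v
    refine ⟨v, 1, le_rfl, ?_⟩
    simp [flip, Turing.TM2.step, hM, code]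
  | @seq p q S S' S'' t t' _ _ ih ih' =>
    exact (ih (emb ∘ Sum.inl) (emb (Sum.inr q.start)) fun l => hM (Sum.inl l)).trans
      (ih' (emb ∘ Sum.inr) out fun l => hM (Sum.inr l))
  | @loop_exit k body again S S' t ha _ ih =>
    have h1 := reach_loop M S emb out hM
    rw [add_comm]
    refine h1.trans (ih (fun l => emb (some ⟨_, l⟩)) out fun l => ?_)
    refine (hM (some ⟨_, l⟩)).trans ?_
    change (body (S k).head?).code _ (bif again (S k).head? then _ else out) l = _
    rw [ha]
    rfl
  | @loop_again k body again S S' S'' t t' ha _ _ ih ih' =>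
    have h1 := reach_loop M S emb out hM
    rw [add_comm t 1]
    refine (h1.trans (ih (fun l => emb (some ⟨_, l⟩)) (emb none) fun l => ?_)).trans
      (ih' emb out hM)
    refine (hM (some ⟨_, l⟩)).trans ?_
    change (body (S k).head?).code _ (bif again (S k).head? then emb none else out) l = _
    rw [ha]
    rfl
  | mono _ ht ih => exact (ih emb out hM).mono ht

/-- The machine that runs a program and halts. -/
noncomputable def machine [Fintype K] [∀ k, Fintype (Γ k)] (p : StackProg Γ) (k₀ k₁ : K) :
    Turing.FinTM2 :=
  letI : Fintype p.Loc := @Fintype.ofFinite _ p.finite_loc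
  { K := K, k₀ := k₀, k₁ := k₁, Γ := Γ, Λ := Option p.Loc, main := some p.start
    σ := ∀ k, Option (Γ k), initialState := fun _ => none
    m := fun
      | some l => p.code some none l
      | none => .load (fun _ _ => none) .halt }

/-- The left side is the form in which `Turing.initList` and `Turing.haltList` give the stacks. -/
theorem dite_eq_update (k₀ : K) (s : List (Γ k₀)) (k : K) :
    (dite (k = k₀) (fun h => by rw [h]; exact s) fun _ => [] : List (Γ k)) =
      Function.update (fun _ => []) k₀ s k := by
  by_cases hk : k = k₀
  · subst hk
    simp
  · simp [hk]

theorem polyTimeComputable [Fintype K] [∀ k, Fintype (Γ k)] (p : StackProg Γ) (k₀ k₁ : K)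
    {α β Γ₀ Γ₁ : Type} {ea : α → List Γ₀} {eb : β → List Γ₁} {f : α → β}
    (e₀ : Γ k₀ ≃ Γ₀) (e₁ : Γ k₁ ≃ Γ₁) (T : Polynomial ℕ)
    (h : ∀ a, p.Run (Function.update (fun _ => []) k₀ ((ea a).map e₀.symm))
      (Function.update (fun _ => []) k₁ ((eb (f a)).map e₁.symm)) (T.eval (ea a).length)) :
    PolyTimeComputable ea eb f := by
  -- The additional step is the one at the location `none`. It resets the internal state, as the
  -- final configuration has to carry the initial one, and halts.
  refine ⟨{ tm := p.machine k₀ k₁, inputAlphabet := e₀, outputAlphabet := e₁, time := T + 1,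
            outputsFun := fun a => Classical.choice ?_ }⟩
  obtain ⟨v', s, hs, e⟩ := (h a).reach (p.machine k₀ k₁).m some none (fun l => rfl) (fun _ => none)
  refine ⟨{ steps := s + 1, evals_in_steps := ?_, steps_le_m := by simpa using hs }⟩
  have hi : Turing.initList (p.machine k₀ k₁) ((ea a).map e₀.symm) =
      ⟨some (some p.start), fun _ => none,
        Function.update (fun _ => []) k₀ ((ea a).map e₀.symm)⟩ := by
    exact congrArg (Turing.TM2.Cfg.mk _ _) (funext (dite_eq_update k₀ _))
  have ho : Turing.haltList (p.machine k₀ k₁) ((eb (f a)).map e₁.symm) =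
      ⟨none, fun _ => none, Function.update (fun _ => []) k₁ ((eb (f a)).map e₁.symm)⟩ := by
    exact congrArg (Turing.TM2.Cfg.mk _ _) (funext (dite_eq_update k₁ _))
  simp only [Equiv.invFun_as_coe, Option.map_some]
  rw [hi, ho, Function.iterate_succ_apply']
  exact (congrArg (flip bind (p.machine k₀ k₁).step) e).trans rfl

end StackProg

/-! ### Weighted sums over perfect matchings of a list of edges -/

/-- No edge of `l` is incident to `u`. -/
def Avoids {V R : Type*} (l : List (V × V × R)) (u : V) : Prop := ∀ e ∈ l, e.1 ≠ u ∧ e.2.1 ≠ u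

theorem avoids_nil {V R : Type*} (u : V) : Avoids ([] : List (V × V × R)) u := by simp [Avoids]

theorem avoids_cons {V R : Type*} {e : V × V × R} {l : List (V × V × R)} {u : V} :
    Avoids (e :: l) u ↔ (e.1 ≠ u ∧ e.2.1 ≠ u) ∧ Avoids l u := by simp [Avoids]

theorem avoids_append {V R : Type*} {l l' : List (V × V × R)} {u : V} :
    Avoids (l ++ l') u ↔ Avoids l u ∧ Avoids l' u := by
  simp only [Avoids, List.mem_append]
  exact ⟨fun h => ⟨fun e he => h e (Or.inl he), fun e he => h e (Or.inr he)⟩,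
    fun h e he => he.elim (h.1 e) (h.2 e)⟩

section EdgeList

variable {V R : Type*} [DecidableEq V] [CommRing R]

/-- The total weight of the sets of edges of `l` that cover every vertex of `S` exactly once and no
other vertex. -/
def matchSum : List (V × V × R) → Finset V → R
  | [], S => if S = ∅ then 1 else 0
  | (u, v, w) :: l, S =>
      matchSum l S + if u ∈ S ∧ v ∈ S then w * matchSum l (S \ {u, v}) else 0

/-- This makes gadgets modular, since edges to be contracted can be brought to the front. For two
neighbouring edges, removing their ends commutes, and if they share a vertex they cannot both be
taken in either order. -/
theorem matchSum_perm {l l' : List (V × V × R)} (h : l.Perm l') (S : Finset V) :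
    matchSum l S = matchSum l' S := by
  induction h generalizing S with
  | nil => rfl
  | cons x _ ih => obtain ⟨u, v, w⟩ := x; simp [matchSum, ih]
  | swap x y l =>
    obtain ⟨u, v, w⟩ := x
    obtain ⟨u', v', w'⟩ := y
    simp only [matchSum, Finset.mem_sdiff, Finset.mem_insert, Finset.mem_singleton, not_or]
    rw [show (S \ {u, v}) \ {u', v'} = (S \ {u', v'}) \ {u, v} from sdiff_right_comm ..]
    by_cases h1 : u ∈ S <;> by_cases h2 : v ∈ S <;> by_cases h3 : u' ∈ S <;>
      by_cases h4 : v' ∈ S <;> simp only [h1, h2, h3, h4, true_and, and_true, false_and, and_false,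
        if_true, if_false, add_zero]
    simp only [eq_comm (a := u), eq_comm (a := v)]
    by_cases a1 : u' = u <;> by_cases a2 : u' = v <;> by_cases a3 : v' = u <;>
      by_cases a4 : v' = v <;> simp only [a1, a2, a3, a4, not_true, not_false_eq_true, true_and,
        and_true, false_and, and_false, if_true, if_false, add_zero] <;> ring_nf
  | trans _ _ ih ih' => rw [ih, ih']

/-- The vertex `u` has to be covered, but stays uncovered whichever edges are taken. -/
theorem matchSum_eq_zero {l : List (V × V × R)} {S : Finset V} {u : V} (hu : u ∈ S)
    (h : Avoids l u) : matchSum l S = 0 := by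
  induction l generalizing S with
  | nil => simp [matchSum, Finset.ne_empty_of_mem hu]
  | cons e l ih =>
    obtain ⟨a, b, w⟩ := e
    rw [avoids_cons] at h
    have : u ∈ S \ {a, b} := by simp [hu, h.1.1.symm, h.1.2.symm]
    simp [matchSum, ih hu h.2, ih this h.2]

theorem matchSum_cons_of_mem {u v : V} {w : R} {l : List (V × V × R)} {S : Finset V} (hu : u ∈ S)
    (hv : v ∈ S) : matchSum ((u, v, w) :: l) S = matchSum l S + w * matchSum l (S \ {u, v}) := by
  simp [matchSum, hu, hv]

theorem matchSum_cons_left {u v : V} {w : R} {l : List (V × V × R)} {S : Finset V} (hu : u ∉ S) :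
    matchSum ((u, v, w) :: l) S = matchSum l S := by
  simp [matchSum, hu]

theorem matchSum_cons_right {u v : V} {w : R} {l : List (V × V × R)} {S : Finset V} (hv : v ∉ S) :
    matchSum ((u, v, w) :: l) S = matchSum l S := by
  simp [matchSum, hv]

/-- An edge whose first end has no further edges. -/
theorem matchSum_leaf {u v : V} {w : R} {l : List (V × V × R)} {S : Finset V} (hu : u ∈ S)
    (hv : v ∈ S) (h : Avoids l u) :
    matchSum ((u, v, w) :: l) S = w * matchSum l (S \ {u, v}) := by
  rw [matchSum_cons_of_mem hu hv, matchSum_eq_zero hu h, zero_add]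

theorem matchSum_map {W : Type*} [DecidableEq W] (f : V ↪ W) (l : List (V × V × R))
    (S : Finset V) :
    matchSum (l.map fun e => (f e.1, f e.2.1, e.2.2)) (S.map f) = matchSum l S := by
  induction l generalizing S with
  | nil => simp [matchSum]
  | cons e l ih =>
    obtain ⟨u, v, w⟩ := e
    have : S.map f \ {f u, f v} = (S \ {u, v}).map f := by
      ext x
      simp only [Finset.mem_sdiff, Finset.mem_map, Finset.mem_insert, Finset.mem_singleton]
      constructor
      · rintro ⟨⟨a, ha, rfl⟩, h⟩
        exact ⟨a, ⟨ha, by simpa using h⟩, rfl⟩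
      · rintro ⟨a, ⟨ha, h⟩, rfl⟩
        exact ⟨⟨a, ha, rfl⟩, by simpa using h⟩
    simp only [List.map_cons, matchSum, ih, this, Finset.mem_map' f]

theorem matchSum_ringHom {R' : Type*} [CommRing R'] (f : R →+* R') (l : List (V × V × R))
    (S : Finset V) :
    matchSum (l.map fun e => (e.1, e.2.1, f e.2.2)) S = f (matchSum l S) := by
  induction l generalizing S with
  | nil => simp [matchSum, apply_ite f]
  | cons e l ih =>
    obtain ⟨u, v, w⟩ := e
    simp [matchSum, ih, apply_ite f]

end EdgeList

/-! ### Ladders -/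

/-- The edges that lead from the rung `a b` of a ladder to the next one, and the rung itself, which
has weight `w`. -/
def ladderLevel (a b w : ℕ) : List (ℕ × ℕ × ℕ) :=
  [(a, b, w), (a, a + 1, 2), (b - 1, b, 1)]

/-- A ladder on the vertices `u, …, u + (2 * k + 5)`, the first rung of which has weight `r`. -/
def ladder (k u r : ℕ) : List (ℕ × ℕ × ℕ) :=
  ladderLevel u (u + (2 * k + 5)) r ++
    ((List.range k).flatMap fun j => ladderLevel (u + 1 + j) (u + (2 * k + 4) - j) 1) ++
    ladderLevel (u + 1 + k) (u + k + 4) 3 ++ [(u + k + 2, u + k + 3, 1)]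

section Ladder

variable {R : Type*} [CommRing R]

/-- The edges `l` with weights in `R`. -/
def castEdges (R : Type*) [CommRing R] (l : List (ℕ × ℕ × ℕ)) : List (ℕ × ℕ × R) :=
  l.map fun e => (e.1, e.2.1, (e.2.2 : R))

theorem castEdges_append (l l' : List (ℕ × ℕ × ℕ)) :
    castEdges R (l ++ l') = castEdges R l ++ castEdges R l' := List.map_append

/-- In every larger graph, the edges `g`, with vertices from `a` to `b`, can be replaced by an edge
`a b` of weight `β`, up to the factor `α`. -/
def ActsAsEdge (g : List (ℕ × ℕ × R)) (a b : ℕ) (α β : R) : Prop :=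
  ∀ (l : List (ℕ × ℕ × R)) (S : Finset ℕ), (∀ x ∈ Finset.Ioo a b, x ∉ S ∧ Avoids l x) →
    matchSum (g ++ l) (S ∪ Finset.Ioo a b) =
      α * matchSum l S + β * if a ∈ S ∧ b ∈ S then matchSum l (S \ {a, b}) else 0

theorem actsAsEdge_single (a : ℕ) (w : R) : ActsAsEdge [(a, a + 1, w)] a (a + 1) 1 w := by
  intro l S _
  have : Finset.Ioo a (a + 1) = ∅ := by ext; simp
  rw [this]
  simp [matchSum]

/-- The vertices `a + 1` and `b` have become inner and must be covered. Either the inner piece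
covers both, with weight β, and the ends `a`, `b + 1` are free for the rung or for other edges; or
it covers neither, with weight α, and then the two side edges of weights 2 and 1 are forced and
cover both ends. This gives (β, 2α + wβ). -/
theorem ActsAsEdge.level {g : List (ℕ × ℕ × R)} {a b w : ℕ} {α β : R} (hab : a + 1 < b)
    (h : ActsAsEdge g (a + 1) b α β) :
    ActsAsEdge (castEdges R (ladderLevel a (b + 1) w) ++ g) a (b + 1) β (2 * α + w * β) := by
  intro l S hS
  have hp : (castEdges R (ladderLevel a (b + 1) w) ++ g ++ l).Perm
      (g ++ ((a, a + 1, 2) :: (b, b + 1, 1) :: (a, b + 1, (w : R)) :: l)) := by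
    have : castEdges R (ladderLevel a (b + 1) w) =
      [(a, b + 1, (w : R)), (a, a + 1, 2), (b, b + 1, 1)] := by simp [castEdges, ladderLevel]
    rw [this, List.append_assoc]
    refine List.perm_append_comm.trans ?_
    rw [List.append_assoc]
    refine List.Perm.append_left g ?_
    refine List.perm_append_comm.trans ?_
    simp only [List.cons_append, List.nil_append]
    exact (List.Perm.swap _ _ _).trans ((List.Perm.swap _ _ _).cons _)
  have a1 : a + 1 ∉ S ∧ Avoids l (a + 1) := hS _ (by simp; omega)
  have b1 : b ∉ S ∧ Avoids l b := hS _ (by simp; omega)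
  rw [matchSum_perm hp]
  have hu : S ∪ Finset.Ioo a (b + 1) = (S ∪ {a + 1, b}) ∪ Finset.Ioo (a + 1) b := by
    ext x
    simp only [Finset.mem_union, Finset.mem_Ioo, Finset.mem_insert, Finset.mem_singleton]
    by_cases x ∈ S <;> simp [*] <;> omega
  rw [hu, h]
  · have e1 : (S ∪ {a + 1, b}) \ {a + 1, b} = S := by
      ext x
      simp only [Finset.mem_sdiff, Finset.mem_union, Finset.mem_insert, Finset.mem_singleton]
      constructor
      · tauto
      · intro hx
        refine ⟨Or.inl hx, ?_⟩
        rintro (rfl | rfl)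
        · exact a1.1 hx
        · exact b1.1 hx
    rw [if_pos (by simp), e1, matchSum_cons_right a1.1, matchSum_cons_left b1.1]
    have e2 : matchSum ((a, a + 1, (2 : R)) :: (b, b + 1, 1) :: (a, b + 1, (w : R)) :: l)
        (S ∪ {a + 1, b}) = if a ∈ S ∧ b + 1 ∈ S then 2 * matchSum l (S \ {a, b + 1}) else 0 := by
      have av : Avoids ((b, b + 1, (1 : R)) :: (a, b + 1, (w : R)) :: l) (a + 1) := by
        simp only [avoids_cons, a1.2, and_true]; omega
      have bv : Avoids ((a, b + 1, (w : R)) :: l) b := by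
        simp only [avoids_cons, b1.2, and_true]; omega
      by_cases ha : a ∈ S
      · rw [matchSum, matchSum_eq_zero (u := a + 1) (by simp) av, if_pos (by simp [ha]), zero_add]
        by_cases hb : b + 1 ∈ S
        · rw [matchSum_leaf (by simp; omega) (by simp [hb]; omega) bv, if_pos ⟨ha, hb⟩,
            matchSum_cons_left (by simp), one_mul]
          congr 2
          ext x
          simp only [Finset.mem_sdiff, Finset.mem_union, Finset.mem_insert, Finset.mem_singleton]
          have : x = a + 1 → x ∉ S := by rintro rfl; exact a1.1
          have : x = b → x ∉ S := by rintro rfl; exact b1.1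
          tauto
        · have : ∀ x, x = b + 1 → x ∉ S := by rintro _ rfl; exact hb
          rw [matchSum_cons_right (by simp [hb]; tauto), matchSum_eq_zero (u := b) (by simp; omega) bv,
            if_neg (by tauto), mul_zero]
      · rw [matchSum_cons_left (by simp [ha]; omega), matchSum_eq_zero (u := a + 1) (by simp) av,
          if_neg (by tauto)]
    rw [e2, matchSum]
    split_ifs <;> ring
  · intro x hx
    simp only [Finset.mem_Ioo] at hx
    have := hS x (by simp; omega)
    simp only [avoids_cons, this.2, Finset.mem_union, this.1, Finset.mem_insert,
      Finset.mem_singleton]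
    refine ⟨?_, ?_⟩ <;> simp <;> omega

/-- The part of a ladder inside its first rung. -/
theorem actsAsEdge_inner (k u : ℕ) :
    ActsAsEdge (castEdges R (((List.range k).flatMap fun j =>
      ladderLevel (u + j) (u + (2 * k + 3) - j) 1) ++
        ladderLevel (u + k) (u + k + 3) 3 ++ [(u + k + 1, u + k + 2, 1)])) u (u + (2 * k + 3))
      (2 ^ (k + 1) - (-1) ^ k) (2 ^ (k + 2) + (-1) ^ k) := by
  induction k generalizing u with
  | zero =>
    -- The single edge is the pair (1, 1), and the rung 3 turns it into (1, 5). This starting point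
    -- fixes the coefficients of the powers of 2 and of -1 in the solution of the recursion.
    have h := (actsAsEdge_single (u + 1) (1 : R)).level (w := 3) (by omega)
    simp only [castEdges_append]
    convert h using 1
    · simp [castEdges, ladderLevel]
    · norm_num
    · norm_num
  | succ k ih =>
    have h := (ih (u + 1)).level (w := 1) (by omega)
    have e : u + (2 * (k + 1) + 3) = u + 1 + (2 * k + 3) + 1 := by ring
    rw [e]
    convert h using 1
    · rw [← castEdges_append, List.range_succ_eq_map, List.flatMap_cons, List.flatMap_map]
      congr 1
      simp only [List.append_assoc, add_zero, Nat.sub_zero]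
      congr 1
      have : ∀ j, ladderLevel (u + (j + 1)) (u + 1 + (2 * k + 3) + 1 - (j + 1)) 1 =
          ladderLevel (u + 1 + j) (u + 1 + (2 * k + 3) - j) 1 := fun j => by congr 1 <;> omega
      simp only [Nat.succ_eq_add_one, this]
      congr 2
      · congr 1 <;> omega
      · congr 1; simp; omega
    · ring
    · push_cast; ring

/-- As 2^(k+2) vanishes and k is even, the inner part is the pair (2^(k+1) - 1, 1), so the outer
rung gives 1 and 2(2^(k+1) - 1) + r = r - 2. -/
theorem actsAsEdge_ladder (k u r : ℕ) (hk : Even k) (h : (2 : R) ^ (k + 2) = 0) :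
    ActsAsEdge (castEdges R (ladder k u r)) u (u + (2 * k + 5)) 1 (r - 2) := by
  have h1 := (actsAsEdge_inner (R := R) k (u + 1)).level (w := r) (by omega)
  convert h1 using 1
  · rw [← castEdges_append, ladder]
    simp only [List.append_assoc]
    congr 1
    congr 1
    · congr 1; omega
    congr 1
    · have : ∀ j, u + (2 * k + 4) - j = u + 1 + (2 * k + 3) - j := by omega
      simp only [this]
    · congr 2
      · omega
      · simp; omega
  · omega
  · rw [h, hk.neg_one_pow]; ring
  · rw [h, hk.neg_one_pow, show (2 : R) * (2 ^ (k + 1) - 1) = 2 ^ (k + 2) - 2 by ring, h]; ring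

end Ladder

/-! ### Graphs assembled from ladders and edges -/

/-- A part of a graph whose main vertices are the multiples of the length of a ladder: either the
ladder that leads from the main vertex `m` to the next one and has first rung `r`, or an edge that
joins two main vertices. -/
inductive GraphPart
  | wire (m r : ℕ)
  | jump (m m' : ℕ)

namespace GraphPart

/-- The edges of a part. -/
def expand (k : ℕ) : GraphPart → List (ℕ × ℕ × ℕ)
  | wire m r => ladder k (m * (2 * k + 5)) r
  | jump m m' => [(m * (2 * k + 5), m' * (2 * k + 5), 1)]

/-- The edge between main vertices that a part amounts to. -/
def core : GraphPart → List (ℕ × ℕ × ℤ)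
  | wire m r => if r = 2 then [] else [(m, m + 1, (r : ℤ) - 2)]
  | jump m m' => [(m, m', 1)]

/-- The main vertices at which the ladders of a list of parts start. -/
def wires : List GraphPart → List ℕ
  | [] => []
  | wire m _ :: l => m :: wires l
  | jump _ _ :: l => wires l

theorem wires_append (l l' : List GraphPart) : wires (l ++ l') = wires l ++ wires l' := by
  induction l with
  | nil => rfl
  | cons p l ih => cases p <;> simp [wires, ih]

theorem wires_flatMap {α : Type*} (l : List α) (f : α → List GraphPart) :
    wires (l.flatMap f) = l.flatMap fun a => wires (f a) := by
  induction l with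
  | nil => rfl
  | cons p l ih => simp [wires_append, ih]

theorem mem_wires {l : List GraphPart} {m : ℕ} : m ∈ wires l ↔ ∃ r, wire m r ∈ l := by
  induction l with
  | nil => simp [wires]
  | cons p l ih =>
    cases p with
    | wire m' r' =>
      simp only [wires, List.mem_cons, ih, wire.injEq]
      constructor
      · rintro (rfl | ⟨r, h⟩)
        · exact ⟨r', Or.inl ⟨rfl, rfl⟩⟩
        · exact ⟨r, Or.inr h⟩
      · rintro ⟨r, ⟨rfl, rfl⟩ | h⟩
        · exact Or.inl rfl
        · exact Or.inr ⟨r, h⟩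
    | jump => simp [wires, ih]

/-- The vertices that are not main vertices. -/
def inner (k : ℕ) (l : List GraphPart) : Finset ℕ :=
  (wires l).toFinset.biUnion fun m => Finset.Ioo (m * (2 * k + 5)) (m * (2 * k + 5) + (2 * k + 5))

end GraphPart

theorem ladder_bounds {k u r : ℕ} {e : ℕ × ℕ × ℕ} (he : e ∈ ladder k u r) :
    u ≤ e.1 ∧ e.1 < e.2.1 ∧ e.2.1 ≤ u + (2 * k + 5) := by
  simp only [ladder, ladderLevel, List.mem_append, List.mem_cons, List.not_mem_nil, or_false,
    List.mem_flatMap, List.mem_range] at he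
  rcases he with (((rfl | rfl | rfl) | ⟨j, hj, rfl | rfl | rfl⟩) | (rfl | rfl | rfl)) | rfl <;>
    simp only <;> omega

theorem not_dvd_of_mem_Ioo {L m x : ℕ} (hx : x ∈ Finset.Ioo (m * L) (m * L + L)) : ¬ L ∣ x := by
  rintro ⟨c, rfl⟩
  simp only [Finset.mem_Ioo] at hx
  rw [mul_comm L c, ← Nat.succ_mul] at hx
  have h1 : m < c := lt_of_mul_lt_mul_right hx.1 (Nat.zero_le _)
  have h2 : c < m + 1 := lt_of_mul_lt_mul_right hx.2 (Nat.zero_le _)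
  omega

namespace GraphPart

/-- A vertex strictly inside a ladder is not a multiple of the ladder length, so no jump ends there,
and other ladders occupy other intervals. -/
theorem avoids_expand {R : Type*} [CommRing R] {k m x : ℕ} {l : List GraphPart} (hm : m ∉ wires l)
    (hx : x ∈ Finset.Ioo (m * (2 * k + 5)) (m * (2 * k + 5) + (2 * k + 5))) :
    Avoids (castEdges R (l.flatMap (expand k))) x := by
  intro e he
  simp only [castEdges, List.mem_map, List.mem_flatMap] at he
  obtain ⟨e, ⟨p, hp, he⟩, rfl⟩ := he
  cases p with
  | wire m' r =>
    have hne : m' ≠ m := by rintro rfl; exact hm (mem_wires.2 ⟨r, hp⟩)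
    have hb := ladder_bounds he
    simp only [Finset.mem_Ioo] at hx
    rcases Nat.lt_or_gt_of_ne hne with h | h
    · have : (m' + 1) * (2 * k + 5) ≤ m * (2 * k + 5) := Nat.mul_le_mul_right _ h
      rw [Nat.succ_mul] at this
      simp only; omega
    · have : (m + 1) * (2 * k + 5) ≤ m' * (2 * k + 5) := Nat.mul_le_mul_right _ h
      rw [Nat.succ_mul] at this
      simp only; omega
  | jump a b =>
    have hd := not_dvd_of_mem_Ioo hx
    simp only [expand, List.mem_singleton] at he
    subst he
    constructor
    · rintro rfl; exact hd (Dvd.intro_left _ rfl)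
    · rintro rfl; exact hd (Dvd.intro_left _ rfl)

/-- The parts are contracted one by one, and the edge that replaces a part is moved into `l`. Its
ends are main vertices, so the hypothesis on `l` persists. -/
theorem matchSum_expand_append {R : Type*} [CommRing R] {k : ℕ} (hk : Even k)
    (h2 : (2 : R) ^ (k + 2) = 0) (parts : List GraphPart) (hp : (wires parts).Nodup)
    (l : List (ℕ × ℕ × R)) (S : Finset ℕ) (hl : ∀ x, ¬ (2 * k + 5) ∣ x → Avoids l x)
    (hS : ∀ x ∈ S, (2 * k + 5) ∣ x) :
    matchSum (castEdges R (parts.flatMap (expand k)) ++ l) (S ∪ inner k parts) =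
      matchSum ((parts.flatMap fun p => p.core.map fun e =>
        (e.1 * (2 * k + 5), e.2.1 * (2 * k + 5), (e.2.2 : R))) ++ l) S := by
  induction parts generalizing l S with
  | nil => simp [castEdges, inner, wires]
  | cons p parts ih =>
    cases p with
    | wire m r =>
      simp only [wires, List.nodup_cons] at hp
      set a := m * (2 * k + 5) with ha
      have hb : (m + 1) * (2 * k + 5) = a + (2 * k + 5) := by rw [ha, Nat.succ_mul]
      have e1 : inner k (wire m r :: parts) = inner k parts ∪ Finset.Ioo a (a + (2 * k + 5)) := by
        simp [inner, wires, Finset.union_comm, ha]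
      have e2 : castEdges R ((wire m r :: parts).flatMap (expand k)) ++ l =
          castEdges R (ladder k a r) ++ (castEdges R (parts.flatMap (expand k)) ++ l) := by
        simp [expand, castEdges_append, ← ha]
      have key := actsAsEdge_ladder k a r hk h2
        (castEdges R (parts.flatMap (expand k)) ++ l) (S ∪ inner k parts) (by
          intro x hx
          refine ⟨?_, avoids_append.2 ⟨avoids_expand hp.1 hx, hl x (not_dvd_of_mem_Ioo hx)⟩⟩
          simp only [Finset.mem_union, not_or]
          refine ⟨fun h => not_dvd_of_mem_Ioo hx (hS x h), ?_⟩
          simp only [inner, Finset.mem_biUnion, List.mem_toFinset, not_exists, not_and]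
          intro m' hm' hx'
          have hne : m' ≠ m := by rintro rfl; exact hp.1 hm'
          simp only [Finset.mem_Ioo] at hx hx'
          rcases Nat.lt_or_gt_of_ne hne with h | h
          · have : (m' + 1) * (2 * k + 5) ≤ m * (2 * k + 5) := Nat.mul_le_mul_right _ h
            rw [Nat.succ_mul] at this
            omega
          · have : (m + 1) * (2 * k + 5) ≤ m' * (2 * k + 5) := Nat.mul_le_mul_right _ h
            rw [Nat.succ_mul] at this
            omega)
      rw [e1, e2, ← Finset.union_assoc, key]
      have e3 : (1 : R) * matchSum (castEdges R (parts.flatMap (expand k)) ++ l) (S ∪ inner k parts)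
          + (r - 2) * (if a ∈ S ∪ inner k parts ∧ a + (2 * k + 5) ∈ S ∪ inner k parts then
            matchSum (castEdges R (parts.flatMap (expand k)) ++ l)
              ((S ∪ inner k parts) \ {a, a + (2 * k + 5)}) else 0) =
          matchSum (castEdges R (parts.flatMap (expand k)) ++ ((a, a + (2 * k + 5), (r : R) - 2) :: l))
            (S ∪ inner k parts) := by
        rw [matchSum_perm (List.perm_middle (l₁ := castEdges R (parts.flatMap (expand k)))
          (a := (a, a + (2 * k + 5), (r : R) - 2)) (l₂ := l))]
        simp only [matchSum, mul_ite, mul_zero, one_mul]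
      rw [e3, ih hp.2 _ S (fun x hx => avoids_cons.2 ⟨⟨?_, ?_⟩, hl x hx⟩) hS]
      -- For `r = 2` the replacing edge has weight 0 and contributes nothing, which is why `core`
      -- omits it.
      · by_cases hr : r = 2
        · subst hr
          rw [matchSum_perm List.perm_middle]
          simp [matchSum, core]
        · rw [matchSum_perm List.perm_middle]
          simp [core, hr, hb, ha]
      · rintro rfl; exact hx (Dvd.intro_left _ rfl)
      · rintro rfl; exact hx (hb ▸ Dvd.intro_left _ rfl)
    | jump m m' =>
      have e1 : inner k (jump m m' :: parts) = inner k parts := rfl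
      have e2 : (castEdges R ((jump m m' :: parts).flatMap (expand k)) ++ l).Perm
          (castEdges R (parts.flatMap (expand k)) ++
            ((m * (2 * k + 5), m' * (2 * k + 5), (1 : R)) :: l)) := by
        simpa [expand, castEdges] using List.perm_middle.symm
      rw [e1, matchSum_perm e2, ih hp _ S (fun x hx => avoids_cons.2 ⟨⟨?_, ?_⟩, hl x hx⟩) hS]
      · rw [matchSum_perm List.perm_middle]
        simp [core]
      · rintro rfl; exact hx (Dvd.intro_left _ rfl)
      · rintro rfl; exact hx (Dvd.intro_left _ rfl)

/-- A ladder starts at each of the main vertices `0, …, n - 1` and fills the interval up to the next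
one, so every vertex is a main vertex or inner to a ladder. After contraction only the integral core
sum is left, read in `R`. -/
theorem matchSum_expand {R : Type*} [CommRing R] {k n : ℕ} (hk : Even k)
    (h2 : (2 : R) ^ (k + 2) = 0) (parts : List GraphPart) (hp : (wires parts).Perm (List.range n)) :
    matchSum (castEdges R (parts.flatMap (expand k))) (Finset.range (n * (2 * k + 5) + 1)) =
      (matchSum (parts.flatMap core) (Finset.range (n + 1)) : ℤ) := by
  let f : ℕ ↪ ℕ := ⟨fun m => m * (2 * k + 5), fun a b h => Nat.eq_of_mul_eq_mul_right (by omega) h⟩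
  have e : Finset.range (n * (2 * k + 5) + 1) = (Finset.range (n + 1)).map f ∪ inner k parts := by
    ext x
    simp only [inner, Finset.mem_union, Finset.mem_map, Finset.mem_biUnion, List.mem_toFinset,
      hp.mem_iff, List.mem_range, Finset.mem_range, Finset.mem_Ioo]
    have hx := Nat.div_add_mod x (2 * k + 5)
    have hl := Nat.mod_lt x (show 0 < 2 * k + 5 by omega)
    rw [mul_comm] at hx
    constructor
    · intro h
      by_cases h0 : x % (2 * k + 5) = 0
      · refine Or.inl ⟨x / (2 * k + 5), ?_, show x / (2 * k + 5) * (2 * k + 5) = x by omega⟩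
        have : x / (2 * k + 5) * (2 * k + 5) ≤ n * (2 * k + 5) := by omega
        have := le_of_mul_le_mul_right this (by omega)
        omega
      · refine Or.inr ⟨x / (2 * k + 5), ?_, by omega, by omega⟩
        have : x / (2 * k + 5) * (2 * k + 5) < n * (2 * k + 5) := by omega
        exact lt_of_mul_lt_mul_right this (by omega)
    · rintro (⟨m, hm, rfl⟩ | ⟨m, hm, h1, h2⟩)
      · have : m * (2 * k + 5) ≤ n * (2 * k + 5) := Nat.mul_le_mul_right _ (by omega)
        exact Nat.lt_succ_of_le this
      · have : (m + 1) * (2 * k + 5) ≤ n * (2 * k + 5) := Nat.mul_le_mul_right _ (by omega)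
        rw [Nat.succ_mul] at this
        omega
  have h := matchSum_expand_append hk h2 parts (hp.nodup_iff.2 List.nodup_range) []
    ((Finset.range (n + 1)).map f) (fun x _ => avoids_nil x) (by
      intro x hx
      obtain ⟨m, _, rfl⟩ := Finset.mem_map.1 hx
      exact Dvd.intro_left _ rfl)
  rw [e]
  simp only [List.append_nil] at h
  rw [h]
  have h3 := matchSum_ringHom (Int.castRingHom R) (parts.flatMap core) (Finset.range (n + 1))
  rw [eq_intCast] at h3
  rw [← h3]
  refine Eq.trans ?_ (matchSum_map f _ _)
  congr 1
  simp only [List.map_flatMap, List.map_map, Function.comp_def, Int.coe_castRingHom]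
  rfl

end GraphPart

/-! ### The graph of a formula -/

open GraphPart in
/-- A row of pairs of vertices, one for each variable, starting at `cur`. The pair of the variable
`v` is joined to the vertex `old + 2 * v` of an earlier row, where the edge of the variable `i` is
led through the vertices `P` and `Q`. -/
def litRow (ν i old P Q cur : ℕ) : List GraphPart :=
  (List.range ν).flatMap fun v =>
    (if v = i then [jump (old + 2 * v) P, jump Q (cur + 2 * v)] else
      [jump (old + 2 * v) (cur + 2 * v)]) ++ [wire (cur + 2 * v) 3, wire (cur + 2 * v + 1) 2]

open GraphPart in
/-- The parts for a clause, where the preceding row starts at `s`. -/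
def clauseParts (ν : ℕ) (c : ℕ × ℕ) (s : ℕ) : List GraphPart :=
  [wire (s + 2 * ν) 3, wire (s + 2 * ν + 1) 2] ++
  litRow ν c.1 (s + 1) (s + 2 * ν + 1) (s + 2 * ν) (s + 2 * ν + 2) ++
  [wire (s + 4 * ν + 2) 1, jump (s + 2 * ν) (s + 4 * ν + 3), jump (s + 2 * ν + 1) (s + 4 * ν + 3),
    wire (s + 4 * ν + 3) 2, jump (s + 2 * ν) (s + 4 * ν + 4), jump (s + 2 * ν + 1) (s + 4 * ν + 4),
    jump (s + 4 * ν + 2) (s + 4 * ν + 4), wire (s + 4 * ν + 4) 1,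
    jump (s + 4 * ν + 3) (s + 4 * ν + 5), wire (s + 4 * ν + 5) 2] ++
  litRow ν c.2 (s + 2 * ν + 3) (s + 4 * ν + 5) (s + 4 * ν + 2) (s + 4 * ν + 6)

open GraphPart in
/-- The last row, which is joined to the first one, where the preceding row starts at `s`. -/
def finalParts (ν s : ℕ) : List GraphPart :=
  [wire (s + 2 * ν) 3, wire (s + 2 * ν + 1) 2] ++
  ((List.range ν).flatMap fun v =>
    [jump (s + 1 + 2 * v) (s + 2 * ν + 2 + 2 * v), wire (s + 2 * ν + 2 + 2 * v) 3,
      jump (2 * v) (s + 2 * ν + 2 + 2 * v + 1), wire (s + 2 * ν + 2 + 2 * v + 1) 2]) ++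
  [wire (s + 4 * ν + 2) 3]

/-- The parts for the clauses `cs` and the last row, where the preceding row starts at `s`. -/
def tailParts (ν : ℕ) : List (ℕ × ℕ) → ℕ → List GraphPart
  | [], s => finalParts ν s
  | c :: cs, s => clauseParts ν c s ++ tailParts ν cs (s + 4 * ν + 6)

open GraphPart in
/-- The parts of the graph of the formula with `ν` variables and clauses `cs`. -/
def formulaParts (ν : ℕ) (cs : List (ℕ × ℕ)) : List GraphPart :=
  ((List.range ν).flatMap fun v => [wire (2 * v) 3, wire (2 * v + 1) 2]) ++ tailParts ν cs 0

/-! ### The matchings of the graph of a formula -/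

theorem matchSum_expand_vertex {a b c d x : ℕ} {w₁ w₂ w₃ w₄ : ℤ} {l : List (ℕ × ℕ × ℤ)}
    {S : Finset ℕ} (hx : x ∈ S) (hl : Avoids l x) :
    matchSum ((a, x, w₁) :: (b, x, w₂) :: (c, x, w₃) :: (x, d, w₄) :: l) S =
      (if a ∈ S then w₁ * matchSum l (S \ {a, x}) else 0) +
      (if b ∈ S then w₂ * matchSum l (S \ {b, x}) else 0) +
      (if c ∈ S then w₃ * matchSum l (S \ {c, x}) else 0) +
      (if d ∈ S then w₄ * matchSum l (S \ {x, d}) else 0) := by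
  simp only [matchSum, hx, and_true, true_and, matchSum_eq_zero hx hl, Finset.mem_sdiff,
    Finset.mem_insert, Finset.mem_singleton, or_true, not_true, and_false, if_false, add_zero,
    false_and, zero_add]
  ring

/-- The gadget of a clause: with the factor `2`, at least one of the pairs `p q` and `p' q'` is
covered by its edges. -/
theorem matchSum_clause {p q p' q' x y : ℕ} {l : List (ℕ × ℕ × ℤ)} {S : Finset ℕ}
    (hS : {p, q, p', q', x, y} ⊆ S) (hd : [p, q, p', q', x, y].Nodup)
    (hx : Avoids l x) (hy : Avoids l y) :
    matchSum ((p, x, 1) :: (q, x, 1) :: (p', x, 1) :: (x, q', -1) :: (p, y, 1) :: (q, y, 1) ::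
      (p', y, -1) :: (y, q', 1) :: (p, q, 1) :: l) S =
    2 * (matchSum l (S \ {x, y, p, q}) + matchSum l (S \ {x, y, p', q'}) +
      matchSum l (S \ {x, y, p, q, p', q'})) := by
  simp only [List.nodup_cons, List.mem_cons, List.not_mem_nil, or_false, not_or, not_false_eq_true,
    List.nodup_nil, and_true] at hd
  obtain ⟨⟨pq, pp, pq', px, py⟩, ⟨qp, qq, qx, qy⟩, ⟨pq2, px2, py2⟩, ⟨qx2, qy2⟩, xy⟩ := hd
  simp only [Finset.insert_subset_iff, Finset.singleton_subset_iff] at hS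
  obtain ⟨hp, hq, hp', hq', hxS, hyS⟩ := hS
  have hl : Avoids ((p, q, 1) :: l) y := avoids_cons.2 ⟨⟨py, qy⟩, hy⟩
  have hl' : Avoids ((p, y, 1) :: (q, y, 1) :: (p', y, -1) :: (y, q', 1) :: (p, q, 1) :: l) x := by
    simp only [avoids_cons, ne_eq, px, qx, px2, qx2, hx, Ne.symm xy, not_false_eq_true, and_self]
  -- The vertices `x` and `y` choose two distinct partners among `p`, `q`, `p'`, `q'`, and every
  -- pair of partners is chosen in two ways. For a pair with one element from each side the two
  -- signs are opposite; for `p, q` and for `p', q'` the two products are both 1, whence the factor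
  -- 2.
  rw [matchSum_expand_vertex hxS hl']
  simp only [hp, hq, hp', hq', if_true]
  rw [matchSum_expand_vertex (by simp [hyS, Ne.symm py, Ne.symm xy]) hl,
    matchSum_expand_vertex (by simp [hyS, Ne.symm qy, Ne.symm xy]) hl,
    matchSum_expand_vertex (by simp [hyS, Ne.symm py2, Ne.symm xy]) hl,
    matchSum_expand_vertex (by simp [hyS, Ne.symm qy2, Ne.symm xy]) hl]
  simp only [Finset.mem_sdiff, Finset.mem_insert, Finset.mem_singleton, hp, hq, hp', hq',
    or_true, not_true, and_false, if_false, pq, pp, pq', px, qp, qq, qx, pq2, px2, qx2,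
    Ne.symm pq, Ne.symm pp, Ne.symm pq', Ne.symm qp, Ne.symm qq, Ne.symm pq2, or_false,
    not_false_eq_true, and_true, if_true]
  have e : ∀ a b : ℕ, (S \ {a, x}) \ {b, y} = (S \ {b, x}) \ {a, y} := by
    intro a b; ext z; simp only [Finset.mem_sdiff, Finset.mem_insert, Finset.mem_singleton]; tauto
  have e2 : ∀ a b : ℕ, (S \ {x, a}) \ {b, y} = (S \ {b, x}) \ {a, y} := by
    intro a b; ext z; simp only [Finset.mem_sdiff, Finset.mem_insert, Finset.mem_singleton]; tauto
  have e3 : ∀ a b : ℕ, (S \ {a, x}) \ {y, b} = S \ {x, y, a, b} := by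
    intro a b; ext z; simp only [Finset.mem_sdiff, Finset.mem_insert, Finset.mem_singleton]; tauto
  have e4 : ∀ a b : ℕ, (S \ {a, x}) \ {b, y} = S \ {x, y, a, b} := by
    intro a b; ext z; simp only [Finset.mem_sdiff, Finset.mem_insert, Finset.mem_singleton]; tauto
  have e5 : ∀ a b : ℕ, S \ {x, y, a, b} = S \ {x, y, b, a} := by
    intro a b; ext z; simp only [Finset.mem_sdiff, Finset.mem_insert, Finset.mem_singleton]; tauto
  simp only [e2, e3, e4]
  rw [e5 q p, e5 p' p, e5 p' q]
  have e6 : (S \ {x, y, p', q'}) \ {p, q} = S \ {x, y, p, q, p', q'} := by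
    ext z; simp only [Finset.mem_sdiff, Finset.mem_insert, Finset.mem_singleton]; tauto
  have m1 : matchSum ((p, q, 1) :: l) (S \ {x, y, p, q}) = matchSum l (S \ {x, y, p, q}) :=
    matchSum_cons_left (by simp)
  -- Only when `x` and `y` have taken `p'` and `q'` are both ends of the edge `p q` still free.
  -- Taking it yields the third term.
  have m2 : matchSum ((p, q, 1) :: l) (S \ {x, y, p', q'}) =
      matchSum l (S \ {x, y, p', q'}) + matchSum l (S \ {x, y, p, q, p', q'}) := by
    rw [matchSum_cons_of_mem (by simp [hp, px, py, pp, pq']) (by simp [hq, qx, qy, qp, qq]), e6,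
      one_mul]
  rw [m1, m2]
  ring

/-- Everything is forced: `a` has no partner but `b`, and if `a` is absent then `b` has no partner
but `c`. -/
theorem matchSum_shift_one {a b c : ℕ} {l : List (ℕ × ℕ × ℤ)} {S : Finset ℕ} (hab : a ≠ b)
    (hac : a ≠ c) (hb : b ∈ S) (hc : c ∈ S) (ha' : Avoids l a) (hb' : Avoids l b) :
    matchSum ((a, b, 1) :: (b, c, 1) :: l) S =
      matchSum l (if a ∈ S then S \ {a, b} else S \ {b, c}) := by
  split_ifs with ha
  · rw [matchSum_leaf ha hb (avoids_cons.2 ⟨⟨hab.symm, hac.symm⟩, ha'⟩),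
      matchSum_cons_left (by simp), one_mul]
  · rw [matchSum_cons_left ha, matchSum_leaf hb hc hb', one_mul]

/-- A row copies `X` in exactly one way: a source still to be covered takes the left vertex of its
pair and frees the right one, and otherwise the pair is matched internally. The sources are
arbitrary, so that one of them can be rerouted. -/
theorem matchSum_shift (n cur : ℕ) (src : ℕ → ℕ) (X A : Finset ℕ) (l : List (ℕ × ℕ × ℤ))
    (hX : X ⊆ Finset.range n) (hsrc : ∀ v < n, src v < cur)
    (hinj : ∀ v < n, ∀ w < n, src v = src w → v = w)
    (hl : ∀ v < n, Avoids l (src v) ∧ Avoids l (cur + 2 * v))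
    (hA : ∀ v < n, src v ∉ A) (hA' : ∀ x ∈ A, x < cur ∨ cur + 2 * n ≤ x) :
    matchSum (((List.range n).flatMap fun v =>
      [(src v, cur + 2 * v, 1), (cur + 2 * v, cur + 2 * v + 1, 1)]) ++ l)
        (A ∪ X.image src ∪ Finset.Ico cur (cur + 2 * n)) =
      matchSum l (A ∪ X.image fun v => cur + 2 * v + 1) := by
  induction n generalizing X A l with
  | zero =>
    obtain rfl : X = ∅ := by simpa using hX
    simp
  | succ n ih =>
    rw [List.range_succ, List.flatMap_append, List.append_assoc]
    have hX' : X.erase n ⊆ Finset.range n := by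
      intro v hv
      have h1 := Finset.mem_erase.1 hv
      have h2 := Finset.mem_range.1 (hX h1.2)
      exact Finset.mem_range.2 (by omega)
    -- For the induction the last pair and its source become spectators; their two edges are treated
    -- afterwards by `matchSum_shift_one`.
    set B : Finset ℕ := A ∪ (if n ∈ X then {src n} else ∅) ∪ {cur + 2 * n, cur + 2 * n + 1} with hB
    have e1 : A ∪ X.image src ∪ Finset.Ico cur (cur + 2 * (n + 1)) =
        B ∪ (X.erase n).image src ∪ Finset.Ico cur (cur + 2 * n) := by
      have e : X.image src = (if n ∈ X then {src n} else ∅) ∪ (X.erase n).image src := by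
        split_ifs with h
        · conv_lhs => rw [← Finset.insert_erase h, Finset.image_insert]
          rfl
        · rw [Finset.erase_eq_of_notMem h, Finset.empty_union]
      rw [e]
      ext z
      simp only [hB, Finset.mem_union, Finset.mem_Ico, Finset.mem_insert, Finset.mem_singleton]
      have : (cur ≤ z ∧ z < cur + 2 * (n + 1)) ↔
          ((z = cur + 2 * n ∨ z = cur + 2 * n + 1) ∨ (cur ≤ z ∧ z < cur + 2 * n)) := by omega
      rw [this]
      tauto
    have hsn := hsrc n (by omega)
    have mB : ∀ z, z ∈ B ↔ z ∈ A ∨ (n ∈ X ∧ z = src n) ∨ z = cur + 2 * n ∨ z = cur + 2 * n + 1 := by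
      intro z
      simp only [hB, Finset.mem_union, Finset.mem_insert, Finset.mem_singleton]
      split_ifs with h <;> simp [h]
      tauto
    rw [e1, ih (X.erase n) B _ hX' (fun v hv => hsrc v (by omega))
      (fun v hv w hw => hinj v (by omega) w (by omega))]
    · simp only [List.flatMap_cons, List.flatMap_nil, List.append_nil, List.cons_append,
        List.nil_append]
      rw [matchSum_shift_one (by omega) (by omega) (by simp [mB]) (by simp [mB])
        (hl n (by omega)).1 (hl n (by omega)).2]
      congr 1
      have hi : src n ∈ B ∪ (X.erase n).image (fun v => cur + 2 * v + 1) ↔ n ∈ X := by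
        simp only [Finset.mem_union, mB, Finset.mem_image]
        constructor
        · rintro ((h | h | h) | ⟨v, _, h⟩)
          · exact absurd h (hA n (by omega))
          · exact h.1
          · omega
          · omega
        · intro h; exact Or.inl (Or.inr (Or.inl ⟨h, trivial⟩))
      have hA1 : ∀ z ∈ A, z ≠ cur + 2 * n ∧ z ≠ cur + 2 * n + 1 := fun z hz => by
        have := hA' z hz; omega
      have hA2 : ∀ z ∈ A, z ≠ src n := fun z hz h => hA n (by omega) (h ▸ hz)
      have hI : ∀ z ∈ (X.erase n).image (fun v => cur + 2 * v + 1),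
          cur ≤ z ∧ z < cur + 2 * n := by
        intro z hz
        obtain ⟨v, hv, rfl⟩ := Finset.mem_image.1 hz
        have := Finset.mem_range.1 (hX' hv)
        omega
      by_cases hn : n ∈ X
      · rw [if_pos (hi.2 hn)]
        conv_rhs => rw [← Finset.insert_erase hn, Finset.image_insert]
        ext z
        have := hA1 z
        have := hA2 z
        have := hI z
        simp only [Finset.mem_sdiff, Finset.mem_union, mB, Finset.mem_insert, Finset.mem_singleton]
        grind
      · rw [if_neg (fun h => hn (hi.1 h))]
        rw [Finset.erase_eq_of_notMem hn] at hI ⊢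
        ext z
        have := hA1 z
        have := hI z
        simp only [Finset.mem_sdiff, Finset.mem_union, mB, Finset.mem_insert, Finset.mem_singleton]
        grind
    · intro v hv
      have h1 := hsrc v (by omega)
      have h2 : src n ≠ src v := fun h => by
        have := hinj n (by omega) v (by omega) h
        omega
      have h3 := hl v (by omega)
      simp only [List.flatMap_cons, List.flatMap_nil, List.append_nil, List.cons_append,
        List.nil_append, avoids_cons, h3, and_true]
      refine ⟨⟨⟨h2, ?_⟩, ?_, ?_⟩, ⟨?_, ?_⟩, ?_, ?_⟩ <;> omega
    · intro v hv hvB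
      have h1 := hsrc v (by omega)
      rcases (mB _).1 hvB with h | h | h
      · exact hA v (by omega) h
      · have := hinj v (by omega) n (by omega) h.2
        omega
      · omega
    · intro z hz
      rcases (mB _).1 hz with h | h | h
      · have := hA' z h; omega
      · omega
      · omega

theorem flatMap_ite_perm {α : Type*} (n i : ℕ) (hi : i < n) (e : α) (f : ℕ → List α) :
    ((List.range n).flatMap fun v => (if v = i then [e] else []) ++ f v).Perm
      (e :: (List.range n).flatMap f) := by
  refine (List.flatMap_append_perm _ _ _).symm.trans ?_
  have : ∀ m, ((List.range m).flatMap fun v => if v = i then [e] else []) =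
      if i < m then [e] else [] := by
    intro m
    induction m with
    | zero => simp
    | succ m ih =>
      rw [List.range_succ, List.flatMap_append, ih]
      by_cases h : i < m
      · have : m ≠ i := by omega
        simp [h, this, show i < m + 1 by omega]
      · by_cases h' : m = i
        · simp [h']
        · simp [h, h', show ¬ i < m + 1 by omega]
  rw [this, if_pos hi]
  simp

/-- Up to the extra edge from `old + 2 * i` to `P`, a row with a cut edge is an ordinary row in
which the source of the variable `i` has moved to `Q`. -/
theorem litRow_core_perm {ν i : ℕ} (old P Q cur : ℕ) (hi : i < ν) :
    ((litRow ν i old P Q cur).flatMap GraphPart.core).Perm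
      ((old + 2 * i, P, 1) :: (List.range ν).flatMap fun v =>
        [(if v = i then Q else old + 2 * v, cur + 2 * v, 1),
          (cur + 2 * v, cur + 2 * v + 1, 1)]) := by
  refine List.Perm.trans (List.Perm.of_eq ?_) (flatMap_ite_perm ν i hi _ _)
  rw [litRow, List.flatMap_assoc]
  congr 1
  funext v
  by_cases h : v = i <;> simp [h, GraphPart.core]

/-- If `i ∈ X`, then `old + 2 * i` must take `P`, and `Q` must take the left vertex of the pair of
`i`, so both terminals have to be free. If `i ∉ X`, then `P` has no partner in this row, so the
terminals must already be covered. The Boolean `b` says whether the gadget of the clause has covered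
them. -/
theorem matchSum_litRow {ν i old P Q cur : ℕ} {X A : Finset ℕ} {l : List (ℕ × ℕ × ℤ)} (b : Bool)
    (hi : i < ν) (hX : X ⊆ Finset.range ν) (h1 : old + 2 * ν ≤ Q + 1) (h2 : Q < P) (h3 : P < cur)
    (hA : ∀ x ∈ A, (∀ v < ν, x ≠ old + 2 * v) ∧ x ≠ P ∧ x ≠ Q ∧ (x < cur ∨ cur + 2 * ν ≤ x))
    (hl : ∀ v < ν, Avoids l (old + 2 * v) ∧ Avoids l (cur + 2 * v)) (hP : Avoids l P)
    (hQ : Avoids l Q) :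
    matchSum ((litRow ν i old P Q cur).flatMap GraphPart.core ++ l)
      (A ∪ X.image (fun v => old + 2 * v) ∪ (if b then ∅ else {Q, P}) ∪
        Finset.Ico cur (cur + 2 * ν)) =
      if b = true ↔ i ∉ X then matchSum l (A ∪ X.image fun v => cur + 2 * v + 1) else 0 := by
  rw [matchSum_perm ((litRow_core_perm old P Q cur hi).append_right l), List.cons_append]
  set l' := ((List.range ν).flatMap fun v =>
        [(if v = i then Q else old + 2 * v, cur + 2 * v, (1 : ℤ)),
          (cur + 2 * v, cur + 2 * v + 1, 1)]) ++ l with hl'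
  have av : ∀ x, Avoids l x → x < cur → x ≠ Q → (∀ v < ν, v ≠ i → x ≠ old + 2 * v) →
      Avoids l' x := by
    intro x hx hxc hxQ hxo
    refine avoids_append.2 ⟨?_, hx⟩
    intro e he
    simp only [List.mem_flatMap, List.mem_range, List.mem_cons, List.not_mem_nil, or_false] at he
    obtain ⟨v, hv, rfl | rfl⟩ := he
    · split_ifs with h
      · exact ⟨hxQ.symm, by simp only; omega⟩
      · exact ⟨(hxo v hv h).symm, by simp only; omega⟩
    · simp only; omega
  have avq : Avoids l' (old + 2 * i) :=
    av _ (hl i hi).1 (by omega) (by omega) (fun v _ hvi => by omega)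
  have avP : Avoids l' P := av _ hP (by omega) (by omega) (fun v hv _ => by omega)
  have hXlt : ∀ v ∈ X, v < ν := fun v hv => Finset.mem_range.1 (hX hv)
  have key : matchSum l' (A ∪ X.image (fun v => if v = i then Q else old + 2 * v) ∪
      Finset.Ico cur (cur + 2 * ν)) = matchSum l (A ∪ X.image fun v => cur + 2 * v + 1) := by
    refine matchSum_shift ν cur (fun v => if v = i then Q else old + 2 * v) X A l hX ?_ ?_ ?_ ?_ ?_
    · intro v hv; split_ifs <;> omega
    · intro v hv w hw h
      split_ifs at h <;> omega
    · intro v hv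
      refine ⟨?_, (hl v hv).2⟩
      split_ifs
      · exact hQ
      · exact (hl v hv).1
    · intro v hv h
      split_ifs at h
      · exact (hA _ h).2.2.1 rfl
      · exact (hA _ h).1 v hv rfl
    · exact fun x hx => (hA x hx).2.2.2
  have mq : ∀ (T : Finset ℕ), T ⊆ {Q, P} → (old + 2 * i ∈ A ∪ X.image (fun v => old + 2 * v) ∪ T ∪
      Finset.Ico cur (cur + 2 * ν) ↔ i ∈ X) := by
    intro T hT
    simp only [Finset.mem_union, Finset.mem_image, Finset.mem_Ico]
    constructor
    · rintro (((h | ⟨v, hv, h⟩) | h) | h)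
      · exact absurd rfl ((hA _ h).1 i hi)
      · obtain rfl : v = i := by omega
        exact hv
      · have := hT h
        simp only [Finset.mem_insert, Finset.mem_singleton] at this
        omega
      · omega
    · exact fun h => Or.inl (Or.inl (Or.inr ⟨i, h, rfl⟩))
  have nP : P ∉ A ∪ X.image (fun v => old + 2 * v) ∪ ∅ ∪ Finset.Ico cur (cur + 2 * ν) := by
    simp only [Finset.mem_union, Finset.mem_image, Finset.mem_Ico, Finset.notMem_empty]
    rintro (((h | ⟨v, hv, h⟩) | h) | h)
    · exact (hA _ h).2.1 rfl
    · have := hXlt v hv; omega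
    · exact h
    · omega
  have img : ∀ z, z ∈ X.image (fun v => if v = i then Q else old + 2 * v) ↔
      (z = Q ∧ i ∈ X) ∨ (z ≠ old + 2 * i ∧ z ∈ X.image fun v => old + 2 * v) := by
    intro z
    simp only [Finset.mem_image]
    constructor
    · rintro ⟨v, hv, rfl⟩
      split_ifs with h
      · exact Or.inl ⟨rfl, h ▸ hv⟩
      · exact Or.inr ⟨by omega, v, hv, rfl⟩
    · rintro (⟨rfl, h⟩ | ⟨hz, v, hv, rfl⟩)
      · exact ⟨i, h, by simp⟩
      · exact ⟨v, hv, by rw [if_neg]; omega⟩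
  have im : ∀ z ∈ X.image (fun v => old + 2 * v), z < P := by
    intro z hz
    obtain ⟨v, hv, rfl⟩ := Finset.mem_image.1 hz
    have := hXlt v hv
    omega
  cases b with
  | false =>
    simp only [Bool.false_eq_true, if_false, false_iff, not_not]
    by_cases hiX : i ∈ X
    · rw [if_pos hiX, matchSum_leaf ((mq _ subset_rfl).2 hiX) (by simp) avq, one_mul, ← key]
      congr 1
      ext z
      simp only [Finset.mem_sdiff, Finset.mem_union, img, Finset.mem_insert, Finset.mem_singleton,
        Finset.mem_Ico, hiX, and_true]
      have a1 := im z
      have a2 : z ∈ A → z ≠ old + 2 * i ∧ z ≠ P := fun hz => ⟨(hA z hz).1 i hi, (hA z hz).2.1⟩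
      clear key img im mq nP hA hl avq avP av
      grind
    · rw [if_neg hiX, matchSum_cons_left (fun h => hiX ((mq _ subset_rfl).1 h)),
        matchSum_eq_zero (u := P) (by simp) avP]
  | true =>
    simp only [if_true, true_iff]
    by_cases hiX : i ∈ X
    · rw [matchSum_cons_right nP, if_neg (not_not.2 hiX),
        matchSum_eq_zero ((mq ∅ (Finset.empty_subset _)).2 hiX) avq]
    · rw [if_pos hiX, matchSum_cons_left (fun h => hiX ((mq _ (Finset.empty_subset _)).1 h)), ← key]
      congr 1
      ext z
      have a1 : z ∈ X.image (fun v => old + 2 * v) → z ≠ old + 2 * i := by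
        rintro hz rfl
        obtain ⟨v, hv, h⟩ := Finset.mem_image.1 hz
        obtain rfl : v = i := by omega
        exact hiX hv
      simp only [Finset.mem_union, img, hiX, and_false, false_or, Finset.notMem_empty, or_false]
      clear key img im mq nP hA hl avq avP av
      tauto

/-- Each vertex on the left has a single edge, so the matching is unique. -/
theorem matchSum_pairs (n f : ℕ) (hf : 2 * n ≤ f) (X : Finset ℕ) (hX : X ⊆ Finset.range n) :
    matchSum ((List.range n).map fun v => (2 * v, f + 2 * v + 1, (1 : ℤ)))
      (X.image (fun v => 2 * v) ∪ X.image fun v => f + 2 * v + 1) = 1 := by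
  induction n generalizing X with
  | zero =>
    obtain rfl : X = ∅ := by simpa using hX
    simp [matchSum]
  | succ n ih =>
    have hX' : X.erase n ⊆ Finset.range n := by
      intro v hv
      have h1 := Finset.mem_erase.1 hv
      have h2 := Finset.mem_range.1 (hX h1.2)
      exact Finset.mem_range.2 (by omega)
    have hp : ((List.range (n + 1)).map fun v => (2 * v, f + 2 * v + 1, (1 : ℤ))).Perm
        ((2 * n, f + 2 * n + 1, 1) :: (List.range n).map fun v => (2 * v, f + 2 * v + 1, (1 : ℤ))) := by
      rw [List.range_succ, List.map_append]
      exact List.perm_append_comm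
    have hav : Avoids ((List.range n).map fun v => (2 * v, f + 2 * v + 1, (1 : ℤ))) (2 * n) := by
      intro e he
      obtain ⟨v, hv, rfl⟩ := List.mem_map.1 he
      have := List.mem_range.1 hv
      simp only; omega
    rw [matchSum_perm hp]
    by_cases hn : n ∈ X
    · rw [matchSum_leaf (Finset.mem_union_left _ (Finset.mem_image_of_mem _ hn))
        (Finset.mem_union_right _ (Finset.mem_image_of_mem (fun v => f + 2 * v + 1) hn)) hav,
        one_mul]
      refine Eq.trans (congrArg _ ?_) (ih (by omega) (X.erase n) hX')
      ext z
      simp only [Finset.mem_sdiff, Finset.mem_union, Finset.mem_image, Finset.mem_insert,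
        Finset.mem_singleton, Finset.mem_erase]
      constructor
      · rintro ⟨⟨v, hv, rfl⟩ | ⟨v, hv, rfl⟩, h⟩
        · exact Or.inl ⟨v, ⟨by omega, hv⟩, rfl⟩
        · exact Or.inr ⟨v, ⟨by omega, hv⟩, rfl⟩
      · rintro (⟨v, hv, rfl⟩ | ⟨v, hv, rfl⟩)
        · have := Finset.mem_range.1 (hX hv.2)
          exact ⟨Or.inl ⟨v, hv.2, rfl⟩, by omega⟩
        · have := Finset.mem_range.1 (hX hv.2)
          exact ⟨Or.inr ⟨v, hv.2, rfl⟩, by omega⟩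
    · rw [matchSum_cons_left]
      · rw [Finset.erase_eq_of_notMem hn] at hX'
        exact ih (by omega) X hX'
      · simp only [Finset.mem_union, Finset.mem_image]
        rintro (⟨v, hv, h⟩ | ⟨v, hv, h⟩)
        · obtain rfl : v = n := by omega
          exact hn hv
        · omega

/-- Here the assignment is chosen: `X` is the set of pairs not matched by their own edge. Of such a
pair, `2 * v` waits for the last row and `2 * v + 1` is handed to the next one. -/
theorem matchSum_free_pairs (n : ℕ) (l : List (ℕ × ℕ × ℤ)) (D : Finset ℕ)
    (hD : ∀ x ∈ D, 2 * n ≤ x) :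
    matchSum (((List.range n).map fun v => (2 * v, 2 * v + 1, (1 : ℤ))) ++ l)
      (Finset.Ico 0 (2 * n) ∪ D) =
      ∑ X ∈ (Finset.range n).powerset,
        matchSum l (X.image (fun v => 2 * v) ∪ X.image (fun v => 2 * v + 1) ∪ D) := by
  induction n generalizing l D with
  | zero => simp
  | succ n ih =>
    rw [List.range_succ, List.map_append, List.append_assoc, List.map_singleton,
      List.singleton_append, Finset.range_add_one, Finset.sum_powerset_insert (by simp)]
    have e : Finset.Ico 0 (2 * (n + 1)) ∪ D =
        Finset.Ico 0 (2 * n) ∪ ({2 * n, 2 * n + 1} ∪ D) := by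
      ext z
      simp only [Finset.mem_union, Finset.mem_Ico, Finset.mem_insert, Finset.mem_singleton]
      have : (0 ≤ z ∧ z < 2 * (n + 1)) ↔
          (0 ≤ z ∧ z < 2 * n) ∨ (z = 2 * n ∨ z = 2 * n + 1) := by omega
      rw [this]
      tauto
    rw [e, ih, ← Finset.sum_add_distrib]
    · refine Finset.sum_congr rfl fun X hX => ?_
      have hXlt : ∀ v ∈ X, v < n := fun v hv => Finset.mem_range.1 (Finset.mem_powerset.1 hX hv)
      rw [matchSum_cons_of_mem (by simp) (by simp), one_mul, add_comm]
      congr 2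
      · ext z
        simp only [Finset.mem_sdiff, Finset.mem_union, Finset.mem_image, Finset.mem_insert,
          Finset.mem_singleton]
        constructor
        · rintro ⟨(h | h) | (h | h), hn⟩
          · exact Or.inl (Or.inl h)
          · exact Or.inl (Or.inr h)
          · exact absurd h hn
          · exact Or.inr h
        · rintro ((⟨v, hv, rfl⟩ | ⟨v, hv, rfl⟩) | h)
          · have := hXlt v hv
            exact ⟨Or.inl (Or.inl ⟨v, hv, rfl⟩), by omega⟩
          · have := hXlt v hv
            exact ⟨Or.inl (Or.inr ⟨v, hv, rfl⟩), by omega⟩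
          · have := hD z h
            exact ⟨Or.inr (Or.inr h), by omega⟩
      · rw [Finset.image_insert, Finset.image_insert]
        ext z
        simp only [Finset.mem_union, Finset.mem_insert, Finset.mem_singleton]
        tauto
    · intro x hx
      simp only [Finset.mem_union, Finset.mem_insert, Finset.mem_singleton] at hx
      rcases hx with (h | h) | h
      · omega
      · omega
      · have := hD x h; omega

/-! ### Vertices that later rows can meet. -/

/-- An end of an edge of the parts from the row that starts at `s` on. -/
def IsTailEnd (ν s x : ℕ) : Prop :=
  (∃ v < ν, x = 2 * v) ∨ (∃ v < ν, x = s + 2 * v + 1) ∨ s + 2 * ν ≤ x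

theorem litRow_core_ends {ν i old P Q cur : ℕ} {e : ℕ × ℕ × ℤ}
    (he : e ∈ (litRow ν i old P Q cur).flatMap GraphPart.core) {x : ℕ} (hx : x = e.1 ∨ x = e.2.1) :
    (∃ v < ν, x = old + 2 * v) ∨ x = P ∨ x = Q ∨ cur ≤ x := by
  rw [litRow, List.flatMap_assoc, List.mem_flatMap] at he
  obtain ⟨v, hv, he⟩ := he
  have hv' := List.mem_range.1 hv
  by_cases h : v = i
  · subst h
    simp [GraphPart.core] at he
    rcases he with rfl | rfl | rfl <;> simp only at hx
    · rcases hx with rfl | rfl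
      · exact Or.inl ⟨v, hv', rfl⟩
      · exact Or.inr (Or.inl rfl)
    · omega
    · omega
  · simp [h, GraphPart.core] at he
    rcases he with rfl | rfl <;> simp only at hx
    · rcases hx with rfl | rfl
      · exact Or.inl ⟨v, hv', rfl⟩
      · omega
    · omega

/-- Rows reach back only to the right vertices of the preceding row. The exception is the last row,
which returns to the left vertices `2 * v` of the first. -/
theorem tailParts_ends (ν : ℕ) (cs : List (ℕ × ℕ)) (s : ℕ) {e : ℕ × ℕ × ℤ}
    (he : e ∈ (tailParts ν cs s).flatMap GraphPart.core) {x : ℕ} (hx : x = e.1 ∨ x = e.2.1) :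
    IsTailEnd ν s x := by
  induction cs generalizing s with
  | nil =>
    simp only [tailParts, finalParts, List.flatMap_append, List.mem_append, List.flatMap_assoc,
      List.mem_flatMap, List.mem_range, List.mem_cons, List.not_mem_nil, or_false,
      exists_eq_or_imp, exists_eq_left] at he
    simp [GraphPart.core] at he
    rcases he with (rfl | ⟨v, hv, rfl | rfl | rfl⟩) | rfl <;> simp only at hx
    · exact Or.inr (Or.inr (by omega))
    · rcases hx with rfl | rfl
      · exact Or.inr (Or.inl ⟨v, hv, by omega⟩)
      · exact Or.inr (Or.inr (by omega))
    · exact Or.inr (Or.inr (by omega))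
    · rcases hx with rfl | rfl
      · exact Or.inl ⟨v, hv, rfl⟩
      · exact Or.inr (Or.inr (by omega))
    · exact Or.inr (Or.inr (by omega))
  | cons c cs ih =>
    rw [tailParts, List.flatMap_append, List.mem_append] at he
    rcases he with he | he
    · simp only [clauseParts, List.flatMap_append, List.mem_append] at he
      rcases he with ((he | he) | he) | he
      · simp [GraphPart.core] at he
        subst he
        exact Or.inr (Or.inr (by simp only at hx; omega))
      · rcases litRow_core_ends he hx with ⟨v, hv, rfl⟩ | h
        · exact Or.inr (Or.inl ⟨v, hv, by omega⟩)
        · exact Or.inr (Or.inr (by omega))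
      · simp [GraphPart.core] at he
        refine Or.inr (Or.inr ?_)
        rcases he with rfl | rfl | rfl | rfl | rfl | rfl | rfl | rfl <;> simp only at hx <;> omega
      · refine Or.inr (Or.inr ?_)
        rcases litRow_core_ends he hx with ⟨v, hv, rfl⟩ | h <;> omega
    · rcases ih _ he with h | ⟨v, hv, rfl⟩ | h
      · exact Or.inl h
      · exact Or.inr (Or.inr (by omega))
      · exact Or.inr (Or.inr (by omega))

theorem avoids_tailParts {ν : ℕ} {cs : List (ℕ × ℕ)} {s x : ℕ} (h : ¬ IsTailEnd ν s x) :
    Avoids ((tailParts ν cs s).flatMap GraphPart.core) x := fun _ he =>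
  ⟨fun hx => h (tailParts_ends ν cs s he (Or.inl hx.symm)),
    fun hx => h (tailParts_ends ν cs s he (Or.inr hx.symm))⟩

theorem avoids_litRow {ν i old P Q cur x : ℕ} (h1 : ∀ v < ν, x ≠ old + 2 * v) (h2 : x ≠ P)
    (h3 : x ≠ Q) (h4 : x < cur) :
    Avoids ((litRow ν i old P Q cur).flatMap GraphPart.core) x := by
  have : ¬ ((∃ v < ν, x = old + 2 * v) ∨ x = P ∨ x = Q ∨ cur ≤ x) := by
    rintro (⟨v, hv, h⟩ | h | h | h)
    · exact h1 v hv h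
    · exact h2 h
    · exact h3 h
    · omega
  exact fun _ he => ⟨fun hx => this (litRow_core_ends he (Or.inl hx.symm)),
    fun hx => this (litRow_core_ends he (Or.inr hx.symm))⟩

/-- Ends of wires are left in the form `m + 1` that `core` produces, so that `abel`, applied to
multisets, sees the same terms on both sides. -/
theorem clauseParts_core_perm_aux (ν : ℕ) (c : ℕ × ℕ) (s : ℕ) (l : List (ℕ × ℕ × ℤ)) :
    ((clauseParts ν c s).flatMap GraphPart.core ++ l).Perm
      ((s + 2 * ν, s + 4 * ν + 4, 1) :: (s + 2 * ν + 1, s + 4 * ν + 4, 1) ::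
        (s + 4 * ν + 2, s + 4 * ν + 4, 1) :: (s + 4 * ν + 4, s + 4 * ν + 4 + 1, -1) ::
        (s + 2 * ν, s + 4 * ν + 3, 1) :: (s + 2 * ν + 1, s + 4 * ν + 3, 1) ::
        (s + 4 * ν + 2, s + 4 * ν + 2 + 1, -1) :: (s + 4 * ν + 3, s + 4 * ν + 5, 1) ::
        (s + 2 * ν, s + 2 * ν + 1, 1) ::
        ((litRow ν c.1 (s + 1) (s + 2 * ν + 1) (s + 2 * ν) (s + 2 * ν + 2)).flatMap GraphPart.core ++
        ((litRow ν c.2 (s + 2 * ν + 3) (s + 4 * ν + 5) (s + 4 * ν + 2) (s + 4 * ν + 6)).flatMap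
          GraphPart.core ++ l))) := by
  have w1 : ∀ m, (GraphPart.wire m 1).core = [(m, m + 1, -1)] := fun m => by
    norm_num [GraphPart.core]
  have w2 : ∀ m, (GraphPart.wire m 2).core = [] := fun m => by norm_num [GraphPart.core]
  have w3 : ∀ m, (GraphPart.wire m 3).core = [(m, m + 1, 1)] := fun m => by
    norm_num [GraphPart.core]
  have j : ∀ m m', (GraphPart.jump m m').core = [(m, m', 1)] := fun _ _ => rfl
  rw [← Multiset.coe_eq_coe]
  simp only [clauseParts, List.flatMap_append, ← Multiset.coe_add, List.flatMap_cons,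
    List.flatMap_nil, w1, w2, w3, j, ← Multiset.cons_coe, Multiset.coe_nil,
    ← Multiset.singleton_add]
  abel

theorem clauseParts_core_perm (ν : ℕ) (c : ℕ × ℕ) (s : ℕ) (l : List (ℕ × ℕ × ℤ)) :
    ((clauseParts ν c s).flatMap GraphPart.core ++ l).Perm
      ((s + 2 * ν, s + 4 * ν + 4, 1) :: (s + 2 * ν + 1, s + 4 * ν + 4, 1) ::
        (s + 4 * ν + 2, s + 4 * ν + 4, 1) :: (s + 4 * ν + 4, s + 4 * ν + 5, -1) ::
        (s + 2 * ν, s + 4 * ν + 3, 1) :: (s + 2 * ν + 1, s + 4 * ν + 3, 1) ::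
        (s + 4 * ν + 2, s + 4 * ν + 3, -1) :: (s + 4 * ν + 3, s + 4 * ν + 5, 1) ::
        (s + 2 * ν, s + 2 * ν + 1, 1) ::
        ((litRow ν c.1 (s + 1) (s + 2 * ν + 1) (s + 2 * ν) (s + 2 * ν + 2)).flatMap GraphPart.core ++
        ((litRow ν c.2 (s + 2 * ν + 3) (s + 4 * ν + 5) (s + 4 * ν + 2) (s + 4 * ν + 6)).flatMap
          GraphPart.core ++ l))) :=
  clauseParts_core_perm_aux ν c s l

theorem matchSum_clauseParts {ν s E : ℕ} {c : ℕ × ℕ} {X : Finset ℕ} {l : List (ℕ × ℕ × ℤ)}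
    (hs : Even s) (hc1 : c.1 < ν) (hc2 : c.2 < ν) (hX : X ⊆ Finset.range ν)
    (hE : s + 4 * ν + 6 + 2 * ν ≤ E) (hl : ∀ x, ¬ IsTailEnd ν (s + 4 * ν + 6) x → Avoids l x) :
    matchSum ((clauseParts ν c s).flatMap GraphPart.core ++ l)
      (X.image (fun v => 2 * v) ∪ X.image (fun v => s + 2 * v + 1) ∪ Finset.Ico (s + 2 * ν) E) =
    2 * ((if c.1 ∉ X ∨ c.2 ∉ X then 1 else 0) *
      matchSum l (X.image (fun v => 2 * v) ∪ X.image (fun v => s + 4 * ν + 6 + 2 * v + 1) ∪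
        Finset.Ico (s + 4 * ν + 6 + 2 * ν) E)) := by
  obtain ⟨s', rfl⟩ := hs
  set s := s' + s' with hs
  have hXlt : ∀ v ∈ X, v < ν := fun v hv => Finset.mem_range.1 (hX hv)
  have p0 : ∀ x ∈ X.image (fun v => 2 * v), x < 2 * ν ∧ x % 2 = 0 := by
    intro x hx
    obtain ⟨v, hv, rfl⟩ := Finset.mem_image.1 hx
    have := hXlt v hv
    omega
  have q0 : ∀ x ∈ X.image (fun v => s + 2 * v + 1), x < s + 2 * ν ∧ s < x := by
    intro x hx
    obtain ⟨v, hv, rfl⟩ := Finset.mem_image.1 hx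
    have := hXlt v hv
    omega
  -- The later edges meet vertices before the end of the next row only at `2 * v` with `v < ν` and
  -- at the odd vertices of that row.
  have hend : ∀ x, 2 * ν ≤ x ∨ x % 2 = 1 → x < s + 4 * ν + 6 + 2 * ν →
      x < s + 4 * ν + 6 ∨ x % 2 = 0 → Avoids l x := by
    intro x h1 h2 h3
    refine hl x ?_
    rintro (⟨v, hv, rfl⟩ | ⟨v, hv, rfl⟩ | h) <;> omega
  rw [matchSum_perm (clauseParts_core_perm ν c s l)]
  set l2 := (litRow ν c.2 (s + 2 * ν + 3) (s + 4 * ν + 5) (s + 4 * ν + 2) (s + 4 * ν + 6)).flatMap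
    GraphPart.core ++ l with hl2
  set l1 := (litRow ν c.1 (s + 1) (s + 2 * ν + 1) (s + 2 * ν) (s + 2 * ν + 2)).flatMap
    GraphPart.core ++ l2 with hl1
  have av2 : ∀ x, 2 * ν ≤ x ∨ x % 2 = 1 → x < s + 4 * ν + 6 → x ≠ s + 4 * ν + 2 →
      x ≠ s + 4 * ν + 5 → (∀ v < ν, x ≠ s + 2 * ν + 3 + 2 * v) → Avoids l2 x :=
    fun x h1 h2 h3 h4 h5 => avoids_append.2
      ⟨avoids_litRow h5 h4 h3 h2, hend x h1 (by omega) (by omega)⟩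
  have av1 : ∀ x, s + 4 * ν + 3 ≤ x → x ≤ s + 4 * ν + 4 → Avoids l1 x := by
    intro x h1 h2
    have hx2 : Avoids l2 x := av2 x (by omega) (by omega) (by omega) (by omega)
      (fun v hv => by omega)
    refine avoids_append.2 ⟨?_, hx2⟩
    intro e he
    have hlit : ∀ y, (∃ v < ν, y = s + 1 + 2 * v) ∨ y = s + 2 * ν ∨ y = s + 2 * ν + 1 ∨
        (s + 2 * ν + 2 ≤ y ∧ y < s + 4 * ν + 2) → y ≠ x := by
      rintro y (⟨v, hv, rfl⟩ | h | h | h) <;> omega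
    rw [(litRow_core_perm _ _ _ _ hc1).mem_iff] at he
    simp only [List.mem_cons, List.mem_flatMap, List.mem_range, List.not_mem_nil, or_false] at he
    rcases he with rfl | ⟨v, hv, rfl | rfl⟩
    · exact ⟨hlit _ (Or.inl ⟨_, hc1, rfl⟩), hlit _ (by simp)⟩
    · refine ⟨?_, hlit _ (by simp only; omega)⟩
      simp only
      split_ifs
      · exact hlit _ (by simp)
      · exact hlit _ (Or.inl ⟨v, hv, rfl⟩)
    · exact ⟨hlit _ (by simp only; omega), hlit _ (by simp only; omega)⟩
  have eo : ∀ a : ℕ, (fun v => a + 1 + 2 * v) = fun v => a + 2 * v + 1 := by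
    intro a; funext v; omega
  -- The Booleans record whether the gadget has covered the terminals of the first and of the second
  -- literal; the rows are then evaluated one after the other.
  have step : ∀ b₁ b₂ : Bool,
      matchSum l1 (X.image (fun v => 2 * v) ∪ X.image (fun v => s + 2 * v + 1) ∪
        (if b₁ then ∅ else {s + 2 * ν, s + 2 * ν + 1}) ∪
        (if b₂ then ∅ else {s + 4 * ν + 2, s + 4 * ν + 5}) ∪
        Finset.Ico (s + 2 * ν + 2) (s + 4 * ν + 2) ∪ Finset.Ico (s + 4 * ν + 6) E) =
      if (b₁ = true ↔ c.1 ∉ X) ∧ (b₂ = true ↔ c.2 ∉ X) then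
        matchSum l (X.image (fun v => 2 * v) ∪ X.image (fun v => s + 4 * ν + 6 + 2 * v + 1) ∪
          Finset.Ico (s + 4 * ν + 6 + 2 * ν) E) else 0 := by
    intro b₁ b₂
    have hB : ∀ x ∈ (if b₂ then ∅ else {s + 4 * ν + 2, s + 4 * ν + 5} : Finset ℕ),
        x = s + 4 * ν + 2 ∨ x = s + 4 * ν + 5 := by
      intro x hx
      split_ifs at hx
      · simp at hx
      · simpa using hx
    have e1 : X.image (fun v => 2 * v) ∪ X.image (fun v => s + 2 * v + 1) ∪
        (if b₁ then ∅ else {s + 2 * ν, s + 2 * ν + 1}) ∪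
        (if b₂ then ∅ else {s + 4 * ν + 2, s + 4 * ν + 5}) ∪
        Finset.Ico (s + 2 * ν + 2) (s + 4 * ν + 2) ∪ Finset.Ico (s + 4 * ν + 6) E =
      (X.image (fun v => 2 * v) ∪ (if b₂ then ∅ else {s + 4 * ν + 2, s + 4 * ν + 5}) ∪
        Finset.Ico (s + 4 * ν + 6) E) ∪ X.image (fun v => s + 1 + 2 * v) ∪
        (if b₁ then ∅ else {s + 2 * ν, s + 2 * ν + 1}) ∪
        Finset.Ico (s + 2 * ν + 2) (s + 2 * ν + 2 + 2 * ν) := by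
      rw [eo, show s + 2 * ν + 2 + 2 * ν = s + 4 * ν + 2 by ring]
      ext z
      simp only [Finset.mem_union]
      tauto
    have e2 : (X.image (fun v => 2 * v) ∪ (if b₂ then ∅ else {s + 4 * ν + 2, s + 4 * ν + 5}) ∪
        Finset.Ico (s + 4 * ν + 6) E) ∪ X.image (fun v => s + 2 * ν + 2 + 2 * v + 1) =
      (X.image (fun v => 2 * v) ∪ Finset.Ico (s + 4 * ν + 6 + 2 * ν) E) ∪
        X.image (fun v => s + 2 * ν + 3 + 2 * v) ∪
        (if b₂ then ∅ else {s + 4 * ν + 2, s + 4 * ν + 5}) ∪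
        Finset.Ico (s + 4 * ν + 6) (s + 4 * ν + 6 + 2 * ν) := by
      rw [show s + 2 * ν + 3 = s + 2 * ν + 2 + 1 by ring, eo,
        ← Finset.Ico_union_Ico_eq_Ico (show s + 4 * ν + 6 ≤ s + 4 * ν + 6 + 2 * ν by omega) hE]
      ext z
      simp only [Finset.mem_union]
      tauto
    have e3 : (X.image (fun v => 2 * v) ∪ Finset.Ico (s + 4 * ν + 6 + 2 * ν) E) ∪
        X.image (fun v => s + 4 * ν + 6 + 2 * v + 1) =
      X.image (fun v => 2 * v) ∪ X.image (fun v => s + 4 * ν + 6 + 2 * v + 1) ∪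
        Finset.Ico (s + 4 * ν + 6 + 2 * ν) E := by
      ext z
      simp only [Finset.mem_union]
      tauto
    rw [e1, hl1, matchSum_litRow b₁ hc1 hX (by omega) (by omega) (by omega)]
    · by_cases h1 : b₁ = true ↔ c.1 ∉ X
      · rw [if_pos h1, e2, hl2, matchSum_litRow b₂ hc2 hX (by omega) (by omega) (by omega)]
        · simp only [h1, true_and, e3]
        · intro x hx
          rcases Finset.mem_union.1 hx with h | h
          · have := p0 x h
            exact ⟨fun v hv => by omega, by omega, by omega, by omega⟩
          · have := Finset.mem_Ico.1 h
            exact ⟨fun v hv => by omega, by omega, by omega, by omega⟩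
        · exact fun v hv => ⟨hend _ (by omega) (by omega) (by omega),
            hend _ (by omega) (by omega) (by omega)⟩
        · exact hend _ (by omega) (by omega) (by omega)
        · exact hend _ (by omega) (by omega) (by omega)
      · rw [if_neg h1, if_neg (fun h => h1 h.1)]
    · intro x hx
      simp only [Finset.mem_union] at hx
      rcases hx with (h | h) | h
      · have := p0 x h
        exact ⟨fun v hv => by omega, by omega, by omega, by omega⟩
      · have := hB x h
        exact ⟨fun v hv => by omega, by omega, by omega, by omega⟩
      · have := Finset.mem_Ico.1 h
        exact ⟨fun v hv => by omega, by omega, by omega, by omega⟩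
    · exact fun v hv => ⟨av2 _ (by omega) (by omega) (by omega) (by omega) (fun w hw => by omega),
        av2 _ (by omega) (by omega) (by omega) (by omega) (fun w hw => by omega)⟩
    · exact av2 _ (by omega) (by omega) (by omega) (by omega) (fun w hw => by omega)
    · exact av2 _ (by omega) (by omega) (by omega) (by omega) (fun w hw => by omega)
  have hin : ∀ x, s + 2 * ν ≤ x → x < E → x ∈ X.image (fun v => 2 * v) ∪
      X.image (fun v => s + 2 * v + 1) ∪ Finset.Ico (s + 2 * ν) E := fun x h1 h2 =>
    Finset.mem_union_right _ (Finset.mem_Ico.2 ⟨h1, h2⟩)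
  rw [matchSum_clause]
  · have t1 := step true false
    have t2 := step false true
    have t3 := step true true
    simp only [Bool.false_eq_true, false_iff, true_iff, not_not, if_true, if_false] at t1 t2 t3
    -- The three sets left over by the gadget differ only in the terminals `T` and `T'` still free,
    -- so one identity of sets serves all three terms.
    have s1 := fun (T T' : Finset ℕ) (T'' : Finset ℕ)
      (h : ∀ z, s + 2 * ν ≤ z → z < E → (z ∉ T'' ↔ z ∈ T ∨ z ∈ T' ∨
        (s + 2 * ν + 2 ≤ z ∧ z < s + 4 * ν + 2) ∨ s + 4 * ν + 6 ≤ z))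
      (h2 : ∀ z ∈ T'', s + 2 * ν ≤ z) (h3 : ∀ z ∈ T, s + 2 * ν ≤ z ∧ z < E)
      (h4 : ∀ z ∈ T', s + 2 * ν ≤ z ∧ z < E) =>
      show (X.image (fun v => 2 * v) ∪ X.image (fun v => s + 2 * v + 1) ∪
          Finset.Ico (s + 2 * ν) E) \ T'' =
        X.image (fun v => 2 * v) ∪ X.image (fun v => s + 2 * v + 1) ∪ T ∪ T' ∪
          Finset.Ico (s + 2 * ν + 2) (s + 4 * ν + 2) ∪ Finset.Ico (s + 4 * ν + 6) E by
        ext z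
        have a1 := p0 z
        have a2 := q0 z
        have a3 := h z
        have a4 := h2 z
        have a5 := h3 z
        have a6 := h4 z
        simp only [Finset.mem_sdiff, Finset.mem_union, Finset.mem_Ico]
        clear t1 t2 t3 hin step eo av1 av2 hend q0 p0 hl h h2 h3 h4
        grind
    rw [s1 ∅ {s + 4 * ν + 2, s + 4 * ν + 5} _ ?_ ?_ ?_ ?_,
      s1 {s + 2 * ν, s + 2 * ν + 1} ∅ _ ?_ ?_ ?_ ?_, s1 ∅ ∅ _ ?_ ?_ ?_ ?_, t1, t2, t3]
    -- In each of the four cases at most one of the three terms is nonzero; if both variables lie in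
    -- `X`, all of them vanish.
    · by_cases h1 : c.1 ∈ X <;> by_cases h2 : c.2 ∈ X <;> simp [h1, h2]
    all_goals
      intro z
      simp only [Finset.mem_insert, Finset.mem_singleton, Finset.notMem_empty, false_or]
      first
        | omega
        | simp
  · intro x hx
    simp only [Finset.mem_insert, Finset.mem_singleton] at hx
    exact hin x (by omega) (by omega)
  · simp only [List.nodup_cons, List.mem_cons, List.not_mem_nil, or_false, List.nodup_nil, not_or,
      not_false_eq_true, and_true]
    omega
  · exact av1 _ (by omega) (by omega)
  · exact av1 _ (by omega) (by omega)

theorem finalParts_core_perm (ν s : ℕ) :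
    ((finalParts ν s).flatMap GraphPart.core).Perm
      ((s + 2 * ν, s + 2 * ν + 1, 1) :: (s + 4 * ν + 2, s + 4 * ν + 2 + 1, 1) ::
        (((List.range ν).flatMap fun v => [(s + 2 * v + 1, s + 2 * ν + 2 + 2 * v, 1),
          (s + 2 * ν + 2 + 2 * v, s + 2 * ν + 2 + 2 * v + 1, 1)]) ++
        (List.range ν).map fun v => (2 * v, s + 2 * ν + 2 + 2 * v + 1, 1))) := by
  have w2 : ∀ m, (GraphPart.wire m 2).core = [] := fun m => by norm_num [GraphPart.core]
  have w3 : ∀ m, (GraphPart.wire m 3).core = [(m, m + 1, 1)] := fun m => by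
    norm_num [GraphPart.core]
  have j : ∀ m m', (GraphPart.jump m m').core = [(m, m', 1)] := fun _ _ => rfl
  have h : ((List.range ν).flatMap fun v => [(s + 1 + 2 * v, s + 2 * ν + 2 + 2 * v, (1 : ℤ)),
      (s + 2 * ν + 2 + 2 * v, s + 2 * ν + 2 + 2 * v + 1, 1),
      (2 * v, s + 2 * ν + 2 + 2 * v + 1, 1)]).Perm
      (((List.range ν).flatMap fun v => [(s + 2 * v + 1, s + 2 * ν + 2 + 2 * v, 1),
          (s + 2 * ν + 2 + 2 * v, s + 2 * ν + 2 + 2 * v + 1, 1)]) ++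
        (List.range ν).map fun v => (2 * v, s + 2 * ν + 2 + 2 * v + 1, 1)) := by
    rw [List.map_eq_flatMap]
    refine List.Perm.trans (List.Perm.of_eq ?_) (List.flatMap_append_perm _ _ _).symm
    have : ∀ v, s + 1 + 2 * v = s + 2 * v + 1 := fun v => by omega
    simp only [this, List.cons_append, List.nil_append]
  simp only [finalParts, List.flatMap_append, List.flatMap_assoc, List.flatMap_cons,
    List.flatMap_nil, w2, w3, j, List.cons_append, List.nil_append]
  exact ((List.perm_append_comm.trans (h.cons _)).cons _)

/-- The last row copies `X` to its right vertices, which absorb the vertices `2 * v` left over from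
the first row; all of this is forced. The two additional pairs are matched internally. The one
before the row keeps its incoming jumps from joining consecutive vertices when `ν = 1`, and the
other provides an end for the last ladder of the row. -/
theorem matchSum_finalParts (ν s : ℕ) (hs : Even s) (X : Finset ℕ) (hX : X ⊆ Finset.range ν) :
    matchSum ((finalParts ν s).flatMap GraphPart.core)
      (X.image (fun v => 2 * v) ∪ X.image (fun v => s + 2 * v + 1) ∪
        Finset.Ico (s + 2 * ν) (s + 4 * ν + 4)) = 1 := by
  obtain ⟨s', rfl⟩ := hs
  set s := s' + s' with hs
  have hXlt : ∀ v ∈ X, v < ν := fun v hv => Finset.mem_range.1 (hX hv)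
  have p0 : ∀ x ∈ X.image (fun v => 2 * v), x < 2 * ν ∧ x % 2 = 0 := by
    intro x hx
    obtain ⟨v, hv, rfl⟩ := Finset.mem_image.1 hx
    have := hXlt v hv
    omega
  have q0 : ∀ x ∈ X.image (fun v => s + 2 * v + 1), x < s + 2 * ν ∧ s < x := by
    intro x hx
    obtain ⟨v, hv, rfl⟩ := Finset.mem_image.1 hx
    have := hXlt v hv
    omega
  rw [matchSum_perm (finalParts_core_perm ν s)]
  set l := (((List.range ν).flatMap fun v => [(s + 2 * v + 1, s + 2 * ν + 2 + 2 * v, (1 : ℤ)),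
          (s + 2 * ν + 2 + 2 * v, s + 2 * ν + 2 + 2 * v + 1, 1)]) ++
        (List.range ν).map fun v => (2 * v, s + 2 * ν + 2 + 2 * v + 1, 1)) with hl
  have ends : ∀ e ∈ l, ∀ x, e.1 = x ∨ e.2.1 = x →
      x < s + 2 * ν ∨ (s + 2 * ν + 2 ≤ x ∧ x < s + 4 * ν + 2) := by
    intro e he x hx
    simp only [hl, List.mem_append, List.mem_flatMap, List.mem_map, List.mem_range, List.mem_cons,
      List.not_mem_nil, or_false] at he
    rcases he with ⟨v, hv, rfl | rfl⟩ | ⟨v, hv, rfl⟩ <;> simp only at hx <;> omega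
  have av : ∀ x, ¬ (x < s + 2 * ν ∨ (s + 2 * ν + 2 ≤ x ∧ x < s + 4 * ν + 2)) → Avoids l x :=
    fun x hx e he => ⟨fun h => hx (ends e he x (Or.inl h)), fun h => hx (ends e he x (Or.inr h))⟩
  rw [matchSum_leaf (Finset.mem_union_right _ (Finset.mem_Ico.2 (by omega)))
    (Finset.mem_union_right _ (Finset.mem_Ico.2 (by omega)))
    (avoids_cons.2 ⟨by simp only; omega, av _ (by omega)⟩), one_mul,
    matchSum_leaf (Finset.mem_sdiff.2 ⟨Finset.mem_union_right _ (Finset.mem_Ico.2 (by omega)),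
      by simp only [Finset.mem_insert, Finset.mem_singleton]; omega⟩)
    (Finset.mem_sdiff.2 ⟨Finset.mem_union_right _ (Finset.mem_Ico.2 (by omega)),
      by simp only [Finset.mem_insert, Finset.mem_singleton]; omega⟩) (av _ (by omega)), one_mul]
  have e1 : ((X.image (fun v => 2 * v) ∪ X.image (fun v => s + 2 * v + 1) ∪
      Finset.Ico (s + 2 * ν) (s + 4 * ν + 4)) \ {s + 2 * ν, s + 2 * ν + 1}) \
      {s + 4 * ν + 2, s + 4 * ν + 2 + 1} =
      X.image (fun v => 2 * v) ∪ X.image (fun v => s + 2 * v + 1) ∪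
        Finset.Ico (s + 2 * ν + 2) (s + 2 * ν + 2 + 2 * ν) := by
    ext z
    have a1 := p0 z
    have a2 := q0 z
    simp only [Finset.mem_sdiff, Finset.mem_union, Finset.mem_Ico, Finset.mem_insert,
      Finset.mem_singleton]
    clear av ends hl q0 p0
    grind
  rw [e1, hl, matchSum_shift ν (s + 2 * ν + 2) (fun v => s + 2 * v + 1) X
    (X.image fun v => 2 * v) _ hX (fun v hv => by omega) (fun v _ w _ h => by omega)]
  · exact matchSum_pairs ν (s + 2 * ν + 2) (by omega) X hX
  · intro v hv
    constructor <;>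
    · intro e he
      obtain ⟨w, hw, rfl⟩ := List.mem_map.1 he
      have := List.mem_range.1 hw
      simp only
      omega
  · intro v hv h
    have := p0 _ h
    omega
  · intro x hx
    have := p0 x hx
    omega

/-- The number of main vertices of the parts from the row that starts at `s` on. -/
def coreEnd (ν : ℕ) (cs : List (ℕ × ℕ)) (s : ℕ) : ℕ := s + cs.length * (4 * ν + 6) + 4 * ν + 4

theorem coreEnd_cons (ν : ℕ) (c : ℕ × ℕ) (cs : List (ℕ × ℕ)) (s : ℕ) :
    coreEnd ν (c :: cs) s = coreEnd ν cs (s + 4 * ν + 6) := by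
  simp only [coreEnd, List.length_cons]; ring

theorem matchSum_tailParts (ν : ℕ) (cs : List (ℕ × ℕ)) (hcs : ∀ c ∈ cs, c.1 < ν ∧ c.2 < ν) (s : ℕ)
    (hs : Even s) (X : Finset ℕ) (hX : X ⊆ Finset.range ν) :
    matchSum ((tailParts ν cs s).flatMap GraphPart.core)
      (X.image (fun v => 2 * v) ∪ X.image (fun v => s + 2 * v + 1) ∪
        Finset.Ico (s + 2 * ν) (coreEnd ν cs s)) =
      2 ^ cs.length * if ∀ c ∈ cs, c.1 ∉ X ∨ c.2 ∉ X then 1 else 0 := by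
  induction cs generalizing s with
  | nil =>
    have := matchSum_finalParts ν s hs X hX
    simpa [tailParts, coreEnd] using this
  | cons c cs ih =>
    have hc := hcs c (by simp)
    rw [tailParts, List.flatMap_append, coreEnd_cons, matchSum_clauseParts hs hc.1 hc.2 hX
      (by simp only [coreEnd]; omega) (fun x hx => avoids_tailParts hx),
      ih (fun c hc => hcs c (by simp [hc])) _ (by
        have : s + 4 * ν + 6 = s + 2 * (2 * ν + 3) := by ring
        rw [this]
        exact hs.add (even_two_mul _))]
    simp only [List.forall_mem_cons, List.length_cons]
    by_cases h1 : c.1 ∉ X ∨ c.2 ∉ X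
    · simp only [h1, true_and, pow_succ, if_true]
      ring
    · simp only [h1, false_and, if_false, zero_mul, mul_zero]

/-- The first row sums over all `X`, and for each `X` the rest contributes 2 per clause if every
clause has a variable outside `X`, and 0 otherwise. -/
theorem matchSum_formulaParts (ν : ℕ) (cs : List (ℕ × ℕ)) (hcs : ∀ c ∈ cs, c.1 < ν ∧ c.2 < ν) :
    matchSum ((formulaParts ν cs).flatMap GraphPart.core) (Finset.range (coreEnd ν cs 0)) =
      2 ^ cs.length *
        (((Finset.range ν).powerset.filter fun X => ∀ c ∈ cs, c.1 ∉ X ∨ c.2 ∉ X).card : ℤ) := by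
  have e : (formulaParts ν cs).flatMap GraphPart.core =
      ((List.range ν).map fun v => (2 * v, 2 * v + 1, (1 : ℤ))) ++
        (tailParts ν cs 0).flatMap GraphPart.core := by
    rw [formulaParts, List.flatMap_append, List.flatMap_assoc, List.map_eq_flatMap]
    congr 2
  have e2 : Finset.range (coreEnd ν cs 0) =
      Finset.Ico 0 (2 * ν) ∪ Finset.Ico (2 * ν) (coreEnd ν cs 0) := by
    rw [Finset.Ico_union_Ico_eq_Ico (by omega) (by simp only [coreEnd]; omega), Finset.range_eq_Ico]
  rw [e, e2, matchSum_free_pairs _ _ _ (fun x hx => (Finset.mem_Ico.1 hx).1), Finset.card_filter]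
  push_cast
  rw [Finset.mul_sum]
  refine Finset.sum_congr rfl fun X hX => ?_
  have := matchSum_tailParts ν cs hcs 0 (by simp) X (Finset.mem_powerset.1 hX)
  simpa using this

/-! ### Satisfying assignments as sets of false variables. -/

/-- The clauses of a formula as pairs of numbers. -/
def MonotoneTwoSat.clausePairs (φ : MonotoneTwoSat) : List (ℕ × ℕ) :=
  φ.clauses.map fun c => ((c.1 : ℕ), (c.2 : ℕ))

theorem MonotoneTwoSat.clausePairs_lt (φ : MonotoneTwoSat) :
    ∀ c ∈ φ.clausePairs, c.1 < φ.numVars ∧ c.2 < φ.numVars := by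
  intro c hc
  obtain ⟨d, _, rfl⟩ := List.mem_map.1 hc
  exact ⟨d.1.2, d.2.2⟩

/-- Satisfying assignments are counted by their sets of false variables. -/
theorem MonotoneTwoSat.card_eq_numSat (φ : MonotoneTwoSat) :
    ((Finset.range φ.numVars).powerset.filter fun X =>
      ∀ c ∈ φ.clausePairs, c.1 ∉ X ∨ c.2 ∉ X).card = φ.numSat := by
  symm
  refine Finset.card_nbij'
    (fun a => (Finset.range φ.numVars).filter fun v => ∃ h : v < φ.numVars, a ⟨v, h⟩ = false)
    (fun X v => decide ((v : ℕ) ∉ X)) ?_ ?_ ?_ ?_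
  · intro a ha
    simp only [Finset.coe_filter, Finset.mem_univ, true_and, Set.mem_ofPred_eq] at ha
    simp only [Finset.coe_filter, Finset.mem_powerset, Finset.filter_subset, true_and,
      Set.mem_ofPred_eq]
    intro c hc
    obtain ⟨d, hd, rfl⟩ := List.mem_map.1 hc
    rcases ha d hd with h | h
    · left; simp [h]
    · right; simp [h]
  · intro X hX
    simp only [Finset.coe_filter, Finset.mem_powerset, Set.mem_ofPred_eq] at hX
    simp only [Finset.coe_filter, Finset.mem_univ, true_and, Set.mem_ofPred_eq]
    intro d hd
    have := hX.2 _ (List.mem_map_of_mem hd)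
    simpa using this
  · intro a _
    funext v
    cases h : a v <;> simp [h]
  · intro X hX
    simp only [Finset.coe_filter, Finset.mem_powerset, Set.mem_ofPred_eq] at hX
    ext v
    simp only [Finset.mem_filter, Finset.mem_range, decide_eq_false_iff_not, not_not]
    constructor
    · rintro ⟨_, _, h⟩; exact h
    · intro h
      have := Finset.mem_range.1 (hX.1 h)
      exact ⟨this, this, h⟩

/-! ### The ladders in the order of the main vertices. -/

theorem flatMap_pairs_eq_range' (n cur : ℕ) :
    ((List.range n).flatMap fun v => [cur + 2 * v, cur + 2 * v + 1]) =
      List.range' cur (2 * n) := by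
  induction n with
  | zero => rfl
  | succ n ih =>
    rw [List.range_succ, List.flatMap_append, ih, show 2 * (n + 1) = 2 * n + 1 + 1 by ring,
      List.range'_concat, List.range'_concat]
    simp [add_assoc]

theorem wires_litRow (ν i old P Q cur : ℕ) :
    GraphPart.wires (litRow ν i old P Q cur) = List.range' cur (2 * ν) := by
  rw [litRow, GraphPart.wires_flatMap, ← flatMap_pairs_eq_range']
  congr 1
  funext v
  by_cases h : v = i <;> simp [h, GraphPart.wires]

/-- A ladder starts at every main vertex except the last one, whence the `- 1`. The order is
increasing, which gives both the Hamiltonian path and the fact that no ladder is contracted twice.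
-/
theorem wires_tailParts (ν : ℕ) (cs : List (ℕ × ℕ)) (s : ℕ) :
    GraphPart.wires (tailParts ν cs s) =
      List.range' (s + 2 * ν) (coreEnd ν cs s - 1 - (s + 2 * ν)) := by
  have ap : ∀ a m n : ℕ, List.range' a m ++ List.range' (a + m) n = List.range' a (m + n) := by
    intro a m n; simp
  induction cs generalizing s with
  | nil =>
    have h : GraphPart.wires ((List.range ν).flatMap fun v =>
        [GraphPart.jump (s + 1 + 2 * v) (s + 2 * ν + 2 + 2 * v),
          GraphPart.wire (s + 2 * ν + 2 + 2 * v) 3,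
          GraphPart.jump (2 * v) (s + 2 * ν + 2 + 2 * v + 1),
          GraphPart.wire (s + 2 * ν + 2 + 2 * v + 1) 2]) = List.range' (s + 2 * ν + 2) (2 * ν) := by
      rw [GraphPart.wires_flatMap, ← flatMap_pairs_eq_range']
      rfl
    rw [tailParts, finalParts, GraphPart.wires_append, GraphPart.wires_append, h]
    have e1 : GraphPart.wires [GraphPart.wire (s + 2 * ν) 3, GraphPart.wire (s + 2 * ν + 1) 2] =
      List.range' (s + 2 * ν) 2 := rfl
    have e2 : GraphPart.wires [GraphPart.wire (s + 4 * ν + 2) 3] =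
      List.range' (s + 2 * ν + (2 + 2 * ν)) 1 := by
      rw [show s + 2 * ν + (2 + 2 * ν) = s + 4 * ν + 2 by ring]; rfl
    rw [e1, e2, ap, ap]
    congr 1
    simp [coreEnd]
    omega
  | cons c cs ih =>
    rw [tailParts, GraphPart.wires_append, ih, coreEnd_cons, clauseParts]
    simp only [GraphPart.wires_append, wires_litRow]
    have e1 : GraphPart.wires [GraphPart.wire (s + 2 * ν) 3, GraphPart.wire (s + 2 * ν + 1) 2] =
      List.range' (s + 2 * ν) 2 := rfl
    have hE : s + 6 * ν + 7 ≤ coreEnd ν cs (s + 4 * ν + 6) := by simp only [coreEnd]; omega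
    rw [e1, ap]
    simp only [GraphPart.wires]
    have e2 : [s + 4 * ν + 2, s + 4 * ν + 3, s + 4 * ν + 4, s + 4 * ν + 5] =
      List.range' (s + 2 * ν + (2 + 2 * ν)) 4 := by
      rw [show s + 2 * ν + (2 + 2 * ν) = s + 4 * ν + 2 by ring]; rfl
    rw [e2, ap, show s + 4 * ν + 6 = s + 2 * ν + (2 + 2 * ν + 4) by ring, ap,
      show s + 2 * ν + (2 + 2 * ν + 4) + 2 * ν = s + 2 * ν + (2 + 2 * ν + 4 + 2 * ν) by ring, ap]
    congr 1
    rw [show s + 2 * ν + (2 + 2 * ν + 4) = s + 4 * ν + 6 by ring]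
    omega

theorem wires_formulaParts (ν : ℕ) (cs : List (ℕ × ℕ)) :
    GraphPart.wires (formulaParts ν cs) = List.range (coreEnd ν cs 0 - 1) := by
  have h : GraphPart.wires ((List.range ν).flatMap fun v =>
      [GraphPart.wire (2 * v) 3, GraphPart.wire (2 * v + 1) 2]) = List.range' 0 (2 * ν) := by
    rw [GraphPart.wires_flatMap, ← flatMap_pairs_eq_range']
    simp [GraphPart.wires]
  have := List.range'_append (s := 0) (m := 2 * ν) (n := coreEnd ν cs 0 - 1 - 2 * ν) (step := 1)
  rw [formulaParts, GraphPart.wires_append, h, wires_tailParts, List.range_eq_range']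
  simp only [zero_add, one_mul] at this ⊢
  rw [this]
  congr 1
  simp only [coreEnd]
  omega

/-! ### Sums over perfect matchings as sums over lists of edges -/

section PerfectMatching

variable {V : Type*} [DecidableEq V]

/-- Every vertex of `S` lies on exactly one edge of `M`, and the other vertices on none. -/
def CoversExactly (M : Finset (Sym2 V)) (S : Finset V) : Prop :=
  ∀ x, (x ∈ S → ∃! e, e ∈ M ∧ x ∈ e) ∧ (x ∉ S → ∀ e ∈ M, x ∉ e)

/-- A new edge uses up its two ends, so the other edges cover exactly what remains. -/
theorem coversExactly_insert {M : Finset (Sym2 V)} {S : Finset V} {u v : V} (hM : s(u, v) ∉ M) :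
    CoversExactly (insert s(u, v) M) S ↔ u ∈ S ∧ v ∈ S ∧ CoversExactly M (S \ {u, v}) := by
  constructor
  · intro h
    refine ⟨?_, ?_, fun x => ⟨fun hx => ?_, fun hx e he hxe => ?_⟩⟩
    · by_contra hu
      exact (h u).2 hu _ (Finset.mem_insert_self _ _) (Sym2.mem_mk_left u v)
    · by_contra hv
      exact (h v).2 hv _ (Finset.mem_insert_self _ _) (Sym2.mem_mk_right u v)
    · simp only [Finset.mem_sdiff, Finset.mem_insert, Finset.mem_singleton, not_or] at hx
      obtain ⟨e, ⟨he, hxe⟩, huniq⟩ := (h x).1 hx.1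
      rcases Finset.mem_insert.1 he with rfl | he
      · simp [hx.2] at hxe
      · exact ⟨e, ⟨he, hxe⟩, fun f hf => huniq f ⟨Finset.mem_insert_of_mem hf.1, hf.2⟩⟩
    · by_cases hxS : x ∈ S
      · have hxs : x ∈ s(u, v) := by
          by_contra hc
          simp only [Sym2.mem_iff, not_or] at hc
          exact hx (by simp [hxS, hc])
        have := ((h x).1 hxS).unique ⟨Finset.mem_insert_of_mem he, hxe⟩
          ⟨Finset.mem_insert_self _ _, hxs⟩
        exact hM (this ▸ he)
      · exact (h x).2 hxS e (Finset.mem_insert_of_mem he) hxe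
  · rintro ⟨hu, hv, h⟩ x
    constructor
    · intro hx
      by_cases hxs : x ∈ s(u, v)
      · refine ⟨s(u, v), ⟨Finset.mem_insert_self _ _, hxs⟩, ?_⟩
        rintro f ⟨hf, hxf⟩
        rcases Finset.mem_insert.1 hf with rfl | hf
        · rfl
        · exact absurd hxf ((h x).2 (by simpa [hx, or_iff_not_imp_left] using hxs) f hf)
      · obtain ⟨e, ⟨he, hxe⟩, huniq⟩ := (h x).1 (by simpa [hx] using hxs)
        refine ⟨e, ⟨Finset.mem_insert_of_mem he, hxe⟩, ?_⟩
        rintro f ⟨hf, hxf⟩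
        rcases Finset.mem_insert.1 hf with rfl | hf
        · exact absurd hxf hxs
        · exact huniq f ⟨hf, hxf⟩
    · intro hx e he hxe
      rcases Finset.mem_insert.1 he with rfl | he
      · rcases Sym2.mem_iff.1 hxe with rfl | rfl
        · exact hx hu
        · exact hx hv
      · exact (h x).2 (by simp [hx]) e he hxe

-- Splitting the sets of edges by whether they contain the head of the list reproduces the recursion
-- of `matchSum`; that no edge is listed twice makes the two classes disjoint.
open Classical in
theorem sum_coversExactly {R : Type*} [CommRing R] (l : List (V × V × R)) (γ : Sym2 V → R)
    (hγ : ∀ e ∈ l, γ s(e.1, e.2.1) = e.2.2) (hl : (l.map fun e => s(e.1, e.2.1)).Nodup)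
    (S : Finset V) :
    ∑ M ∈ (l.map fun e => s(e.1, e.2.1)).toFinset.powerset,
      (if CoversExactly M S then ∏ e ∈ M, γ e else 0) = matchSum l S := by
  induction l generalizing S with
  | nil =>
    have : CoversExactly (∅ : Finset (Sym2 V)) S ↔ S = ∅ := by
      simp [CoversExactly, Finset.eq_empty_iff_forall_notMem]
    simp [matchSum, this]
  | cons e l ih =>
    obtain ⟨u, v, w⟩ := e
    simp only [List.map_cons, List.nodup_cons] at hl
    have hnot : s(u, v) ∉ (l.map fun e => s(e.1, e.2.1)).toFinset := by simpa using hl.1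
    rw [List.map_cons, List.toFinset_cons, Finset.sum_powerset_insert hnot, matchSum,
      ih (fun e he => hγ e (by simp [he])) hl.2]
    congr 1
    have hM : ∀ M ∈ (l.map fun e => s(e.1, e.2.1)).toFinset.powerset, s(u, v) ∉ M :=
      fun M hM h => hnot (Finset.mem_powerset.1 hM h)
    by_cases h : u ∈ S ∧ v ∈ S
    · rw [if_pos h, ← ih (fun e he => hγ e (by simp [he])) hl.2, Finset.mul_sum]
      refine Finset.sum_congr rfl fun M hMm => ?_
      rw [Finset.prod_insert (hM M hMm), hγ (u, v, w) (by simp)]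
      simp only [coversExactly_insert (hM M hMm), h.1, h.2, true_and, mul_ite, mul_zero]
    · rw [if_neg h]
      refine Finset.sum_eq_zero fun M hMm => ?_
      rw [if_neg]
      rw [coversExactly_insert (hM M hMm)]
      tauto

end PerfectMatching

/-! ### Weighted graphs given by lists of edges. -/

namespace WeightedGraph

theorem filter_eq_singleton {α β : Type*} [DecidableEq β] {l : List α} {f : α → β}
    (h : (l.map f).Nodup) {x : α} (hx : x ∈ l) : l.filter (fun y => f y = f x) = [x] := by
  induction l with
  | nil => simp at hx
  | cons a l ih =>
    simp only [List.map_cons, List.nodup_cons] at h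
    rcases List.mem_cons.1 hx with rfl | hx
    · rw [List.filter_cons_of_pos (by simp)]
      congr 1
      rw [List.filter_eq_nil_iff]
      intro y hy
      simp only [decide_eq_true_eq]
      intro hxy
      exact h.1 (hxy ▸ List.mem_map_of_mem hy)
    · have : f a ≠ f x := fun hax => h.1 (hax ▸ List.mem_map_of_mem hx)
      rw [List.filter_cons_of_neg (by simpa using this), ih h.2 hx]

theorem weight_of_mem (G : WeightedGraph) {e} (he : e ∈ G.edges) :
    G.weight s(e.1, e.2.1) = e.2.2 := by
  have := filter_eq_singleton G.nodup he
  simp only [weight, this, List.map_cons, List.map_nil, List.sum_cons, List.sum_nil, add_zero]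

theorem mem_edgeSet (G : WeightedGraph) (e : Sym2 (Fin G.numVertices)) :
    e ∈ G.graph.edgeSet ↔ e ∈ G.edges.map fun e => s(e.1, e.2.1) := by
  rw [graph, SimpleGraph.edgeSet_fromEdgeSet]
  constructor
  · exact fun h => h.1
  · refine fun h => ⟨h, ?_⟩
    obtain ⟨x, hx, rfl⟩ := List.mem_map.1 h
    simpa using G.ne_of_mem x hx

theorem totalWeight_eq (G : WeightedGraph) (R : Type*) [CommRing R] :
    (G.totalWeight : R) =
      matchSum (G.edges.map fun e => (e.1, e.2.1, (e.2.2 : R))) Finset.univ := by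
  classical
  rw [← sum_coversExactly _ (fun e => (G.weight e : R))]
  · rw [totalWeight, SimpleGraph.perfectMatchingWeight, Nat.cast_sum, ← Finset.sum_filter]
    simp only [Nat.cast_prod, List.map_map, Function.comp_def]
    refine Finset.sum_congr ?_ fun _ _ => rfl
    ext M
    simp only [Finset.mem_filter, Finset.mem_univ, true_and, Finset.mem_powerset]
    refine and_congr ?_ ?_
    · simp only [Set.subset_def, Finset.mem_coe, mem_edgeSet, Finset.subset_iff, List.mem_toFinset]
    · simp [CoversExactly]
  · intro e he
    obtain ⟨x, hx, rfl⟩ := List.mem_map.1 he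
    simp [G.weight_of_mem hx]
  · simpa [Function.comp_def] using G.nodup

theorem hasHamiltonianPath_of_path (G : WeightedGraph) (hn : 0 < G.numVertices)
    (hp : ∀ j (hj : j + 1 < G.numVertices),
      s((⟨j, by omega⟩ : Fin G.numVertices), (⟨j + 1, hj⟩ : Fin G.numVertices)) ∈
        G.edges.map fun e => s(e.1, e.2.1)) :
    G.HasHamiltonianPath := by
  have adj : ∀ j (hj : j + 1 < G.numVertices), G.graph.Adj ⟨j, by omega⟩ ⟨j + 1, hj⟩ := by
    intro j hj
    rw [← SimpleGraph.mem_edgeSet, mem_edgeSet]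
    exact hp j hj
  have walk : ∀ k (hk : k < G.numVertices), ∃ p : G.graph.Walk ⟨0, hn⟩ ⟨k, hk⟩,
      p.support.map Fin.val = List.range (k + 1) := by
    intro k
    induction k with
    | zero => exact fun hk => ⟨SimpleGraph.Walk.nil, rfl⟩
    | succ k ih =>
      intro hk
      obtain ⟨p, hp⟩ := ih (by omega)
      refine ⟨p.concat (adj k hk), ?_⟩
      rw [SimpleGraph.Walk.support_concat, List.map_append, hp,
        List.range_succ (n := k + 1)]
      rfl
  obtain ⟨p, hp⟩ := walk (G.numVertices - 1) (by omega)
  refine ⟨_, _, p, fun a => ?_⟩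
  -- The walk has the numbers of all vertices, in increasing order, as its support, so each of them
  -- occurs once.
  rw [← List.count_map_of_injective _ Fin.val Fin.val_injective, hp]
  have ha : (a : ℕ) < G.numVertices := a.2
  exact List.count_eq_one_of_mem List.nodup_range (List.mem_range.2 (by omega))

/-- The weighted graph on `n` vertices with the edges `l`. -/
def ofList (n : ℕ) (l : List (ℕ × ℕ × ℕ)) (h : ∀ e ∈ l, e.1 < e.2.1 ∧ e.2.1 < n)
    (hl : (l.map fun e => (e.1, e.2.1)).Nodup) : WeightedGraph where
  numVertices := n
  edges := l.pmap (fun e he => (⟨e.1, he.1.trans he.2⟩, ⟨e.2.1, he.2⟩, e.2.2)) h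
  ne_of_mem := by
    intro e he
    obtain ⟨x, hx, rfl⟩ := List.mem_pmap.1 he
    exact fun hc => (h x hx).1.ne (congrArg Fin.val hc)
  nodup := by
    rw [List.map_pmap, List.Nodup, List.pairwise_pmap]
    rw [List.Nodup, List.pairwise_map] at hl
    refine hl.imp fun {a b} hab ha hb hc => hab ?_
    simp only [Sym2.eq_iff, Fin.mk.injEq] at hc
    rcases hc with ⟨h1, h2⟩ | ⟨h1, h2⟩
    · rw [h1, h2]
    -- The ends of every listed edge are increasing, so no edge is another one reversed.
    · omega

section OfList

variable {n : ℕ} {l : List (ℕ × ℕ × ℕ)} (h : ∀ e ∈ l, e.1 < e.2.1 ∧ e.2.1 < n)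
  (hl : (l.map fun e => (e.1, e.2.1)).Nodup)

theorem ofList_edges_map :
    (ofList n l h hl).edges.map (fun e => ((e.1 : ℕ), (e.2.1 : ℕ), e.2.2)) = l := by
  simp only [ofList, List.map_pmap]
  rw [List.pmap_eq_map (f := fun e => e)]
  exact List.map_id _

theorem ofList_encode :
    (ofList n l h hl).encode = encodeTally (n :: l.flatMap fun e => [e.1, e.2.1, e.2.2]) := by
  conv_rhs => rw [← ofList_edges_map h hl]
  rw [WeightedGraph.encode, List.flatMap_map]
  rfl

theorem ofList_totalWeight (R : Type*) [CommRing R] :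
    ((ofList n l h hl).totalWeight : R) = matchSum (castEdges R l) (Finset.range n) := by
  rw [totalWeight_eq, ← matchSum_map Fin.valEmbedding]
  conv_rhs => rw [← ofList_edges_map h hl]
  rw [castEdges, List.map_map, List.map_map]
  refine congrArg₂ _ rfl ?_
  ext x
  simp only [Finset.mem_map, Finset.mem_univ, true_and, Finset.mem_range]
  exact ⟨fun ⟨a, ha⟩ => ha ▸ a.2, fun hx => ⟨⟨x, hx⟩, rfl⟩⟩

theorem ofList_weight_mem {W : Set ℕ} (hW : ∀ e ∈ l, e.2.2 ∈ W) :
    ∀ e ∈ (ofList n l h hl).graph.edgeSet, (ofList n l h hl).weight e ∈ W := by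
  intro e he
  rw [mem_edgeSet] at he
  obtain ⟨x, hx, rfl⟩ := List.mem_map.1 he
  rw [weight_of_mem _ hx]
  obtain ⟨y, hy, rfl⟩ := List.mem_pmap.1 hx
  exact hW y hy

theorem ofList_hasHamiltonianPath (hn : 0 < n)
    (hp : ∀ j, j + 1 < n → (j, j + 1) ∈ l.map fun e => (e.1, e.2.1)) :
    (ofList n l h hl).HasHamiltonianPath := by
  refine hasHamiltonianPath_of_path _ hn fun j hj => ?_
  obtain ⟨e, he, hej⟩ := List.mem_map.1 (hp j hj)
  have he1 : e.1 = j := congrArg Prod.fst hej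
  have he2 : e.2.1 = j + 1 := congrArg Prod.snd hej
  refine List.mem_map.2 ⟨(⟨e.1, (h e he).1.trans (h e he).2⟩, ⟨e.2.1, (h e he).2⟩, e.2.2),
    List.mem_pmap.2 ⟨e, he, rfl⟩, ?_⟩
  simp only [he1, he2]

end OfList

end WeightedGraph

/-! ### The list of edges of the graph of a formula -/

namespace GraphPart

/-- The pairs of vertices that are joined by jumps. -/
def jumps : List GraphPart → List (ℕ × ℕ)
  | [] => []
  | wire _ _ :: l => jumps l
  | jump m m' :: l => (m, m') :: jumps l

theorem jumps_append (l l' : List GraphPart) : jumps (l ++ l') = jumps l ++ jumps l' := by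
  induction l with
  | nil => rfl
  | cons p l ih => cases p <;> simp [jumps, ih]

theorem jumps_flatMap {α : Type*} (l : List α) (f : α → List GraphPart) :
    jumps (l.flatMap f) = l.flatMap fun a => jumps (f a) := by
  induction l with
  | nil => rfl
  | cons a l ih => simp [jumps_append, ih]

theorem mem_jumps {l : List GraphPart} {m m' : ℕ} : (m, m') ∈ jumps l ↔ jump m m' ∈ l := by
  induction l with
  | nil => simp [jumps]
  | cons p l ih => cases p <;> simp [jumps, ih]

/-- The part lies on the core vertices below `n`, and a jump does not join consecutive ones. -/
def Valid (n : ℕ) : GraphPart → Prop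
  | wire m r => m + 1 < n ∧ 1 ≤ r ∧ r ≤ 3
  | jump m m' => m + 2 ≤ m' ∧ m' < n

theorem mem_expand_wire {k m r : ℕ} {e : ℕ × ℕ × ℕ} (he : e ∈ expand k (wire m r)) :
    m * (2 * k + 5) ≤ e.1 ∧ e.1 < e.2.1 ∧ e.2.1 ≤ (m + 1) * (2 * k + 5) := by
  have := ladder_bounds he
  rw [add_mul, one_mul]
  exact this

theorem Valid.bounds {n k : ℕ} {p : GraphPart} (hp : p.Valid n) {e : ℕ × ℕ × ℕ}
    (he : e ∈ p.expand k) : e.1 < e.2.1 ∧ e.2.1 < (n - 1) * (2 * k + 5) + 1 := by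
  cases p with
  | wire m r =>
    obtain ⟨h1, h2, h3⟩ := mem_expand_wire he
    have := Nat.mul_le_mul_right (2 * k + 5) (show m + 1 ≤ n - 1 by have := hp.1; omega)
    omega
  | jump m m' =>
    rw [expand, List.mem_singleton] at he
    subst he
    obtain ⟨h1, h2⟩ := hp
    have := Nat.mul_le_mul_right (2 * k + 5) (show m' ≤ n - 1 by omega)
    have := Nat.mul_lt_mul_of_pos_right (show m < m' by omega) (show 0 < 2 * k + 5 by omega)
    exact ⟨this, by dsimp only; omega⟩

theorem Valid.weight {n k : ℕ} {p : GraphPart} (hp : p.Valid n) {e : ℕ × ℕ × ℕ}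
    (he : e ∈ p.expand k) : e.2.2 ∈ ({1, 2, 3} : Set ℕ) := by
  simp only [Set.mem_insert_iff, Set.mem_singleton_iff]
  cases p with
  | wire m r =>
    have := hp.2
    simp only [expand, ladder, ladderLevel, List.mem_append, List.mem_flatMap, List.mem_cons,
      List.not_mem_nil, or_false] at he
    rcases he with (((rfl | rfl | rfl) | ⟨j, _, (rfl | rfl | rfl)⟩) | (rfl | rfl | rfl)) | rfl <;>
      dsimp only <;> omega
  | jump m m' =>
    rw [expand, List.mem_singleton] at he
    subst he
    simp

end GraphPart

/-! ### Distinct edges, and edges between consecutive vertices. -/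

theorem nodup_ladder (k u r : ℕ) : ((ladder k u r).map fun e => (e.1, e.2.1)).Nodup := by
  have level : ∀ a b w, a + 2 < b →
      ((ladderLevel a b w).map fun e => (e.1, e.2.1)).Nodup := by
    intro a b w h
    simp only [ladderLevel, List.map_cons, List.map_nil, List.nodup_cons, List.mem_cons,
      Prod.mk.injEq, List.not_mem_nil, or_false, not_false_eq_true, List.nodup_nil, and_true]
    omega
  simp only [ladder, List.map_append, List.map_flatMap]
  refine List.nodup_append.2 ⟨List.nodup_append.2 ⟨List.nodup_append.2
    ⟨level _ _ _ (by omega), List.nodup_flatMap.2 ⟨fun j hj => level _ _ _ ?_, ?_⟩, ?_⟩,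
      level _ _ _ (by omega), ?_⟩, by simp, ?_⟩
  · have := List.mem_range.1 hj
    omega
  · refine (List.pairwise_lt_range (n := k)).imp_of_mem fun {i j} hi hj hij => ?_
    have := List.mem_range.1 hj
    intro x hx hx'
    simp only [ladderLevel, List.map_cons, List.map_nil, List.mem_cons, List.not_mem_nil,
      or_false] at hx hx'
    rcases hx with rfl | rfl | rfl <;> simp only [Prod.mk.injEq] at hx' <;> omega
  · intro x hx y hy
    simp only [ladderLevel, List.map_cons, List.map_nil, List.mem_cons, List.not_mem_nil,
      or_false, List.mem_flatMap, List.mem_range] at hx hy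
    obtain ⟨j, hj, hy⟩ := hy
    rcases hx with rfl | rfl | rfl <;> rcases hy with rfl | rfl | rfl <;>
      simp only [ne_eq, Prod.mk.injEq] <;> omega
  · intro x hx y hy
    simp only [ladderLevel, List.map_cons, List.map_nil, List.mem_cons, List.not_mem_nil,
      or_false, List.mem_flatMap, List.mem_range, List.mem_append] at hx hy
    rcases hx with (rfl | rfl | rfl) | ⟨j, hj, (rfl | rfl | rfl)⟩ <;>
      rcases hy with rfl | rfl | rfl <;> simp only [ne_eq, Prod.mk.injEq] <;> omega
  · intro x hx y hy
    simp only [ladderLevel, List.map_cons, List.map_nil, List.mem_cons, List.not_mem_nil,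
      or_false, List.mem_flatMap, List.mem_range, List.mem_append] at hx hy
    subst hy
    rcases hx with ((rfl | rfl | rfl) | ⟨j, hj, (rfl | rfl | rfl)⟩) | rfl | rfl | rfl <;>
      simp only [ne_eq, Prod.mk.injEq] <;> omega

/-- Without its rungs a ladder is a path: up one side, across the innermost edge, and down the other
side. -/
theorem succ_mem_ladder {k u r x : ℕ} (h : u ≤ x) (h' : x < u + (2 * k + 5)) :
    (x, x + 1) ∈ (ladder k u r).map fun e => (e.1, e.2.1) := by
  simp only [ladder, ladderLevel, List.map_append, List.map_flatMap, List.map_cons, List.map_nil,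
    List.mem_append, List.mem_flatMap, List.mem_range, List.mem_cons, List.not_mem_nil, or_false,
    Prod.mk.injEq]
  by_cases h1 : x < u + 1 + k
  · by_cases h2 : x = u
    · omega
    · exact Or.inl (Or.inl (Or.inr ⟨x - u - 1, by omega, by omega⟩))
  · by_cases h2 : x < u + k + 4
    · omega
    · by_cases h3 : x = u + (2 * k + 4)
      · omega
      · exact Or.inl (Or.inl (Or.inr ⟨u + 2 * k + 3 - x, by omega, by omega⟩))

namespace GraphPart

/-- Different ladders have no common edge because they lie in different intervals. A jump spans at
least two ladder lengths, whereas an edge of a ladder stays within one. -/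
theorem nodup_expand {k n : ℕ} {l : List GraphPart} (hv : ∀ p ∈ l, p.Valid n)
    (hw : (wires l).Nodup) (hj : (jumps l).Nodup) :
    ((l.flatMap (expand k)).map fun e => (e.1, e.2.1)).Nodup := by
  have cross : ∀ m r a b, a + 2 ≤ b → ∀ e ∈ expand k (wire m r),
      ¬ (e.1 = a * (2 * k + 5) ∧ e.2.1 = b * (2 * k + 5)) := by
    intro m r a b hab e he h
    obtain ⟨h1, h2, h3⟩ := mem_expand_wire he
    rw [h.1] at h1
    rw [h.2] at h3
    have h1 := Nat.le_of_mul_le_mul_right h1 (by omega)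
    have h3 := Nat.le_of_mul_le_mul_right h3 (by omega)
    omega
  induction l with
  | nil => simp
  | cons p l ih =>
    have hv' : ∀ p ∈ l, p.Valid n := fun p hp => hv p (by simp [hp])
    rw [List.flatMap_cons, List.map_append]
    cases p with
    | wire m r =>
      simp only [wires, List.nodup_cons] at hw
      refine List.nodup_append.2 ⟨nodup_ladder k _ r, ih hv' hw.2 hj, ?_⟩
      intro x hx y hy hxy
      obtain ⟨e, he, rfl⟩ := List.mem_map.1 hx
      obtain ⟨f, hf, rfl⟩ := List.mem_map.1 hy
      obtain ⟨p, hp, hf⟩ := List.mem_flatMap.1 hf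
      simp only [Prod.mk.injEq] at hxy
      cases p with
      | wire m' r' =>
        obtain ⟨h1, h2, h3⟩ := mem_expand_wire he
        obtain ⟨h1', h2', h3'⟩ := mem_expand_wire hf
        have hm : m ≠ m' := fun h => hw.1 (mem_wires.2 ⟨r', h ▸ hp⟩)
        have := Nat.lt_of_mul_lt_mul_right (show m * (2 * k + 5) < (m' + 1) * (2 * k + 5) by omega)
        have := Nat.lt_of_mul_lt_mul_right (show m' * (2 * k + 5) < (m + 1) * (2 * k + 5) by omega)
        omega
      | jump a b =>
        rw [expand, List.mem_singleton] at hf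
        subst hf
        exact cross m r a b (hv' _ hp).1 e he hxy
    | jump a b =>
      simp only [jumps, List.nodup_cons] at hj
      refine List.nodup_append.2 ⟨by simp [expand], ih hv' hw hj.2, ?_⟩
      intro x hx y hy hxy
      simp only [expand, List.map_cons, List.map_nil, List.mem_singleton] at hx
      subst hx
      obtain ⟨f, hf, rfl⟩ := List.mem_map.1 hy
      obtain ⟨p, hp, hf⟩ := List.mem_flatMap.1 hf
      simp only [Prod.mk.injEq] at hxy
      cases p with
      | wire m r => exact cross m r a b (hv (jump a b) (by simp)).1 f hf ⟨hxy.1.symm, hxy.2.symm⟩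
      | jump a' b' =>
        rw [expand, List.mem_singleton] at hf
        subst hf
        have ha := Nat.eq_of_mul_eq_mul_right (by omega) hxy.1
        have hb := Nat.eq_of_mul_eq_mul_right (by omega) hxy.2
        exact hj.1 (mem_jumps.2 (by rw [ha, hb]; exact hp))

theorem succ_mem_expand {k n x : ℕ} {l : List GraphPart} (hw : wires l = List.range n)
    (hx : x < n * (2 * k + 5)) :
    (x, x + 1) ∈ (l.flatMap (expand k)).map fun e => (e.1, e.2.1) := by
  have hm : x / (2 * k + 5) ∈ wires l := by
    rw [hw, List.mem_range]
    exact (Nat.div_lt_iff_lt_mul (by omega)).2 hx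
  obtain ⟨r, hr⟩ := mem_wires.1 hm
  have h1 := Nat.div_mul_le_self x (2 * k + 5)
  have h2 := Nat.lt_div_mul_add (a := x) (show 0 < 2 * k + 5 by omega)
  obtain ⟨e, he, hex⟩ := List.mem_map.1 (succ_mem_ladder (r := r) h1 h2)
  exact List.mem_map.2 ⟨e, List.mem_flatMap.2 ⟨_, hr, he⟩, hex⟩

end GraphPart

/-! ### Validity and distinctness of the jumps of a formula. -/

open GraphPart

theorem mem_litRow {ν i old P Q cur : ℕ} {p : GraphPart} (hp : p ∈ litRow ν i old P Q cur) :
    ∃ v < ν, v = i ∧ (p = jump (old + 2 * v) P ∨ p = jump Q (cur + 2 * v)) ∨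
      v ≠ i ∧ p = jump (old + 2 * v) (cur + 2 * v) ∨ p = wire (cur + 2 * v) 3 ∨
      p = wire (cur + 2 * v + 1) 2 := by
  obtain ⟨v, hv, hp⟩ := List.mem_flatMap.1 hp
  refine ⟨v, List.mem_range.1 hv, ?_⟩
  by_cases h : v = i
  · subst h
    simp only [if_true, List.mem_append, List.mem_cons, List.not_mem_nil, or_false] at hp
    tauto
  · simp only [h, if_false, List.mem_append, List.mem_cons, List.not_mem_nil, or_false] at hp
    tauto

theorem valid_litRow {ν i old P Q cur n : ℕ} (hP : old + 2 * i + 2 ≤ P) (hPn : P < n)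
    (hQ : Q + 2 ≤ cur) (hold : old + 2 ≤ cur) (hn : cur + 2 * ν < n) :
    ∀ p ∈ litRow ν i old P Q cur, p.Valid n := by
  intro p hp
  obtain ⟨v, hv, ⟨rfl, rfl | rfl⟩ | ⟨_, rfl⟩ | rfl | rfl⟩ := mem_litRow hp <;>
    simp only [Valid] <;> omega

theorem valid_tailParts (ν : ℕ) (cs : List (ℕ × ℕ)) (hcs : ∀ c ∈ cs, c.1 < ν ∧ c.2 < ν) (s : ℕ) :
    ∀ p ∈ tailParts ν cs s, p.Valid (coreEnd ν cs s) := by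
  induction cs generalizing s with
  | nil =>
    intro p hp
    simp only [tailParts, finalParts, List.mem_append, List.mem_cons, List.not_mem_nil, or_false,
      List.mem_flatMap, List.mem_range] at hp
    have : coreEnd ν [] s = s + 4 * ν + 4 := by simp [coreEnd]
    rw [this]
    rcases hp with ((rfl | rfl) | ⟨v, hv, (rfl | rfl | rfl | rfl)⟩) | rfl <;>
      simp only [Valid] <;> omega
  | cons c cs ih =>
    intro p hp
    have hc := hcs c (by simp)
    rw [coreEnd_cons]
    rw [tailParts, List.mem_append] at hp
    rcases hp with hp | hp
    · have hn : s + 4 * ν + 6 + 4 * ν + 4 ≤ coreEnd ν cs (s + 4 * ν + 6) := by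
        simp only [coreEnd]; omega
      simp only [clauseParts, List.mem_append] at hp
      rcases hp with ((hp | hp) | hp) | hp
      · simp only [List.mem_cons, List.not_mem_nil, or_false] at hp
        rcases hp with rfl | rfl <;> simp only [Valid] <;> omega
      · exact valid_litRow (by omega) (by omega) (by omega) (by omega) (by omega) p hp
      · simp only [List.mem_cons, List.not_mem_nil, or_false] at hp
        rcases hp with rfl | rfl | rfl | rfl | rfl | rfl | rfl | rfl | rfl | rfl <;>
          simp only [Valid] <;> omega
      · exact valid_litRow (by omega) (by omega) (by omega) (by omega) (by omega) p hp
    · exact ih (fun c hc => hcs c (by simp [hc])) _ p hp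

theorem valid_formulaParts (ν : ℕ) (cs : List (ℕ × ℕ)) (hcs : ∀ c ∈ cs, c.1 < ν ∧ c.2 < ν) :
    ∀ p ∈ formulaParts ν cs, p.Valid (coreEnd ν cs 0) := by
  intro p hp
  rw [formulaParts, List.mem_append] at hp
  rcases hp with hp | hp
  · simp only [List.mem_flatMap, List.mem_range, List.mem_cons, List.not_mem_nil, or_false] at hp
    obtain ⟨v, hv, rfl | rfl⟩ := hp <;> simp only [Valid, coreEnd] <;> omega
  · exact valid_tailParts ν cs hcs 0 p hp

theorem nodup_jumps_litRow {ν i old P Q cur : ℕ} (hP : P < cur) :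
    (jumps (litRow ν i old P Q cur)).Nodup := by
  rw [litRow, jumps_flatMap]
  refine List.nodup_flatMap.2 ⟨fun v _ => ?_, ?_⟩
  · split_ifs
    · simp [jumps]
      omega
    · simp [jumps]
  · refine (List.pairwise_lt_range (n := ν)).imp fun {a b} hab => ?_
    rintro ⟨x, y⟩ hx hy
    dsimp only at hx hy
    split_ifs at hx hy <;> simp [jumps] at hx hy <;> omega

theorem mem_jumps_litRow {ν i old P Q cur : ℕ} {x : ℕ × ℕ}
    (hx : x ∈ jumps (litRow ν i old P Q cur)) :
    (x = (old + 2 * i, P) ∧ i < ν) ∨ ∃ v < ν, x.2 = cur + 2 * v := by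
  have := mem_litRow (mem_jumps.1 hx)
  obtain ⟨v, hv, ⟨rfl, h | h⟩ | ⟨_, h⟩ | h | h⟩ := this <;>
    simp only [jump.injEq, reduceCtorEq] at h
  · exact Or.inl ⟨Prod.ext h.1 h.2, hv⟩
  · exact Or.inr ⟨v, hv, h.2⟩
  · exact Or.inr ⟨v, hv, h.2⟩

theorem nodup_jumps_clauseParts {ν : ℕ} {c : ℕ × ℕ} (hc : c.1 < ν ∧ c.2 < ν) (s : ℕ) :
    (jumps (clauseParts ν c s)).Nodup := by
  simp only [clauseParts, jumps_append]
  refine List.nodup_append.2 ⟨List.nodup_append.2 ⟨List.nodup_append.2 ⟨by simp [jumps],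
    nodup_jumps_litRow (by omega), by simp [jumps]⟩, ?_, ?_⟩, nodup_jumps_litRow (by omega), ?_⟩
  · simp [jumps]
    omega
  · rintro ⟨x, x'⟩ hx ⟨y, y'⟩ hy
    simp only [jumps, List.nil_append, List.mem_cons, List.not_mem_nil, or_false,
      Prod.mk.injEq] at hx hy
    simp only [ne_eq, Prod.mk.injEq]
    rcases mem_jumps_litRow hx with ⟨hx, _⟩ | ⟨v, hv, hx⟩
    · simp only [Prod.mk.injEq] at hx
      omega
    · dsimp only at hx
      omega
  · rintro ⟨x, x'⟩ hx ⟨y, y'⟩ hy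
    simp only [jumps, List.nil_append, List.mem_append, List.mem_cons, List.not_mem_nil, or_false,
      Prod.mk.injEq] at hx hy
    simp only [ne_eq, Prod.mk.injEq]
    have hx' : x' < s + 4 * ν + 5 ∨ x = s + 4 * ν + 3 ∧ x' = s + 4 * ν + 5 := by
      rcases hx with hx | hx
      · rcases mem_jumps_litRow hx with ⟨hx, _⟩ | ⟨v, hv, hx⟩
        · simp only [Prod.mk.injEq] at hx
          omega
        · dsimp only at hx
          omega
      · omega
    rcases mem_jumps_litRow hy with ⟨hy, _⟩ | ⟨v, hv, hy⟩
    · simp only [Prod.mk.injEq] at hy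
      omega
    · dsimp only at hy
      omega

theorem jumps_clauseParts_le {ν : ℕ} {c : ℕ × ℕ} (s : ℕ) {x : ℕ × ℕ}
    (hx : x ∈ jumps (clauseParts ν c s)) : x.2 ≤ s + 6 * ν + 5 := by
  obtain ⟨x, x'⟩ := x
  simp only [clauseParts, jumps_append, jumps, List.nil_append, List.mem_append, List.mem_cons,
    List.not_mem_nil, or_false, Prod.mk.injEq] at hx
  dsimp only
  rcases hx with (hx | hx) | hx
  · rcases mem_jumps_litRow hx with ⟨hx, _⟩ | ⟨v, hv, hx⟩
    · simp only [Prod.mk.injEq] at hx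
      omega
    · dsimp only at hx
      omega
  · omega
  · rcases mem_jumps_litRow hx with ⟨hx, _⟩ | ⟨v, hv, hx⟩
    · simp only [Prod.mk.injEq] at hx
      omega
    · dsimp only at hx
      omega

theorem lt_jumps_tailParts {ν : ℕ} (cs : List (ℕ × ℕ)) (s : ℕ) {x : ℕ × ℕ}
    (hx : x ∈ jumps (tailParts ν cs s)) : s + 2 * ν < x.2 := by
  obtain ⟨x, x'⟩ := x
  dsimp only
  induction cs generalizing s with
  | nil =>
    simp only [tailParts, finalParts, jumps_append, jumps_flatMap, jumps, List.nil_append,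
      List.append_nil, List.mem_flatMap, List.mem_range, List.mem_cons, List.not_mem_nil, or_false,
      Prod.mk.injEq] at hx
    obtain ⟨v, hv, hx⟩ := hx
    omega
  | cons c cs ih =>
    rw [tailParts, jumps_append, List.mem_append] at hx
    rcases hx with hx | hx
    · simp only [clauseParts, jumps_append, jumps, List.nil_append, List.mem_append, List.mem_cons,
        List.not_mem_nil, or_false, Prod.mk.injEq] at hx
      rcases hx with (hx | hx) | hx
      · rcases mem_jumps_litRow hx with ⟨hx, _⟩ | ⟨v, hv, hx⟩
        · simp only [Prod.mk.injEq] at hx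
          omega
        · dsimp only at hx
          omega
      · omega
      · rcases mem_jumps_litRow hx with ⟨hx, _⟩ | ⟨v, hv, hx⟩
        · simp only [Prod.mk.injEq] at hx
          omega
        · dsimp only at hx
          omega
    · have := ih _ hx
      omega

/-- Jumps of a clause and later ones differ in their upper ends: the former are at most `s + 6 * ν +
5`, and the latter exceed `s + 6 * ν + 6`. -/
theorem nodup_jumps_tailParts (ν : ℕ) (cs : List (ℕ × ℕ)) (hcs : ∀ c ∈ cs, c.1 < ν ∧ c.2 < ν)
    (s : ℕ) : (jumps (tailParts ν cs s)).Nodup := by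
  induction cs generalizing s with
  | nil =>
    simp only [tailParts, finalParts, jumps_append, jumps_flatMap, jumps, List.nil_append,
      List.append_nil]
    refine List.nodup_flatMap.2 ⟨fun v _ => by simp, ?_⟩
    refine (List.pairwise_lt_range (n := ν)).imp fun {a b} hab => ?_
    rintro ⟨x, y⟩ hx hy
    simp at hx hy
    omega
  | cons c cs ih =>
    rw [tailParts, jumps_append]
    refine List.nodup_append.2 ⟨nodup_jumps_clauseParts (hcs c (by simp)) s,
      ih (fun c hc => hcs c (by simp [hc])) _, ?_⟩
    rintro x hx y hy rfl
    have := jumps_clauseParts_le s hx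
    have := lt_jumps_tailParts cs _ hy
    omega

theorem nodup_jumps_formulaParts (ν : ℕ) (cs : List (ℕ × ℕ))
    (hcs : ∀ c ∈ cs, c.1 < ν ∧ c.2 < ν) : (jumps (formulaParts ν cs)).Nodup := by
  have h : jumps ((List.range ν).flatMap fun v => [wire (2 * v) 3, wire (2 * v + 1) 2]) = [] := by
    simp [jumps_flatMap, jumps]
  rw [formulaParts, jumps_append, h]
  exact nodup_jumps_tailParts ν cs hcs 0

/-! ### The reduction -/

namespace MonotoneTwoSat

/-- The parameter of the ladders in the graph of `φ`. -/
def rungs (φ : MonotoneTwoSat) : ℕ := 2 * φ.encode.length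

/-- The list of edges of the graph of `φ`. -/
def edgeList (φ : MonotoneTwoSat) : List (ℕ × ℕ × ℕ) :=
  (formulaParts φ.numVars φ.clausePairs).flatMap (GraphPart.expand φ.rungs)

/-- The number of vertices of the graph of `φ`. -/
def order (φ : MonotoneTwoSat) : ℕ :=
  (coreEnd φ.numVars φ.clausePairs 0 - 1) * (2 * φ.rungs + 5) + 1

/-- The graph of `φ`. -/
def toGraph (φ : MonotoneTwoSat) : WeightedGraph :=
  WeightedGraph.ofList φ.order φ.edgeList.reverse
    (fun e he => by
      rw [List.mem_reverse] at he
      obtain ⟨p, hp, he⟩ := List.mem_flatMap.1 he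
      exact (valid_formulaParts _ _ φ.clausePairs_lt p hp).bounds he)
    (by
      rw [List.map_reverse, List.nodup_reverse]
      refine GraphPart.nodup_expand (valid_formulaParts _ _ φ.clausePairs_lt) ?_
        (nodup_jumps_formulaParts _ _ φ.clausePairs_lt)
      rw [wires_formulaParts]
      exact List.nodup_range)

theorem toGraph_weight_mem (φ : MonotoneTwoSat) :
    ∀ e ∈ φ.toGraph.graph.edgeSet, φ.toGraph.weight e ∈ ({1, 2, 3} : Set ℕ) := by
  refine WeightedGraph.ofList_weight_mem _ _ fun e he => ?_
  rw [List.mem_reverse] at he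
  obtain ⟨p, hp, he⟩ := List.mem_flatMap.1 he
  exact (valid_formulaParts _ _ φ.clausePairs_lt p hp).weight he

theorem toGraph_hasHamiltonianPath (φ : MonotoneTwoSat) : φ.toGraph.HasHamiltonianPath := by
  refine WeightedGraph.ofList_hasHamiltonianPath _ _ (Nat.succ_pos _) fun j hj => ?_
  rw [List.map_reverse, List.mem_reverse]
  exact GraphPart.succ_mem_expand (wires_formulaParts _ _) (Nat.lt_of_succ_lt_succ hj)

theorem clauses_length_eq (φ : MonotoneTwoSat) : φ.clausePairs.length = φ.clauses.length := by
  simp [clausePairs]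

theorem encode_eq (φ : MonotoneTwoSat) :
    φ.encode = encodeTally (φ.numVars :: φ.clausePairs.flatMap fun c => [c.1, c.2]) := by
  rw [encode, clausePairs, List.flatMap_map]

theorem length_encodeTally (l : List ℕ) : (encodeTally l).length = l.sum + l.length := by
  induction l with
  | nil => rfl
  | cons n l ih =>
    simp only [encodeTally, List.flatMap_cons, List.length_append, List.length_replicate,
      List.length_cons, List.length_nil, List.sum_cons] at ih ⊢
    omega

theorem le_length_encode (φ : MonotoneTwoSat) :
    φ.numVars + 2 * φ.clauses.length + 1 ≤ φ.encode.length := by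
  rw [encode_eq, length_encodeTally, ← clauses_length_eq]
  simp only [List.sum_cons, List.length_cons, List.length_flatMap, List.length_nil, zero_add,
    Nat.reduceAdd, List.map_const', List.sum_replicate, smul_eq_mul]
  omega

theorem numSat_le (φ : MonotoneTwoSat) : φ.numSat ≤ 2 ^ φ.numVars := by
  refine (Finset.card_filter_le _ _).trans ?_
  simp

/-- In `ZMod (2 ^ (k + 2))` the power that spoils the ladders is zero, and the parameter `rungs` is
even by definition, so the core sum can be used. -/
theorem toGraph_totalWeight_mod (φ : MonotoneTwoSat) :
    φ.toGraph.totalWeight ≡ 2 ^ φ.clauses.length * φ.numSat [MOD 2 ^ (φ.rungs + 2)] := by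
  have hperm : (castEdges (ZMod (2 ^ (φ.rungs + 2))) φ.edgeList.reverse).Perm
      (castEdges _ φ.edgeList) := (List.reverse_perm _).map _
  rw [← ZMod.natCast_eq_natCast_iff, toGraph, WeightedGraph.ofList_totalWeight,
    matchSum_perm hperm, order,
    edgeList, GraphPart.matchSum_expand (show Even φ.rungs from even_two_mul _)
      (by have := ZMod.natCast_self (2 ^ (φ.rungs + 2)); push_cast at this; exact this)
      _ (List.Perm.of_eq (wires_formulaParts _ _)),
    Nat.sub_add_cancel (by simp [coreEnd]), matchSum_formulaParts _ _ φ.clausePairs_lt,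
    card_eq_numSat, clauses_length_eq]
  push_cast
  rfl

end MonotoneTwoSat

/-! ### Reading the count off the digits of the total weight. -/

/-- The number that has the bits of `x.1` from `x.2.1` on, of which there are `2 * x.2.2 + 1`. -/
def extractBits (x : ℕ × ℕ × ℕ) : ℕ := x.1 / 2 ^ x.2.1 % 2 ^ (2 * x.2.2 + 1)

/-- Shifting by `μ` removes the factor contributed by the clauses. A window of `ν + 1` bits would
suffice; `2 * ν + 1` is used because a machine gets this number from the binary `ν` by adding a
digit 1 at the low end. -/
theorem extractBits_of_mod {W μ ν K N : ℕ} (h : W ≡ 2 ^ μ * N [MOD 2 ^ K]) (hN : N ≤ 2 ^ ν)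
    (hK : μ + (2 * ν + 1) ≤ K) : extractBits (W, μ, ν) = N := by
  have h' : W ≡ 2 ^ μ * N [MOD 2 ^ (μ + (2 * ν + 1))] := h.of_dvd (pow_dvd_pow 2 hK)
  have hlt : N < 2 ^ (2 * ν + 1) :=
    hN.trans_lt (Nat.pow_lt_pow_right one_lt_two (by omega))
  rw [extractBits, ← Nat.mod_mul_right_div_self, ← pow_add, h', pow_add,
    Nat.mul_mod_mul_left, Nat.mul_div_cancel_left _ (by positivity), Nat.mod_eq_of_lt hlt]

theorem MonotoneTwoSat.extractBits_totalWeight (φ : MonotoneTwoSat) :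
    extractBits (φ.toGraph.totalWeight, φ.clauses.length, φ.numVars) = φ.numSat := by
  refine extractBits_of_mod φ.toGraph_totalWeight_mod φ.numSat_le ?_
  have := φ.le_length_encode
  rw [rungs]
  omega

/-! ### A machine with counters -/

/-- The counters of the machine that writes the graph. -/
inductive Counter
  | tmp | iter | lo | hi | rungs | len | vars | cur | old | p | q | p' | o | rem
  deriving DecidableEq

instance : Fintype Counter where
  elems := {.tmp, .iter, .lo, .hi, .rungs, .len, .vars, .cur, .old, .p, .q, .p', .o, .rem}
  complete x := by cases x <;> decide

/-- The stacks of the machine that writes the graph. -/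
inductive Reg
  | inp | out | cnt (x : Counter)
  deriving DecidableEq, Fintype

namespace Counters

open StackProg Function

/-- Programs of the machine with counters. -/
abbrev Prog := StackProg fun _ : Reg => Bool

/-- The stacks, where the counter `x` is a stack of height `c x`. -/
def st (I O : List Bool) (c : Counter → ℕ) : Reg → List Bool
  | .inp => I
  | .out => O
  | .cnt x => List.replicate (c x) true

theorem update_inp (I O I' : List Bool) (c : Counter → ℕ) :
    update (st I O c) Reg.inp I' = st I' O c := by
  funext r; cases r <;> simp [st, update]

theorem update_out (I O O' : List Bool) (c : Counter → ℕ) :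
    update (st I O c) Reg.out O' = st I O' c := by
  funext r; cases r <;> simp [st, update]

theorem update_cnt (I O : List Bool) (c : Counter → ℕ) (x : Counter) (n : ℕ) :
    update (st I O c) (Reg.cnt x) (List.replicate n true) = st I O (update c x n) := by
  funext r
  cases r with
  | inp => simp [st, update]
  | out => simp [st, update]
  | cnt y => by_cases h : y = x <;> simp [st, update, h]

/-- The program `p` turns the input `I` into `I'` and the counters `c` into `c'`, and writes the
word `w`, in at most `t` steps. -/
def Runs (p : Prog) (I : List Bool) (c : Counter → ℕ) (I' : List Bool) (c' : Counter → ℕ)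
    (w : List Bool) (t : ℕ) : Prop :=
  ∀ O, Run p (st I O c) (st I' (w ++ O) c') t

theorem Runs.mono {p : Prog} {I I' w : List Bool} {c c' : Counter → ℕ} {t t' : ℕ}
    (h : Runs p I c I' c' w t) (ht : t ≤ t') : Runs p I c I' c' w t' := fun O => (h O).mono ht

theorem Runs.seq {p p' : Prog} {I I' I'' w w' : List Bool} {c c' c'' : Counter → ℕ} {t t' : ℕ}
    (h : Runs p I c I' c' w t) (h' : Runs p' I' c' I'' c'' w' t') :
    Runs (.seq p p') I c I'' c'' (w' ++ w) (t + t') := fun O => by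
  rw [List.append_assoc]
  exact (h O).seq (h' _)

theorem runs_skip (I : List Bool) (c : Counter → ℕ) : Runs .skip I c I c [] 1 :=
  fun _ => Run.skip _

theorem runs_write (b : Bool) (I : List Bool) (c : Counter → ℕ) :
    Runs (.push Reg.out b) I c I c [b] 1 := fun O => by
  have := Run.push (Γ := fun _ : Reg => Bool) Reg.out b (st I O c)
  rwa [update_out] at this

theorem runs_unread (b : Bool) (I : List Bool) (c : Counter → ℕ) :
    Runs (.push Reg.inp b) I c (b :: I) c [] 1 := fun O => by
  have := Run.push (Γ := fun _ : Reg => Bool) Reg.inp b (st I O c)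
  rwa [update_inp] at this

/-- Increase the counter `x`. -/
def inc (x : Counter) : Prog := .push (Reg.cnt x) true

theorem runs_inc (x : Counter) (I : List Bool) (c : Counter → ℕ) :
    Runs (inc x) I c I (update c x (c x + 1)) [] 1 := fun O => by
  have := Run.push (Γ := fun _ : Reg => Bool) (Reg.cnt x) true (st I O c)
  rwa [show true :: st I O c (Reg.cnt x) = List.replicate (c x + 1) true from rfl,
    update_cnt] at this

/-- Decrease the counter `x`. -/
def dec (x : Counter) : Prog := .loop (Reg.cnt x) (fun _ => .skip) fun _ => false

theorem runs_dec (x : Counter) (I : List Bool) (c : Counter → ℕ) :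
    Runs (dec x) I c I (update c x (c x - 1)) [] 2 := fun O => by
  refine Run.loop_exit (t := 1) rfl ?_
  rw [show (st I O c (Reg.cnt x)).tail = List.replicate (c x - 1) true from List.tail_replicate ..,
    update_cnt]
  exact Run.skip _

/-- Run a program as often as the counter `x` says, and set this counter to `0`. -/
def rep (x : Counter) (p : Prog) : Prog :=
  .loop (Reg.cnt x) (fun o => if o.isSome then p else .skip) Option.isSome

/-- The counters after `j` rounds are `s j`, except for `x`, which holds the number of rounds still
to come and must survive the body. The word grows at the front because the output is a stack. -/
theorem runs_rep {x : Counter} {p : Prog} {I : List Bool} {n t : ℕ} (s : ℕ → Counter → ℕ)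
    (W : ℕ → List Bool) (hW : W 0 = [])
    (h : ∀ j < n, ∃ w, W (j + 1) = w ++ W j ∧
      Runs p I (update (s j) x (n - 1 - j)) I (update (s (j + 1)) x (n - 1 - j)) w t) :
    Runs (rep x p) I (update (s 0) x n) I (update (s n) x 0) (W n) (n * (t + 1) + 2) := by
  intro O
  have key : ∀ r ≤ n, Run (rep x p) (st I (W (n - r) ++ O) (update (s (n - r)) x r))
      (st I (W n ++ O) (update (s n) x 0)) (r * (t + 1) + 2) := by
    intro r
    induction r with
    | zero =>
      intro _
      refine (Run.loop_exit (t := 1) ?_ ?_).mono (by omega)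
      · simp [st]
      · have : (st I (W n ++ O) (update (s n) x 0) (Reg.cnt x)).head? = none := by simp [st]
        rw [Nat.sub_zero, this,
          show (st I (W n ++ O) (update (s n) x 0) (Reg.cnt x)).tail = List.replicate 0 true by
            simp [st], update_cnt, update_idem]
        exact Run.skip _
    | succ r ih =>
      intro hr
      obtain ⟨w, hw, hp⟩ := h (n - (r + 1)) (by omega)
      rw [show n - 1 - (n - (r + 1)) = r by omega, show n - (r + 1) + 1 = n - r by omega] at hp
      rw [show n - (r + 1) + 1 = n - r by omega] at hw
      have h1 := hp (W (n - (r + 1)) ++ O)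
      rw [← List.append_assoc, ← hw] at h1
      refine (Run.loop_again (t := t) (S' := st I (W (n - r) ++ O) (update (s (n - r)) x r))
        (by simp [st, List.replicate_succ]) ?_ (ih (by omega))).mono
          (le_of_eq (by ring))
      have e : (st I (W (n - (r + 1)) ++ O) (update (s (n - (r + 1))) x (r + 1))
          (Reg.cnt x)).head? = some true := by simp [st, List.replicate_succ]
      rw [e, show (st I (W (n - (r + 1)) ++ O) (update (s (n - (r + 1))) x (r + 1))
          (Reg.cnt x)).tail = List.replicate r true by simp [st], update_cnt, update_idem]
      exact h1
  have := key n le_rfl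
  rwa [Nat.sub_self, hW] at this

/-- Set the counter `x` to `0`. -/
def clear (x : Counter) : Prog := rep x .skip

theorem runs_clear (x : Counter) (I : List Bool) (c : Counter → ℕ) :
    Runs (clear x) I c I (update c x 0) [] (2 * c x + 2) := by
  have := runs_rep (x := x) (p := .skip) (I := I) (n := c x) (t := 1) (fun _ => c) (fun _ => [])
    rfl (fun j hj => ⟨[], rfl, runs_skip _ _⟩)
  rw [update_eq_self] at this
  exact this.mono (by omega)

/-- Add the counter `x` to the counter `y`. -/
def addTo (x y : Counter) : Prog :=
  .seq (rep x (.seq (inc .tmp) (inc y))) (rep .tmp (inc x))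

/-- A unary counter can be read only by emptying it. It is drained into `y` and `tmp` at once, and
then restored from `tmp`, which is again zero at the end. -/
theorem runs_addTo {x y : Counter} (hxy : x ≠ y) (hx : x ≠ .tmp) (hy : y ≠ .tmp) (I : List Bool)
    {c : Counter → ℕ} (hc : c .tmp = 0) :
    Runs (addTo x y) I c I (update c y (c y + c x)) [] (5 * c x + 4) := by
  have h1 := runs_rep (x := x) (p := .seq (inc .tmp) (inc y)) (I := I) (n := c x) (t := 2)
    (fun j => update (update c .tmp j) y (c y + j)) (fun _ => [])
    rfl (fun j hj => ⟨[], rfl, by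
      convert (runs_inc .tmp I _).seq (runs_inc y I _) using 1
      · funext z
        simp only [update_apply]
        split_ifs <;> (simp_all; try omega)
      · rfl⟩)
  have h2 := runs_rep (x := .tmp) (p := inc x) (I := I) (n := c x) (t := 1)
    (fun j => update (update c y (c y + c x)) x j) (fun _ => [])
    rfl (fun j hj => ⟨[], rfl, by
      convert runs_inc x I _ using 1
      funext z
      simp only [update_apply]
      split_ifs <;> simp_all⟩)
  have e1 : update (update (update c .tmp 0) y (c y + 0)) x (c x) = c := by
    funext z
    simp only [update_apply]
    split_ifs <;> simp_all
  have e2 : update (update (update c .tmp (c x)) y (c y + c x)) x 0 =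
      update (update (update c y (c y + c x)) x 0) .tmp (c x) := by
    funext z
    simp only [update_apply]
    split_ifs <;> simp_all
  have e3 : update (update (update c y (c y + c x)) x (c x)) .tmp 0 =
      update c y (c y + c x) := by
    funext z
    simp only [update_apply]
    split_ifs <;> simp_all
  simp only [e1, e2] at h1
  simp only [e3] at h2
  exact (h1.seq h2).mono (by omega)

/-- Write the number in the counter `x`. -/
def writeNum (x : Counter) : Prog :=
  .seq (.push Reg.out false)
    (.seq (rep x (.seq (inc .tmp) (.push Reg.out true))) (rep .tmp (inc x)))

/-- Words are written from the end, so the terminating `false` is pushed before the digits. -/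
theorem runs_writeNum {x : Counter} (hx : x ≠ .tmp) (I : List Bool)
    {c : Counter → ℕ} (hc : c .tmp = 0) :
    Runs (writeNum x) I c I c (encodeTally [c x]) (5 * c x + 5) := by
  have h1 := runs_rep (x := x) (p := .seq (inc .tmp) (.push Reg.out true)) (I := I) (n := c x)
    (t := 2) (fun j => update c .tmp j) (fun j => List.replicate j true)
    rfl (fun j hj => ⟨[true], rfl, by
      convert (runs_inc .tmp I _).seq (runs_write true I _) using 1
      · funext z
        simp only [update_apply]
        split_ifs <;> simp_all
      · rfl⟩)
  have h2 := runs_rep (x := .tmp) (p := inc x) (I := I) (n := c x) (t := 1)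
    (fun j => update c x j) (fun _ => [])
    rfl (fun j hj => ⟨[], rfl, by
      convert runs_inc x I _ using 1
      funext z
      simp only [update_apply]
      split_ifs <;> simp_all⟩)
  have e1 : update (update c .tmp 0) x (c x) = c := by
    funext z
    simp only [update_apply]
    split_ifs <;> simp_all
  have e2 : update (update c .tmp (c x)) x 0 = update (update c x 0) .tmp (c x) := by
    funext z
    simp only [update_apply]
    split_ifs <;> simp_all
  have e3 : update (update c x (c x)) .tmp 0 = c := by
    funext z
    simp only [update_apply]
    split_ifs <;> simp_all
  simp only [e1, e2] at h1
  simp only [e3] at h2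
  have := ((runs_write false I c).seq (h1.seq h2)).mono (t' := 5 * c x + 5) (by omega)
  simpa [encodeTally, writeNum] using this

/-- Add the product of the counters `x` and `len` to the counter `y`. -/
def mulTo (x y : Counter) : Prog := .seq (addTo x .iter) (rep .iter (addTo .len y))

theorem runs_mulTo {x y : Counter} (hx : x ≠ .tmp) (hx' : x ≠ .iter) (hy : y ≠ .tmp)
    (hy' : y ≠ .iter) (hlen : y ≠ .len) (I : List Bool) {c : Counter → ℕ} (hc : c .tmp = 0)
    (hc' : c .iter = 0) :
    Runs (mulTo x y) I c I (update c y (c y + c x * c .len)) []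
      (5 * c x + 4 + (c x * (5 * c .len + 5) + 2)) := by
  have h1 := runs_addTo hx' hx (by decide) I hc
  have h2 := runs_rep (x := .iter) (p := addTo .len y) (I := I) (n := c x) (t := 5 * c .len + 4)
    (fun j => update c y (c y + j * c .len)) (fun _ => [])
    rfl (fun j hj => ⟨[], rfl, by
      convert runs_addTo hlen.symm (by decide) hy I ?_ using 1
      · funext z
        simp only [update_apply]
        split_ifs <;> (simp_all; try ring)
      · simp [hlen.symm]
      · simp [hy.symm, hc]⟩)
  have e1 : update (update c y (c y + 0 * c .len)) .iter (c x) =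
      update c .iter (c .iter + c x) := by
    rw [zero_mul, add_zero, update_eq_self, hc', zero_add]
  have e2 : update (update c y (c y + c x * c .len)) .iter 0 =
      update c y (c y + c x * c .len) := by
    funext z
    simp only [update_apply]
    split_ifs <;> simp_all
  simp only [e1, e2] at h2
  exact h1.seq h2

end Counters

/-! ### Writing ladders and edges -/

/-- The word of a list of edges, the last edge first. -/
def edgesWord (l : List (ℕ × ℕ × ℕ)) : List Bool :=
  encodeTally (l.reverse.flatMap fun e => [e.1, e.2.1, e.2.2])

/-- The edges written last stand in front. For this reason the graph of a formula lists its edges in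
reverse order. -/
theorem edgesWord_append (l l' : List (ℕ × ℕ × ℕ)) :
    edgesWord (l ++ l') = edgesWord l' ++ edgesWord l := by
  simp [edgesWord, encodeTally, List.flatMap_append]

theorem edgesWord_range_succ (f : ℕ → List (ℕ × ℕ × ℕ)) (n : ℕ) :
    edgesWord ((List.range (n + 1)).flatMap f) =
      edgesWord (f n) ++ edgesWord ((List.range n).flatMap f) := by
  rw [List.range_succ, List.flatMap_append, edgesWord_append]
  simp

namespace Counters

open StackProg Function

/-- Write the number `w`. -/
def writeConst : ℕ → Prog
  | 0 => .push Reg.out false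
  | w + 1 => .seq (writeConst w) (.push Reg.out true)

theorem runs_writeConst (w : ℕ) (I : List Bool) (c : Counter → ℕ) :
    Runs (writeConst w) I c I c (encodeTally [w]) (w + 1) := by
  induction w with
  | zero => exact runs_write _ _ _
  | succ w ih => exact ih.seq (runs_write _ _ _)

/-- Write the edge that joins the values of the counters `x` and `y`, with weight `w`. -/
def writeEdge (x y : Counter) (w : ℕ) : Prog :=
  .seq (writeConst w) (.seq (writeNum y) (writeNum x))

theorem runs_writeEdge {x y : Counter} (hx : x ≠ .tmp) (hy : y ≠ .tmp) (w : ℕ) (I : List Bool)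
    {c : Counter → ℕ} (hc : c .tmp = 0) :
    Runs (writeEdge x y w) I c I c (edgesWord [(c x, c y, w)])
      (w + 5 * c x + 5 * c y + 11) := by
  have := ((runs_writeConst w I c).seq ((runs_writeNum hy I hc).seq (runs_writeNum hx I hc))).mono
    (t' := w + 5 * c x + 5 * c y + 11) (by omega)
  simpa [edgesWord, encodeTally, writeEdge] using this

/-- Write the edge that joins the value of the counter `x` and its successor, with weight `w`. -/
def writeSuccEdge (x : Counter) (w : ℕ) : Prog :=
  .seq (writeConst w) (.seq (inc x) (.seq (writeNum x) (.seq (dec x) (writeNum x))))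

theorem runs_writeSuccEdge {x : Counter} (hx : x ≠ .tmp) (w : ℕ) (I : List Bool)
    {c : Counter → ℕ} (hc : c .tmp = 0) :
    Runs (writeSuccEdge x w) I c I c (edgesWord [(c x, c x + 1, w)]) (w + 10 * c x + 19) := by
  have h1 := runs_writeNum (x := x) hx I (c := update c x (c x + 1)) (by simp [hx.symm, hc])
  have h2 := runs_dec x I (update c x (c x + 1))
  simp only [update_self, Nat.add_sub_cancel, update_idem, update_eq_self] at h1 h2
  have := ((runs_writeConst w I c).seq ((runs_inc x I c).seq (h1.seq
    (h2.seq (runs_writeNum hx I hc))))).mono (t' := w + 10 * c x + 19) (by omega)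
  simpa [edgesWord, encodeTally, writeSuccEdge] using this

/-- Set the counters `lo`, `hi` and `iter`. -/
def low (c : Counter → ℕ) (a b i : ℕ) : Counter → ℕ
  | .lo => a
  | .hi => b
  | .iter => i
  | x => c x

section Low

variable (c : Counter → ℕ) (a b i n : ℕ)

theorem update_low_lo : update (low c a b i) .lo n = low c n b i := by
  funext x; cases x <;> rfl

theorem update_low_hi : update (low c a b i) .hi n = low c a n i := by
  funext x; cases x <;> rfl

theorem update_low_iter : update (low c a b i) .iter n = low c a b n := by
  funext x; cases x <;> rfl

variable {c}

theorem low_eq (hlo : c .lo = 0) (hhi : c .hi = 0) (hiter : c .iter = 0) : low c 0 0 0 = c := by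
  funext x; cases x <;> simp [low, *]

end Low

/-- Write a level of a ladder. -/
def writeLevel (w : ℕ) : Prog :=
  .seq (writeEdge .lo .hi w) (.seq (writeSuccEdge .lo 2) (.seq (inc .lo)
    (.seq (dec .hi) (writeSuccEdge .hi 1))))

theorem runs_writeLevel {w : ℕ} (I : List Bool) {c : Counter → ℕ} (hc : c .tmp = 0)
    {a b i B : ℕ} (hb : 0 < b) (ha : a ≤ B) (hbB : b ≤ B) (hw : w ≤ 3) :
    Runs (writeLevel w) I (low c a b i) I (low c (a + 1) (b - 1) i) (edgesWord (ladderLevel a b w))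
      (30 * B + 60) := by
  have hc' : ∀ a b i, low c a b i .tmp = 0 := fun a b i => hc
  have h1 := runs_writeEdge (x := .lo) (y := .hi) (by decide) (by decide) w I (hc' a b i)
  have h2 := runs_writeSuccEdge (x := .lo) (by decide) 2 I (hc' a b i)
  have h3 := runs_inc .lo I (low c a b i)
  have h4 := runs_dec .hi I (low c (a + 1) b i)
  have h5 := runs_writeSuccEdge (x := .hi) (by decide) 1 I (hc' (a + 1) (b - 1) i)
  rw [update_low_lo] at h3
  rw [update_low_hi] at h4
  have := (h1.seq (h2.seq (h3.seq (h4.seq h5)))).mono (t' := 30 * B + 60) (by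
    simp only [low]; omega)
  simp only [List.append_nil, ← edgesWord_append, low] at this
  rw [Nat.sub_add_cancel hb] at this
  exact this

/-- The time that it takes to write a ladder, in terms of a bound for the counters. -/
def wireTime {R : Type*} [CommSemiring R] (B : R) : R := 35 * B ^ 2 + 200 * B + 400

/-- Write the ladder that leads from the main vertex with the number `cur` to the next one and has
first rung `r`, and increase `cur`. -/
def writeWire (r : ℕ) : Prog :=
  .seq (mulTo .cur .lo) (.seq (addTo .lo .hi) (.seq (addTo .len .hi) (.seq (writeLevel r)
    (.seq (addTo .rungs .iter) (.seq (rep .iter (writeLevel 1)) (.seq (writeLevel 3)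
      (.seq (writeEdge .lo .hi 1) (.seq (clear .lo) (.seq (clear .hi) (inc .cur))))))))))

/-- The counters `lo` and `hi` start at the two ends of the ladder and approach each other by one at
each level; after `k + 2` levels they are `u + k + 2` and `u + k + 3`, the ends of the innermost
edge. -/
theorem runs_writeWire {r : ℕ} (I : List Bool) {c : Counter → ℕ} (hc : c .tmp = 0)
    (hlo : c .lo = 0) (hhi : c .hi = 0) (hiter : c .iter = 0) (hlen : c .len = 2 * c .rungs + 5)
    {B : ℕ} (hB : (c .cur + 1) * c .len ≤ B) (hr : r ≤ 3) :
    Runs (writeWire r) I c I (update c .cur (c .cur + 1))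
      (edgesWord (GraphPart.expand (c .rungs) (.wire (c .cur) r))) (wireTime B) := by
  set k := c .rungs with hk
  set m := c .cur with hm
  have hu : m * (2 * k + 5) + (2 * k + 5) ≤ B := by rw [hlen] at hB; linarith
  have hmB : m ≤ B := by nlinarith
  set u := m * (2 * k + 5) with hu'
  have hc' : ∀ a b i, low c a b i .tmp = 0 := fun a b i => hc
  have e0 := low_eq hlo hhi hiter
  have h1 := runs_mulTo (x := .cur) (y := .lo) (by decide) (by decide) (by decide) (by decide)
    (by decide) I (hc' 0 0 0) rfl
  have h2 := runs_addTo (x := .lo) (y := .hi) (by decide) (by decide) (by decide) I (hc' u 0 0)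
  have h3 := runs_addTo (x := .len) (y := .hi) (by decide) (by decide) (by decide) I (hc' u u 0)
  have h4 := runs_writeLevel (w := r) I hc (a := u) (b := u + (2 * k + 5)) (i := 0) (B := B)
    (by omega) (by omega) (by omega) hr
  have h5 := runs_addTo (x := .rungs) (y := .iter) (by decide) (by decide) (by decide) I
    (hc' (u + 1) (u + (2 * k + 5) - 1) 0)
  have h6 := runs_rep (x := .iter) (p := writeLevel 1) (I := I) (n := k) (t := 30 * B + 60)
    (fun j => low c (u + 1 + j) (u + (2 * k + 4) - j) 0)
    (fun j => edgesWord ((List.range j).flatMap fun j =>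
      ladderLevel (u + 1 + j) (u + (2 * k + 4) - j) 1))
    rfl (fun j hj => ⟨_, edgesWord_range_succ _ _, by
      simp only [update_low_iter]
      exact runs_writeLevel (w := 1) I hc (a := u + 1 + j) (b := u + (2 * k + 4) - j)
        (i := k - 1 - j) (B := B) (by omega) (by omega) (by omega) (by omega)⟩)
  have h7 := runs_writeLevel (w := 3) I hc (a := u + 1 + k) (b := u + k + 4) (i := 0) (B := B)
    (by omega) (by omega) (by omega) le_rfl
  have h8 := runs_writeEdge (x := .lo) (y := .hi) (by decide) (by decide) 1 I
    (hc' (u + k + 2) (u + k + 3) 0)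
  have h9 := runs_clear .lo I (low c (u + k + 2) (u + k + 3) 0)
  have h10 := runs_clear .hi I (low c 0 (u + k + 3) 0)
  have h11 := runs_inc .cur I c
  simp only [update_low_lo, update_low_hi, update_low_iter, low, zero_add, hlen, ← hk, ← hm]
    at h1 h2 h3 h5 h6 h8 h9 h10 h11
  rw [e0] at h1 h10
  rw [show u + (2 * k + 4) - k = u + k + 4 by omega] at h6
  rw [show u + 1 + k + 1 = u + k + 2 by omega, show u + k + 4 - 1 = u + k + 3 by omega] at h7
  rw [show u + (2 * k + 5) - 1 = u + (2 * k + 4) by omega] at h5 h4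
  -- The products are bounded beforehand, because the final comparison of times is linear.
  have hm2 : m * (5 * (2 * k + 5) + 5) ≤ B * (5 * B + 5) :=
    Nat.mul_le_mul hmB (by omega)
  have hk2 : k * (30 * B + 60 + 1) ≤ B * (30 * B + 61) := Nat.mul_le_mul (by omega) le_rfl
  have := (h1.seq (h2.seq (h3.seq (h4.seq (h5.seq (h6.seq (h7.seq (h8.seq (h9.seq
    (h10.seq h11)))))))))).mono (t' := wireTime B) (by
      rw [wireTime]
      have e1 : B * (5 * B + 5) = 5 * B ^ 2 + 5 * B := by ring
      have e2 : B * (30 * B + 61) = 30 * B ^ 2 + 61 * B := by ring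
      omega)
  simp only [List.append_nil, List.nil_append, ← edgesWord_append] at this
  simpa only [GraphPart.expand, ladder, List.append_assoc, writeWire, ← hu'] using this

/-- The time that it takes to write an edge, in terms of a bound for the counters. -/
def jumpTime {R : Type*} [CommSemiring R] (B : R) : R := 10 * B ^ 2 + 40 * B + 50

/-- Write the edge that joins the main vertices with the numbers `x` and `y`. -/
def writeJump (x y : Counter) : Prog :=
  .seq (mulTo x .lo) (.seq (mulTo y .hi) (.seq (writeEdge .lo .hi 1)
    (.seq (clear .lo) (clear .hi))))

theorem runs_writeJump {x y : Counter} (hx : x ∉ [Counter.tmp, .iter, .lo, .hi])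
    (hy : y ∉ [Counter.tmp, .iter, .lo, .hi]) (I : List Bool) {c : Counter → ℕ} (hc : c .tmp = 0)
    (hlo : c .lo = 0) (hhi : c .hi = 0) (hiter : c .iter = 0) (hlen : c .len = 2 * c .rungs + 5)
    {B : ℕ} (hxB : c x * c .len ≤ B) (hyB : c y * c .len ≤ B) (hB : c .len ≤ B) :
    Runs (writeJump x y) I c I c (edgesWord (GraphPart.expand (c .rungs) (.jump (c x) (c y))))
      (jumpTime B) := by
  simp only [List.mem_cons, List.not_mem_nil, or_false, not_or] at hx hy
  have hc' : ∀ a b i, low c a b i .tmp = 0 := fun a b i => hc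
  have e0 := low_eq hlo hhi hiter
  have ex : ∀ a b i, low c a b i x = c x := fun a b i => by cases x <;> first | rfl | simp at hx
  have ey : ∀ a b i, low c a b i y = c y := fun a b i => by cases y <;> first | rfl | simp at hy
  have h1 := runs_mulTo (x := x) (y := .lo) hx.1 hx.2.1 (by decide) (by decide)
    (by decide) I (hc' 0 0 0) rfl
  have h2 := runs_mulTo (x := y) (y := .hi) hy.1 hy.2.1 (by decide) (by decide)
    (by decide) I (hc' (c x * c .len) 0 0) rfl
  have h3 := runs_writeEdge (x := .lo) (y := .hi) (by decide) (by decide) 1 I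
    (hc' (c x * c .len) (c y * c .len) 0)
  have h4 := runs_clear .lo I (low c (c x * c .len) (c y * c .len) 0)
  have h5 := runs_clear .hi I (low c 0 (c y * c .len) 0)
  simp only [ex, ey, update_low_lo, update_low_hi] at h1 h2 h3 h4 h5
  simp only [low, zero_add] at h1 h2 h3 h4 h5
  rw [e0] at h1 h5
  have hxB' : c x ≤ B := by nlinarith
  have hyB' : c y ≤ B := by nlinarith
  have hm1 : c x * (5 * c .len + 5) ≤ B * (5 * B + 5) := Nat.mul_le_mul hxB' (by omega)
  have hm2 : c y * (5 * c .len + 5) ≤ B * (5 * B + 5) := Nat.mul_le_mul hyB' (by omega)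
  have := (h1.seq (h2.seq (h3.seq (h4.seq h5)))).mono (t' := jumpTime B) (by
      rw [jumpTime]
      have e1 : B * (5 * B + 5) = 5 * B ^ 2 + 5 * B := by ring
      omega)
  simpa only [List.append_nil, List.nil_append, hlen, writeJump, GraphPart.expand] using this

end Counters

/-! ### Writing the parts of the graph of a formula -/

/-- The word of the edges of a list of parts. -/
def partsWord (k : ℕ) (l : List GraphPart) : List Bool := edgesWord (l.flatMap (GraphPart.expand k))

theorem partsWord_append (k : ℕ) (l l' : List GraphPart) :
    partsWord k (l ++ l') = partsWord k l' ++ partsWord k l := by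
  rw [partsWord, List.flatMap_append, edgesWord_append]
  rfl

theorem partsWord_range_succ (k : ℕ) (f : ℕ → List GraphPart) (n : ℕ) :
    partsWord k ((List.range (n + 1)).flatMap f) =
      partsWord k (f n) ++ partsWord k ((List.range n).flatMap f) := by
  rw [List.range_succ, List.flatMap_append, partsWord_append]
  simp

namespace Counters

open StackProg Function GraphPart

theorem Runs.congr {p : Prog} {I I' w w' : List Bool} {c c' c'' : Counter → ℕ} {t t' : ℕ}
    (h : Runs p I c I' c' w t) (hc : c' = c'') (hw : w = w') (ht : t ≤ t') :
    Runs p I c I' c'' w' t' := hc ▸ hw ▸ h.mono ht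

/-- The counters between the steps that write a part. -/
def top (k ν cur old p q p' o rem : ℕ) : Counter → ℕ
  | .rungs => k
  | .len => 2 * k + 5
  | .vars => ν
  | .cur => cur
  | .old => old
  | .p => p
  | .q => q
  | .p' => p'
  | .o => o
  | .rem => rem
  | _ => 0

section Top

variable {k ν cur old p q p' o rem B : ℕ} (n : ℕ) (I : List Bool)

theorem update_top_cur : update (top k ν cur old p q p' o rem) .cur n =
    top k ν n old p q p' o rem := by
  funext x; cases x <;> rfl

theorem update_top_old : update (top k ν cur old p q p' o rem) .old n =
    top k ν cur n p q p' o rem := by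
  funext x; cases x <;> rfl

theorem update_top_p : update (top k ν cur old p q p' o rem) .p n =
    top k ν cur old n q p' o rem := by
  funext x; cases x <;> rfl

theorem update_top_q : update (top k ν cur old p q p' o rem) .q n =
    top k ν cur old p n p' o rem := by
  funext x; cases x <;> rfl

theorem update_top_p' : update (top k ν cur old p q p' o rem) .p' n =
    top k ν cur old p q n o rem := by
  funext x; cases x <;> rfl

theorem update_top_o : update (top k ν cur old p q p' o rem) .o n =
    top k ν cur old p q p' n rem := by
  funext x; cases x <;> rfl

theorem update_top_rem : update (top k ν cur old p q p' o rem) .rem n =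
    top k ν cur old p q p' o n := by
  funext x; cases x <;> rfl

theorem top_wire {r : ℕ} (hr : r ≤ 3) (hB : (cur + 1) * (2 * k + 5) ≤ B) :
    Runs (writeWire r) I (top k ν cur old p q p' o rem) I (top k ν (cur + 1) old p q p' o rem)
      (partsWord k [wire cur r]) (wireTime B) := by
  have := runs_writeWire (r := r) I (c := top k ν cur old p q p' o rem) rfl rfl rfl rfl rfl hB hr
  rw [update_top_cur] at this
  simpa [partsWord, top] using this

theorem top_jump (x y : Counter) (hx : x ∉ [Counter.tmp, .iter, .lo, .hi])
    (hy : y ∉ [Counter.tmp, .iter, .lo, .hi])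
    (hxB : top k ν cur old p q p' o rem x * (2 * k + 5) ≤ B)
    (hyB : top k ν cur old p q p' o rem y * (2 * k + 5) ≤ B) (hB : 2 * k + 5 ≤ B) :
    Runs (writeJump x y) I (top k ν cur old p q p' o rem) I (top k ν cur old p q p' o rem)
      (partsWord k [jump (top k ν cur old p q p' o rem x) (top k ν cur old p q p' o rem y)])
      (jumpTime B) := by
  have := runs_writeJump hx hy I (c := top k ν cur old p q p' o rem) rfl rfl rfl rfl rfl hxB hyB hB
  rw [partsWord, List.flatMap_cons, List.flatMap_nil, List.append_nil]
  exact this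

/-- Increase the counter `old` by `n`. -/
def advance : ℕ → Prog
  | 0 => .skip
  | n + 1 => .seq (advance n) (inc .old)

theorem top_advance : Runs (advance n) I (top k ν cur old p q p' o rem) I
    (top k ν cur (old + n) p q p' o rem) [] (n + 1) := by
  induction n with
  | zero => exact runs_skip _ _
  | succ n ih =>
    have := ih.seq (runs_inc .old I _)
    rwa [update_top_old] at this

/-- Write the parts of a row for a variable that does not occur in the literal. -/
def plainStep : Prog :=
  .seq (writeJump .old .cur) (.seq (writeWire 3) (.seq (writeWire 2) (advance 2)))

/-- Write the parts of a row for the variable of the literal. -/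
def litStep : Prog :=
  .seq (writeJump .old .q) (.seq (writeJump .p .cur) (.seq (writeWire 3) (.seq (writeWire 2)
    (advance 2))))

/-- The time that it takes to write the parts of a row for a variable. -/
def stepTime {R : Type*} [CommSemiring R] (B : R) : R := 2 * jumpTime B + 2 * wireTime B + 6

theorem top_plainStep (h : ∀ x ∈ [cur + 2, old, 1], x * (2 * k + 5) ≤ B) :
    Runs plainStep I (top k ν cur old p q p' o rem) I (top k ν (cur + 2) (old + 2) p q p' o rem)
      (partsWord k [jump old cur, wire cur 3, wire (cur + 1) 2]) (stepTime B) := by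
  simp only [List.mem_cons, List.not_mem_nil, or_false, forall_eq_or_imp, forall_eq, one_mul] at h
  obtain ⟨h1, h2, h3⟩ := h
  refine ((top_jump (B := B) I .old .cur (by decide) (by decide) h2 ?_ h3).seq
    ((top_wire (B := B) I le_rfl ?_).seq ((top_wire I (by decide) h1).seq (top_advance 2 I)))).congr rfl
    (by simp only [List.nil_append, ← partsWord_append]; rfl) (by rw [stepTime]; omega)
  · exact (Nat.mul_le_mul_right _ (by simp [top])).trans h1
  · exact (Nat.mul_le_mul_right _ (by omega)).trans h1

theorem top_litStep (h : ∀ x ∈ [cur + 2, old, p, q, 1], x * (2 * k + 5) ≤ B) :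
    Runs litStep I (top k ν cur old p q p' o rem) I (top k ν (cur + 2) (old + 2) p q p' o rem)
      (partsWord k [jump old q, jump p cur, wire cur 3, wire (cur + 1) 2]) (stepTime B) := by
  simp only [List.mem_cons, List.not_mem_nil, or_false, forall_eq_or_imp, forall_eq, one_mul] at h
  obtain ⟨h1, h2, h3, h4, h5⟩ := h
  refine ((top_jump I .old .q (by decide) (by decide) h2 h4 h5).seq
    ((top_jump (B := B) I .p .cur (by decide) (by decide) h3 ?_ h5).seq
    ((top_wire (B := B) I le_rfl ?_).seq ((top_wire I (by decide) h1).seq (top_advance 2 I))))).congr rfl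
    (by simp only [List.nil_append, ← partsWord_append]; rfl) (by rw [stepTime]; omega)
  · exact (Nat.mul_le_mul_right _ (by simp [top])).trans h1
  · exact (Nat.mul_le_mul_right _ (by omega)).trans h1

/-- Write the parts of a row, up to the variable of the literal, which is read from the input. -/
def litLoop : Prog :=
  .loop Reg.inp (fun
    | some true => .seq plainStep (dec .rem)
    | some false => .seq litStep (dec .rem)
    | none => .skip) fun o => o == some true

/-- The index of the literal is unary on the input and is consumed while the row is written: every
`true` is a column of another variable, and the closing `false` is the column of the literal. The
counter `rem` keeps track of the columns to come. -/
theorem top_litLoop {i : ℕ} (h : ∀ x ∈ [cur + 2 * i + 2, old + 2 * i, p, q, 1],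
    x * (2 * k + 5) ≤ B) :
    Runs litLoop (List.replicate i true ++ false :: I) (top k ν cur old p q p' o rem) I
      (top k ν (cur + 2 * (i + 1)) (old + 2 * (i + 1)) p q p' o (rem - (i + 1)))
      (partsWord k (litRow (i + 1) i old q p cur)) ((i + 1) * (stepTime B + 3)) := by
  simp only [List.mem_cons, List.not_mem_nil, or_false, forall_eq_or_imp, forall_eq, one_mul] at h
  obtain ⟨h1, h2, h3, h4, h5⟩ := h
  intro O
  set f : ℕ → List GraphPart := fun v =>
    (if v = i then [jump (old + 2 * v) q, jump p (cur + 2 * v)] else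
      [jump (old + 2 * v) (cur + 2 * v)]) ++ [wire (cur + 2 * v) 3, wire (cur + 2 * v + 1) 2]
  have key : ∀ r ≤ i, Run litLoop (st (List.replicate r true ++ false :: I)
      (partsWord k ((List.range (i - r)).flatMap f) ++ O)
      (top k ν (cur + 2 * (i - r)) (old + 2 * (i - r)) p q p' o (rem - (i - r))))
      (st I (partsWord k ((List.range (i + 1)).flatMap f) ++ O)
      (top k ν (cur + 2 * (i + 1)) (old + 2 * (i + 1)) p q p' o (rem - (i + 1))))
      ((r + 1) * (stepTime B + 3)) := by
    intro r
    induction r with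
    | zero =>
      intro _
      rw [Nat.sub_zero, zero_add, one_mul, partsWord_range_succ, List.append_assoc]
      refine Run.loop_exit (t := stepTime B + 2) rfl ?_
      rw [show (st (List.replicate 0 true ++ false :: I)
        (partsWord k ((List.range i).flatMap f) ++ O)
        (top k ν (cur + 2 * i) (old + 2 * i) p q p' o (rem - i)) Reg.inp).tail = I from rfl,
        update_inp]
      have := (top_litStep (k := k) (ν := ν) (p' := p') (o := o) (rem := rem - i) (B := B) I
        (cur := cur + 2 * i) (old := old + 2 * i) (p := p) (q := q)
        (by simp [h1, h2, h3, h4, h5])).seq (runs_dec .rem I _)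
      rw [update_top_rem] at this
      have := this (partsWord k ((List.range i).flatMap f) ++ O)
      rw [show f i = [jump (old + 2 * i) q, jump p (cur + 2 * i), wire (cur + 2 * i) 3,
        wire (cur + 2 * i + 1) 2] by simp [f]]
      exact this
    | succ r ih =>
      intro hr
      have hir : i - r = i - (r + 1) + 1 := by omega
      have hlt : i - (r + 1) < i := by omega
      have ih := ih (by omega)
      rw [hir] at ih
      generalize i - (r + 1) = j at ih hlt ⊢
      have h' : (cur + 2 * j + 2) * (2 * k + 5) ≤ B :=
        (Nat.mul_le_mul_right _ (by omega)).trans h1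
      have h'' : (old + 2 * j) * (2 * k + 5) ≤ B :=
        (Nat.mul_le_mul_right _ (by omega)).trans h2
      have := (top_plainStep (k := k) (ν := ν) (p' := p') (o := o) (rem := rem - j) (B := B)
        (List.replicate r true ++ false :: I)
        (cur := cur + 2 * j) (old := old + 2 * j) (p := p) (q := q)
        (by simp [h', h'', h5])).seq (runs_dec .rem _ _)
      rw [update_top_rem] at this
      have := this (partsWord k ((List.range j).flatMap f) ++ O)
      refine (Run.loop_again (t := stepTime B + 2) rfl ?_ ih).mono (le_of_eq (by ring))
      rw [show (st (List.replicate (r + 1) true ++ false :: I)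
        (partsWord k ((List.range j).flatMap f) ++ O)
        (top k ν (cur + 2 * j) (old + 2 * j) p q p' o (rem - j)) Reg.inp).tail =
          List.replicate r true ++ false :: I from rfl, update_inp, partsWord_range_succ,
        List.append_assoc]
      rw [show f j = [jump (old + 2 * j) (cur + 2 * j), wire (cur + 2 * j) 3,
        wire (cur + 2 * j + 1) 2] by simp [f, hlt.ne]]
      exact this
  have := key i le_rfl
  rw [Nat.sub_self] at this
  exact this

/-- Write the parts of a row. -/
def rowProg : Prog := .seq (addTo .vars .rem) (.seq litLoop (rep .rem plainStep))

/-- The time that it takes to write the parts of a row. -/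
def rowTime {R : Type*} [CommSemiring R] (B : R) : R := B * (stepTime B + 8) + 10

theorem top_rowProg {i : ℕ} (hi : i < ν) (hν : ν ≤ B)
    (h : ∀ x ∈ [cur + 2 * ν, old + 2 * ν, p, q, 1], x * (2 * k + 5) ≤ B) :
    Runs rowProg (encodeTally [i] ++ I) (top k ν cur old p q p' o 0) I
      (top k ν (cur + 2 * ν) (old + 2 * ν) p q p' o 0)
      (partsWord k (litRow ν i old q p cur)) (rowTime B) := by
  simp only [List.mem_cons, List.not_mem_nil, or_false, forall_eq_or_imp, forall_eq, one_mul] at h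
  obtain ⟨h1, h2, h3, h4, h5⟩ := h
  have hle : ∀ {x y : ℕ}, x ≤ y → y * (2 * k + 5) ≤ B → x * (2 * k + 5) ≤ B := fun hxy hy =>
    (Nat.mul_le_mul_right _ hxy).trans hy
  have r1 := runs_addTo (x := .vars) (y := .rem) (by decide) (by decide) (by decide)
    (encodeTally [i] ++ I) (c := top k ν cur old p q p' o 0) rfl
  have e0 : encodeTally [i] ++ I = List.replicate i true ++ false :: I := by simp [encodeTally]
  rw [update_top_rem, show top k ν cur old p q p' o 0 .rem + top k ν cur old p q p' o 0 .vars = ν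
    from zero_add ν, e0] at r1
  rw [e0]
  have r2 := top_litLoop (k := k) (ν := ν) (cur := cur) (old := old) (p := p) (q := q) (p' := p')
    (o := o) (rem := ν) (B := B) I (i := i) (by
      simp [h3, h4, h5, hle (show cur + 2 * i + 2 ≤ cur + 2 * ν by omega) h1,
        hle (show old + 2 * i ≤ old + 2 * ν by omega) h2])
  set g : ℕ → List GraphPart := fun v =>
    [jump (old + 2 * (i + 1 + v)) (cur + 2 * (i + 1 + v)), wire (cur + 2 * (i + 1 + v)) 3,
      wire (cur + 2 * (i + 1 + v) + 1) 2] with hg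
  have r3 := runs_rep (x := .rem) (p := plainStep) (I := I) (n := ν - (i + 1)) (t := stepTime B)
    (fun j => top k ν (cur + 2 * (i + 1 + j)) (old + 2 * (i + 1 + j)) p q p' o 0)
    (fun j => partsWord k ((List.range j).flatMap g)) rfl
    (fun j hj => ⟨_, partsWord_range_succ _ _ _, by
      simp only [update_top_rem]
      exact top_plainStep I (by
        simp [h5, hle (show cur + 2 * (i + 1 + j) + 2 ≤ cur + 2 * ν by omega) h1,
          hle (show old + 2 * (i + 1 + j) ≤ old + 2 * ν by omega) h2])⟩)
  simp only [update_top_rem, add_zero] at r3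
  rw [show i + 1 + (ν - (i + 1)) = ν by omega] at r3
  -- The row is split after the column of the literal; all columns beyond it are plain.
  have e : litRow ν i old q p cur =
      litRow (i + 1) i old q p cur ++ (List.range (ν - (i + 1))).flatMap g := by
    conv_lhs => rw [show ν = i + 1 + (ν - (i + 1)) by omega]
    simp only [litRow]
    rw [List.range_add, List.flatMap_append, List.flatMap_map]
    congr 1
    refine List.flatMap_congr fun v _ => ?_
    simp [hg, show ¬ (i + 1 + v = i) by omega]
  refine (r1.seq (r2.seq r3)).congr rfl ?_ ?_
  · rw [e, partsWord_append, List.append_nil]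
  · have : (i + 1) * (stepTime B + 3) + (ν - (i + 1)) * (stepTime B + 3) =
        ν * (stepTime B + 3) := by
      rw [← add_mul]
      congr 1
      omega
    have h1 : (ν - (i + 1)) * (stepTime B + 1) ≤ (ν - (i + 1)) * (stepTime B + 3) :=
      Nat.mul_le_mul_left _ (by omega)
    have h2 : ν * (stepTime B + 8) ≤ B * (stepTime B + 8) := Nat.mul_le_mul_right _ hν
    rw [rowTime, show top k ν cur old p q p' o 0 .vars = ν from rfl]
    have h3 : ν * (stepTime B + 8) = ν * (stepTime B + 3) + 5 * ν := by ring
    omega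

end Top

end Counters

/-! ### Writing the graph of a formula -/

namespace Counters

open StackProg Function GraphPart

section Top

variable {k ν cur old p q p' o rem B : ℕ} (I : List Bool)

theorem top_copy_p (h : cur ≤ B) : Runs (addTo .cur .p) I (top k ν cur old 0 q p' o rem) I
    (top k ν cur old cur q p' o rem) [] (5 * B + 4) := by
  have := (runs_addTo (x := .cur) (y := .p) (by decide) (by decide) (by decide) I
    (c := top k ν cur old 0 q p' o rem) rfl).mono (t' := 5 * B + 4) (by simp only [top]; omega)
  simpa only [update_top_p, top, zero_add] using this

theorem top_copy_q (h : cur ≤ B) : Runs (addTo .cur .q) I (top k ν cur old p 0 p' o rem) I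
    (top k ν cur old p cur p' o rem) [] (5 * B + 4) := by
  have := (runs_addTo (x := .cur) (y := .q) (by decide) (by decide) (by decide) I
    (c := top k ν cur old p 0 p' o rem) rfl).mono (t' := 5 * B + 4) (by simp only [top]; omega)
  simpa only [update_top_q, top, zero_add] using this

theorem top_copy_p' (h : cur ≤ B) : Runs (addTo .cur .p') I (top k ν cur old p q 0 o rem) I
    (top k ν cur old p q cur o rem) [] (5 * B + 4) := by
  have := (runs_addTo (x := .cur) (y := .p') (by decide) (by decide) (by decide) I
    (c := top k ν cur old p q 0 o rem) rfl).mono (t' := 5 * B + 4) (by simp only [top]; omega)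
  simpa only [update_top_p', top, zero_add] using this

theorem top_copy_o (h : cur ≤ B) : Runs (addTo .cur .o) I (top k ν cur old p q p' 0 rem) I
    (top k ν cur old p q p' cur rem) [] (5 * B + 4) := by
  have := (runs_addTo (x := .cur) (y := .o) (by decide) (by decide) (by decide) I
    (c := top k ν cur old p q p' 0 rem) rfl).mono (t' := 5 * B + 4) (by simp only [top]; omega)
  simpa only [update_top_o, top, zero_add] using this

theorem top_move_p (h : p ≤ B) (h' : p' ≤ B) : Runs (.seq (clear .p) (addTo .p' .p)) I
    (top k ν cur old p q p' o rem) I (top k ν cur old p' q p' o rem) [] (7 * B + 6) := by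
  have h1 := runs_clear .p I (top k ν cur old p q p' o rem)
  have h2 := runs_addTo (x := .p') (y := .p) (by decide) (by decide) (by decide) I
    (c := top k ν cur old 0 q p' o rem) rfl
  simp only [update_top_p, top, zero_add] at h1 h2
  exact (h1.seq h2).mono (by omega)

theorem top_move_q (h : q ≤ B) (h' : cur ≤ B) : Runs (.seq (clear .q) (addTo .cur .q)) I
    (top k ν cur old p q p' o rem) I (top k ν cur old p cur p' o rem) [] (7 * B + 6) := by
  have h1 := runs_clear .q I (top k ν cur old p q p' o rem)
  rw [update_top_q] at h1
  exact (h1.seq (top_copy_q I h')).mono (by simp only [top]; omega)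

theorem top_copy_rem (h : ν ≤ B) : Runs (addTo .vars .rem) I (top k ν cur old p q p' o 0) I
    (top k ν cur old p q p' o ν) [] (5 * B + 4) := by
  have := (runs_addTo (x := .vars) (y := .rem) (by decide) (by decide) (by decide) I
    (c := top k ν cur old p q p' o 0) rfl).mono (t' := 5 * B + 4) (by simp only [top]; omega)
  simpa only [update_top_rem, top, zero_add] using this

/-- Reset the counters for the terminals. -/
def clearTerminals : Prog :=
  .seq (clear .p) (.seq (clear .q) (.seq (clear .p') (clear .o)))

theorem top_clearTerminals (hp : p ≤ B) (hq : q ≤ B) (hp' : p' ≤ B) (ho : o ≤ B) :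
    Runs clearTerminals I (top k ν cur old p q p' o rem) I (top k ν cur old 0 0 0 0 rem) []
      (8 * B + 8) := by
  have h1 := runs_clear .p I (top k ν cur old p q p' o rem)
  have h2 := runs_clear .q I (top k ν cur old 0 q p' o rem)
  have h3 := runs_clear .p' I (top k ν cur old 0 0 p' o rem)
  have h4 := runs_clear .o I (top k ν cur old 0 0 0 o rem)
  simp only [update_top_p, update_top_q, update_top_p', update_top_o, top] at h1 h2 h3 h4
  exact (h1.seq (h2.seq (h3.seq h4))).mono (by omega)

/-- Write the terminals of the first literal of a clause. -/
def startProg : Prog :=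
  .seq (addTo .cur .p) (.seq (writeWire 3) (.seq (addTo .cur .q) (writeWire 2)))

theorem top_startProg (h : ∀ x ≤ cur + 2, x * (2 * k + 5) ≤ B) :
    Runs startProg I (top k ν cur old 0 0 p' o rem) I (top k ν (cur + 2) old cur (cur + 1) p' o rem)
      (partsWord k [wire cur 3, wire (cur + 1) 2]) (2 * wireTime B + 10 * B + 8) := by
  have hB : ∀ x ≤ cur + 2, x ≤ B := fun x hx =>
    (Nat.le_mul_of_pos_right x (by omega)).trans (h x hx)
  refine ((top_copy_p (B := B) I (hB _ (by omega))).seq ((top_wire (B := B) I le_rfl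
    (h _ (by omega))).seq ((top_copy_q (B := B) I (hB _ (by omega))).seq (top_wire (B := B) I
    (by decide) (h _ le_rfl))))).congr rfl
    (by simp only [List.append_nil, ← partsWord_append]; rfl) (by omega)

/-- Write the vertices that join the two literals of a clause. -/
def joinProg : Prog :=
  .seq (addTo .cur .p') (.seq (writeWire 1) (.seq (writeJump .p .cur) (.seq (writeJump .q .cur)
    (.seq (addTo .cur .o) (.seq (writeWire 2) (.seq (writeJump .p .cur) (.seq (writeJump .q .cur)
    (.seq (writeJump .p' .cur) (.seq (writeWire 1) (.seq (writeJump .o .cur)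
    (.seq (.seq (clear .p) (addTo .p' .p)) (.seq (.seq (clear .q) (addTo .cur .q))
    (writeWire 2)))))))))))))

theorem top_joinProg (h : ∀ x ≤ cur + 4, x * (2 * k + 5) ≤ B) (hp : p ≤ cur) (hq : q ≤ cur) :
    Runs joinProg I (top k ν cur old p q 0 0 rem) I
      (top k ν (cur + 4) old cur (cur + 3) cur (cur + 1) rem)
      (partsWord k [wire cur 1, jump p (cur + 1), jump q (cur + 1), wire (cur + 1) 2,
        jump p (cur + 2), jump q (cur + 2), jump cur (cur + 2), wire (cur + 2) 1,
        jump (cur + 1) (cur + 3), wire (cur + 3) 2])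
      (4 * wireTime B + 6 * jumpTime B + 24 * B + 20) := by
  have hB : ∀ x ≤ cur + 4, x ≤ B := fun x hx =>
    (Nat.le_mul_of_pos_right x (by omega)).trans (h x hx)
  have hL : 2 * k + 5 ≤ B := by simpa using h 1 (by omega)
  refine ((top_copy_p' (B := B) I (hB _ (by omega))).seq
    ((top_wire (B := B) I (by decide) (h _ (by omega))).seq
    ((top_jump (B := B) I .p .cur (by decide) (by decide) (h p (by omega)) (h (cur + 1) (by omega))
      hL).seq
    ((top_jump (B := B) I .q .cur (by decide) (by decide) (h q (by omega)) (h (cur + 1) (by omega))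
      hL).seq
    ((top_copy_o (B := B) I (hB _ (by omega))).seq
    ((top_wire (B := B) I (by decide) (h _ (by omega))).seq
    ((top_jump (B := B) I .p .cur (by decide) (by decide) (h p (by omega)) (h (cur + 2) (by omega))
      hL).seq
    ((top_jump (B := B) I .q .cur (by decide) (by decide) (h q (by omega)) (h (cur + 2) (by omega))
      hL).seq
    ((top_jump (B := B) I .p' .cur (by decide) (by decide) (h cur (by omega))
      (h (cur + 2) (by omega)) hL).seq
    ((top_wire (B := B) I (by decide) (h _ (by omega))).seq
    ((top_jump (B := B) I .o .cur (by decide) (by decide) (h (cur + 1) (by omega))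
      (h (cur + 3) (by omega)) hL).seq
    ((top_move_p (B := B) I (hB _ (by omega)) (hB _ (by omega))).seq
    ((top_move_q (B := B) I (hB _ (by omega)) (hB _ (by omega))).seq
    (top_wire (B := B) I (by decide) (h _ le_rfl))))))))))))))).congr rfl
    (by simp only [List.append_nil, ← partsWord_append]; rfl) (by omega)

/-- Write the parts for a clause. -/
def clauseProg : Prog :=
  .seq startProg (.seq rowProg (.seq (advance 2) (.seq joinProg (.seq rowProg (.seq (advance 4)
    clearTerminals)))))

/-- The time that it takes to write the parts for a clause. -/
def clauseTime {R : Type*} [CommSemiring R] (B : R) : R :=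
  2 * rowTime B + 6 * wireTime B + 6 * jumpTime B + 42 * B + 50

theorem top_clauseProg {s : ℕ} {c : ℕ × ℕ} (hc : c.1 < ν ∧ c.2 < ν) (hν : ν ≤ B)
    (h : ∀ x ≤ s + 6 * ν + 6, x * (2 * k + 5) ≤ B) :
    Runs clauseProg (encodeTally [c.1, c.2] ++ I) (top k ν (s + 2 * ν) (s + 1) 0 0 0 0 0) I
      (top k ν (s + 4 * ν + 6 + 2 * ν) (s + 4 * ν + 6 + 1) 0 0 0 0 0)
      (partsWord k (clauseParts ν c s)) (clauseTime B) := by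
  have hB : ∀ x ≤ s + 6 * ν + 6, x ≤ B := fun x hx =>
    (Nat.le_mul_of_pos_right x (by omega)).trans (h x hx)
  have hI : encodeTally [c.1, c.2] ++ I = encodeTally [c.1] ++ (encodeTally [c.2] ++ I) := by
    simp [encodeTally]
  have h1 := top_startProg (k := k) (ν := ν) (cur := s + 2 * ν) (old := s + 1) (p' := 0) (o := 0)
    (rem := 0) (B := B) (encodeTally [c.1, c.2] ++ I) fun x hx => h x (by omega)
  have h2 := top_rowProg (k := k) (ν := ν) (cur := s + 2 * ν + 2) (old := s + 1) (p := s + 2 * ν)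
    (q := s + 2 * ν + 1) (p' := 0) (o := 0) (B := B) (encodeTally [c.2] ++ I) hc.1 hν
    (by
      simp only [List.mem_cons, List.not_mem_nil, or_false, forall_eq_or_imp, forall_eq]
      refine ⟨h _ ?_, h _ ?_, h _ ?_, h _ ?_, h _ ?_⟩ <;> omega)
  -- The sources of the second row are the right vertices of the first, which begin at `s + 2 * ν +
  -- 3`; after the first row `old` is two short of this. After the second row, the sources for what
  -- follows are four ahead.
  have h3 := top_advance (k := k) (ν := ν) (cur := s + 2 * ν + 2 + 2 * ν) (old := s + 1 + 2 * ν)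
    (p := s + 2 * ν) (q := s + 2 * ν + 1) (p' := 0) (o := 0) (rem := 0) 2 (encodeTally [c.2] ++ I)
  rw [show s + 2 * ν + 2 + 2 * ν = s + 4 * ν + 2 by ring] at h2 h3
  rw [show s + 1 + 2 * ν + 2 = s + 2 * ν + 3 by ring] at h3
  have h4 := top_joinProg (k := k) (ν := ν) (cur := s + 4 * ν + 2) (old := s + 2 * ν + 3)
    (p := s + 2 * ν) (q := s + 2 * ν + 1) (rem := 0) (B := B) (encodeTally [c.2] ++ I)
    (fun x hx => h x (by omega)) (by omega) (by omega)
  have h5 := top_rowProg (k := k) (ν := ν) (cur := s + 4 * ν + 6) (old := s + 2 * ν + 3)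
    (p := s + 4 * ν + 2) (q := s + 4 * ν + 5) (p' := s + 4 * ν + 2) (o := s + 4 * ν + 3) (B := B)
    I hc.2 hν
    (by
      simp only [List.mem_cons, List.not_mem_nil, or_false, forall_eq_or_imp, forall_eq]
      refine ⟨h _ ?_, h _ ?_, h _ ?_, h _ ?_, h _ ?_⟩ <;> omega)
  have h6 := top_advance (k := k) (ν := ν) (cur := s + 4 * ν + 6 + 2 * ν)
    (old := s + 2 * ν + 3 + 2 * ν) (p := s + 4 * ν + 2) (q := s + 4 * ν + 5) (p' := s + 4 * ν + 2)
    (o := s + 4 * ν + 3) (rem := 0) 4 I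
  rw [show s + 2 * ν + 3 + 2 * ν + 4 = s + 4 * ν + 6 + 1 by ring] at h6
  have h7 := top_clearTerminals (k := k) (ν := ν) (cur := s + 4 * ν + 6 + 2 * ν)
    (old := s + 4 * ν + 6 + 1) (p := s + 4 * ν + 2) (q := s + 4 * ν + 5) (p' := s + 4 * ν + 2)
    (o := s + 4 * ν + 3) (rem := 0) (B := B) I (hB _ (by omega)) (hB _ (by omega))
    (hB _ (by omega)) (hB _ (by omega))
  rw [hI] at h1 ⊢
  refine (h1.seq (h2.seq (h3.seq (h4.seq (h5.seq (h6.seq h7)))))).congr rfl ?_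
    (by rw [clauseTime]; omega)
  simp only [List.append_nil, List.nil_append, ← partsWord_append]
  simp only [clauseParts, List.append_assoc]

/-- Write the last row of pairs. -/
def lastStep : Prog :=
  .seq (writeJump .old .cur) (.seq (writeWire 3) (.seq (writeJump .p .cur) (.seq (writeWire 2)
    (.seq (advance 2) (.seq (inc .p) (inc .p))))))

theorem top_lastStep (h : ∀ x ≤ cur + 2, x * (2 * k + 5) ≤ B) (hold : old ≤ cur) (hp : p ≤ cur) :
    Runs lastStep I (top k ν cur old p q p' o rem) I
      (top k ν (cur + 2) (old + 2) (p + 2) q p' o rem)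
      (partsWord k [jump old cur, wire cur 3, jump p (cur + 1), wire (cur + 1) 2])
      (2 * wireTime B + 2 * jumpTime B + 5) := by
  have hL : 2 * k + 5 ≤ B := by simpa using h 1 (by omega)
  have hi1 := runs_inc .p I (top k ν (cur + 2) (old + 2) p q p' o rem)
  have hi2 := runs_inc .p I (top k ν (cur + 2) (old + 2) (p + 1) q p' o rem)
  rw [update_top_p] at hi1 hi2
  refine ((top_jump (B := B) I .old .cur (by decide) (by decide) (h old (by omega))
      (h cur (by omega)) hL).seq
    ((top_wire (B := B) I (by decide) (h _ (by omega))).seq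
    ((top_jump (B := B) I .p .cur (by decide) (by decide) (h p (by omega))
      (h (cur + 1) (by omega)) hL).seq
    ((top_wire (B := B) I (by decide) (h _ (by omega))).seq
    ((top_advance 2 I).seq (hi1.seq hi2)))))).congr rfl
    (by simp only [List.nil_append, ← partsWord_append]; rfl) (by omega)

/-- Write the last row. -/
def lastProg : Prog :=
  .seq (writeWire 3) (.seq (writeWire 2) (.seq (addTo .vars .rem) (.seq (rep .rem lastStep)
    (.seq (writeWire 3) (.seq (clear .old) (clear .p))))))

/-- The time that it takes to write the last row. -/
def lastTime {R : Type*} [CommSemiring R] (B : R) : R :=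
  3 * wireTime B + B * (2 * wireTime B + 2 * jumpTime B + 6) + 9 * B + 10

theorem top_lastProg {s : ℕ} (hν : ν ≤ B) (h : ∀ x ≤ s + 4 * ν + 3, x * (2 * k + 5) ≤ B) :
    Runs lastProg I (top k ν (s + 2 * ν) (s + 1) 0 0 0 0 0) I (top k ν (s + 4 * ν + 3) 0 0 0 0 0 0)
      (partsWord k (finalParts ν s)) (lastTime B) := by
  have hB : ∀ x ≤ s + 4 * ν + 3, x ≤ B := fun x hx =>
    (Nat.le_mul_of_pos_right x (by omega)).trans (h x hx)
  have h4 := runs_rep (x := .rem) (p := lastStep) (I := I) (n := ν)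
    (t := 2 * wireTime B + 2 * jumpTime B + 5)
    (fun j => top k ν (s + 2 * ν + 2 + 2 * j) (s + 1 + 2 * j) (2 * j) 0 0 0 0)
    (fun j => partsWord k ((List.range j).flatMap fun v =>
      [jump (s + 1 + 2 * v) (s + 2 * ν + 2 + 2 * v), wire (s + 2 * ν + 2 + 2 * v) 3,
        jump (2 * v) (s + 2 * ν + 2 + 2 * v + 1), wire (s + 2 * ν + 2 + 2 * v + 1) 2])) rfl
    (fun j hj => ⟨_, partsWord_range_succ _ _ _, by
      simp only [update_top_rem]
      exact top_lastStep I (fun x hx => h x (by omega)) (by omega) (by omega)⟩)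
  simp only [update_top_rem, mul_zero, add_zero] at h4
  rw [show s + 2 * ν + 2 + 2 * ν = s + 4 * ν + 2 by ring] at h4
  have h6 := runs_clear .old I (top k ν (s + 4 * ν + 3) (s + 1 + 2 * ν) (2 * ν) 0 0 0 0)
  have h7 := runs_clear .p I (top k ν (s + 4 * ν + 3) 0 (2 * ν) 0 0 0 0)
  simp only [update_top_old, update_top_p, top] at h6 h7
  refine ((top_wire (B := B) I (by decide) (h _ (by omega))).seq
    ((top_wire (B := B) I (by decide) (h _ (by omega))).seq
    ((top_copy_rem (B := B) I hν).seq (h4.seq ((top_wire (B := B) I (by decide)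
    (h _ (by omega))).seq (h6.seq h7)))))).congr rfl ?_ ?_
  · simp only [List.append_nil, List.nil_append, ← partsWord_append]
    rfl
  · have h1 : ν * (2 * wireTime B + 2 * jumpTime B + 5 + 1) ≤
        B * (2 * wireTime B + 2 * jumpTime B + 6) := Nat.mul_le_mul_right _ hν
    have h2 := hB (s + 1 + 2 * ν) (by omega)
    have h3 := hB (2 * ν) (by omega)
    rw [lastTime]
    omega

/-- Write the parts for the clauses and the last row. -/
def tailProg : Prog :=
  .loop Reg.inp (fun
    | some b => .seq (.push Reg.inp b) clauseProg
    | none => lastProg) Option.isSome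

/-- Whether clauses remain can be seen only by popping a letter, which is then put back before the
clause is read. The word of a clause is nonempty, so the end of the input means the end of the
clauses. -/
theorem top_tailProg (hν : ν ≤ B) (cs : List (ℕ × ℕ)) (hcs : ∀ c ∈ cs, c.1 < ν ∧ c.2 < ν) (s : ℕ)
    (h : coreEnd ν cs s * (2 * k + 5) ≤ B) :
    Runs tailProg (encodeTally (cs.flatMap fun c => [c.1, c.2]))
      (top k ν (s + 2 * ν) (s + 1) 0 0 0 0 0) [] (top k ν (coreEnd ν cs s - 1) 0 0 0 0 0 0)
      (partsWord k (tailParts ν cs s)) (cs.length * (clauseTime B + 2) + lastTime B + 1) := by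
  intro O
  induction cs generalizing s O with
  | nil =>
    have hs : coreEnd ν [] s = s + 4 * ν + 4 := by simp [coreEnd]
    rw [hs] at h ⊢
    refine (Run.loop_exit (t := lastTime B) rfl ?_).mono (by simp)
    rw [show (st (encodeTally (([] : List (ℕ × ℕ)).flatMap fun c => [c.1, c.2])) O
      (top k ν (s + 2 * ν) (s + 1) 0 0 0 0 0) Reg.inp).tail = [] from rfl, update_inp]
    exact top_lastProg [] hν (fun x hx => (Nat.mul_le_mul_right _ (by omega)).trans h) O
  | cons c cs ih =>
    rw [coreEnd_cons] at h ⊢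
    have h1 := top_clauseProg (k := k) (encodeTally (cs.flatMap fun c => [c.1, c.2]))
      (hcs c (by simp)) hν (s := s) (fun x hx => (Nat.mul_le_mul_right _ (by
        simp only [coreEnd]; omega)).trans h)
    have h2 := ih (fun c hc => hcs c (by simp [hc])) (s + 4 * ν + 6) h
      (partsWord k (clauseParts ν c s) ++ O)
    rw [tailParts, partsWord_append, List.append_assoc]
    have e : encodeTally ((c :: cs).flatMap fun c => [c.1, c.2]) =
        encodeTally [c.1, c.2] ++ encodeTally (cs.flatMap fun c => [c.1, c.2]) := by
      simp [encodeTally]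
    rw [e]
    obtain ⟨b, l, hbl⟩ : ∃ b l, encodeTally [c.1, c.2] ++
        encodeTally (cs.flatMap fun c => [c.1, c.2]) = b :: l := by
      rw [← List.ne_nil_iff_exists_cons]
      simp [encodeTally]
    rw [hbl] at h1 ⊢
    refine (Run.loop_again (t := 1 + clauseTime B) rfl ?_ h2).mono (le_of_eq (by
      rw [List.length_cons]; ring))
    rw [show (st (b :: l) O (top k ν (s + 2 * ν) (s + 1) 0 0 0 0 0) Reg.inp).tail = l from rfl,
      update_inp]
    have := ((runs_unread b l (top k ν (s + 2 * ν) (s + 1) 0 0 0 0 0)).seq h1) O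
    rwa [List.append_nil] at this

end Top

end Counters

/-! ### The reduction is computable in polynomial time -/

namespace Counters

open StackProg Function GraphPart

/-- Move the input to the output in reverse order, and increase the counter `rungs` by twice its
length. -/
def measureProg : Prog :=
  .loop Reg.inp (fun
    | some b => .seq (.push Reg.out b) (.seq (inc .rungs) (inc .rungs))
    | none => .skip) Option.isSome

/-- The height of the ladders depends on the length of the input and is needed before the first
ladder, so the input is passed over once; afterwards `restoreProg` brings it back in the right
order. -/
theorem run_measureProg (w O : List Bool) (c : Counter → ℕ) :
    Run measureProg (st w O c) (st [] (w.reverse ++ O) (update c .rungs (c .rungs + 2 * w.length)))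
      (4 * w.length + 2) := by
  induction w generalizing O c with
  | nil =>
    refine (Run.loop_exit (t := 1) rfl ?_).mono (by simp)
    rw [show (st [] O c Reg.inp).tail = [] from rfl, update_inp, List.length_nil, mul_zero,
      add_zero, update_eq_self]
    exact Run.skip _
  | cons b w ih =>
    have h1 := ((runs_write b w c).seq ((runs_inc .rungs w c).seq (runs_inc .rungs w _))) O
    simp only [update_self, update_idem] at h1
    have h2 := ih (b :: O) (update c .rungs (c .rungs + 1 + 1))
    simp only [update_self, update_idem] at h2
    rw [show c .rungs + 1 + 1 + 2 * w.length = c .rungs + 2 * (b :: w).length by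
      rw [List.length_cons]; ring] at h2
    rw [List.reverse_cons, List.append_assoc]
    refine (Run.loop_again (t := 1 + (1 + 1)) rfl ?_ h2).mono (le_of_eq (by
      rw [List.length_cons]; ring))
    rw [show (st (b :: w) O c Reg.inp).tail = w from rfl, update_inp]
    exact h1

/-- Move the output to the input in reverse order. -/
def restoreProg : Prog :=
  .loop Reg.out (fun
    | some b => .push Reg.inp b
    | none => .skip) Option.isSome

theorem run_restoreProg (w I : List Bool) (c : Counter → ℕ) :
    Run restoreProg (st I w c) (st (w.reverse ++ I) [] c) (2 * w.length + 2) := by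
  induction w generalizing I with
  | nil =>
    refine (Run.loop_exit (t := 1) rfl ?_).mono (by simp)
    rw [show (st I [] c Reg.out).tail = [] from rfl, update_out]
    exact Run.skip _
  | cons b w ih =>
    rw [List.reverse_cons, List.append_assoc]
    refine (Run.loop_again (t := 1) rfl ?_ (ih (b :: I))).mono (le_of_eq (by
      rw [List.length_cons]; ring))
    rw [show (st I (b :: w) c Reg.out).tail = w from rfl, update_out]
    exact runs_unread b I c w

/-- Set the counter `len`. -/
def lenProg : Prog :=
  .seq (addTo .rungs .len) (.seq (addTo .rungs .len) (.seq (inc .len) (.seq (inc .len)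
    (.seq (inc .len) (.seq (inc .len) (inc .len))))))

theorem runs_lenProg (k : ℕ) (I : List Bool) :
    Runs lenProg I (update (fun _ => 0) .rungs k) I (top k 0 0 0 0 0 0 0 0) [] (10 * k + 13) := by
  have h1 := runs_addTo (x := .rungs) (y := .len) (by decide) (by decide) (by decide) I
    (c := update (fun _ => 0) .rungs k) rfl
  have h2 := runs_addTo (x := .rungs) (y := .len) (by decide) (by decide) (by decide) I
    (c := update (update (fun _ => 0) .rungs k) .len k) rfl
  have h3 : ∀ n, Runs (inc .len) I (update (update (fun _ => 0) .rungs k) .len n) I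
      (update (update (fun _ => 0) .rungs k) .len (n + 1)) [] 1 := fun n => by
    have := runs_inc .len I (update (update (fun _ => 0) .rungs k) .len n)
    rwa [update_idem, update_self] at this
  simp only [update_idem, update_self, ne_eq, reduceCtorEq, not_false_eq_true, update_of_ne,
    zero_add] at h1 h2
  refine (h1.seq (h2.seq ((h3 _).seq ((h3 _).seq ((h3 _).seq ((h3 _).seq (h3 _))))))).congr ?_ rfl
    (by omega)
  rw [← two_mul]
  funext x
  cases x <;> rfl

/-- Read the number of variables. -/
def varsProg : Prog :=
  .loop Reg.inp (fun o => if o = some true then inc .vars else .skip) fun o => o == some true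

theorem runs_varsProg (n : ℕ) (I : List Bool) (c : Counter → ℕ) :
    Runs varsProg (encodeTally [n] ++ I) c I (update c .vars (c .vars + n)) [] (2 * n + 2) := by
  intro O
  rw [show encodeTally [n] ++ I = List.replicate n true ++ false :: I by simp [encodeTally]]
  induction n generalizing c with
  | zero =>
    refine (Run.loop_exit (t := 1) rfl ?_).mono (by simp)
    rw [show (st (List.replicate 0 true ++ false :: I) O c Reg.inp).tail = I from rfl, update_inp,
      add_zero, update_eq_self]
    exact Run.skip _
  | succ n ih =>
    have h := ih (update c .vars (c .vars + 1))
    rw [update_self, update_idem, add_assoc, add_comm 1 n] at h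
    refine (Run.loop_again (t := 1) rfl ?_ h).mono (le_of_eq (by ring))
    rw [show (st (List.replicate (n + 1) true ++ false :: I) O c Reg.inp).tail =
      List.replicate n true ++ false :: I from rfl, update_inp]
    exact runs_inc .vars _ c O

/-- Write the first row of pairs. -/
def firstProg : Prog :=
  .seq (addTo .vars .rem) (.seq (rep .rem (.seq (writeWire 3) (writeWire 2))) (advance 1))

/-- The time that it takes to write the first row. -/
def firstTime {R : Type*} [CommSemiring R] (B : R) : R := B * (2 * wireTime B + 1) + 5 * B + 8

theorem top_firstProg {k ν B : ℕ} (I : List Bool) (hν : ν ≤ B)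
    (h : 2 * ν * (2 * k + 5) ≤ B) :
    Runs firstProg I (top k ν 0 0 0 0 0 0 0) I (top k ν (2 * ν) 1 0 0 0 0 0)
      (partsWord k ((List.range ν).flatMap fun v => [wire (2 * v) 3, wire (2 * v + 1) 2]))
      (firstTime B) := by
  have h2 := runs_rep (x := .rem) (p := .seq (writeWire 3) (writeWire 2)) (I := I) (n := ν)
    (t := wireTime B + wireTime B)
    (fun j => top k ν (2 * j) 0 0 0 0 0 0)
    (fun j => partsWord k ((List.range j).flatMap fun v => [wire (2 * v) 3, wire (2 * v + 1) 2]))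
    rfl (fun j hj => ⟨_, partsWord_range_succ _ _ _, by
      simp only [update_top_rem]
      refine ((top_wire (B := B) I (by decide) ?_).seq (top_wire (B := B) I
        (by decide) ?_)).congr rfl (by simp only [← partsWord_append]; rfl) le_rfl <;>
      exact (Nat.mul_le_mul_right _ (by omega)).trans h⟩)
  simp only [update_top_rem, mul_zero] at h2
  refine ((top_copy_rem (B := B) I hν).seq (h2.seq (top_advance 1 I))).congr rfl ?_ ?_
  · rw [List.nil_append, List.append_nil]
  · have h1 : ν * (wireTime B + wireTime B + 1) ≤ B * (2 * wireTime B + 1) :=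
      Nat.mul_le_mul hν (by omega)
    rw [firstTime]
    omega

/-- Write the number of vertices, and reset the counters. -/
def endProg : Prog :=
  .seq (mulTo .cur .lo) (.seq (inc .lo) (.seq (writeNum .lo) (.seq (clear .lo) (.seq (clear .cur)
    (.seq (clear .vars) (.seq (clear .rungs) (clear .len)))))))

/-- The number of vertices heads the encoding and is hence written last. The counters are emptied
because a final configuration has an empty stack everywhere except at the output. -/
theorem top_endProg {k ν m B : ℕ} (I : List Bool) (hν : ν ≤ B) (h : (m + 1) * (2 * k + 5) ≤ B) :
    Runs endProg I (top k ν m 0 0 0 0 0 0) I (fun _ => 0) (encodeTally [m * (2 * k + 5) + 1])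
      (40 * B + 40) := by
  have hm : m * (2 * k + 5) + (2 * k + 5) ≤ B := by linarith
  have hmB : m ≤ B := by nlinarith
  have e : m * (5 * (2 * k + 5) + 5) = 5 * (m * (2 * k + 5)) + 5 * m := by ring
  set N := m * (2 * k + 5)
  have h1 := runs_mulTo (x := .cur) (y := .lo) (by decide) (by decide) (by decide) (by decide)
    (by decide) I (c := top k ν m 0 0 0 0 0 0) rfl rfl
  have h2 := runs_inc .lo I (update (top k ν m 0 0 0 0 0 0) .lo N)
  have h3 := runs_writeNum (x := .lo) (by decide) I
    (c := update (top k ν m 0 0 0 0 0 0) .lo (N + 1)) rfl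
  have h4 := runs_clear .lo I (update (top k ν m 0 0 0 0 0 0) .lo (N + 1))
  rw [update_idem, show update (top k ν m 0 0 0 0 0 0) .lo 0 = top k ν m 0 0 0 0 0 0 from
    update_eq_self (f := top k ν m 0 0 0 0 0 0) .lo] at h4
  have h5 := runs_clear .cur I (top k ν m 0 0 0 0 0 0)
  rw [update_top_cur] at h5
  have h6 := runs_clear .vars I (top k ν 0 0 0 0 0 0 0)
  rw [show update (top k ν 0 0 0 0 0 0 0) .vars 0 = top k 0 0 0 0 0 0 0 0 by
    funext x; cases x <;> rfl] at h6
  have h7 := runs_clear .rungs I (top k 0 0 0 0 0 0 0 0)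
  have h8 := runs_clear .len I (update (top k 0 0 0 0 0 0 0 0) .rungs 0)
  rw [show update (update (top k 0 0 0 0 0 0 0 0) .rungs 0) .len 0 = fun _ => 0 by
    funext x; cases x <;> rfl] at h8
  simp only [update_idem, update_self, ne_eq, reduceCtorEq, not_false_eq_true, update_of_ne,
    top, zero_add] at h1 h2 h3 h4 h5 h6 h7 h8
  exact (h1.seq (h2.seq (h3.seq (h4.seq (h5.seq (h6.seq (h7.seq h8))))))).congr rfl (by simp)
    (by omega)

/-- Write the graph of the formula that is given as input. -/
def graphProg : Prog :=
  .seq (.seq measureProg restoreProg) (.seq lenProg (.seq varsProg (.seq firstProg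
    (.seq tailProg endProg))))

/-- A bound for the counters, in terms of the length of the input. -/
def graphBound {R : Type*} [CommSemiring R] (n : R) : R :=
  (n * (4 * n + 6) + 4 * n + 4) * (4 * n + 5)

/-- The time that it takes to write the graph of a formula, in terms of the length of the input. -/
def graphTime {R : Type*} [CommSemiring R] (n : R) : R :=
  28 * n + 100 + firstTime (graphBound n) + n * (clauseTime (graphBound n) + 2) +
    lastTime (graphBound n) + 40 * graphBound n

theorem run_graphProg (φ : MonotoneTwoSat) :
    Run graphProg (st φ.encode [] fun _ => 0) (st [] φ.toGraph.encode fun _ => 0)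
      (graphTime φ.encode.length) := by
  have hle := φ.le_length_encode
  have hk : φ.rungs = 2 * φ.encode.length := rfl
  set n := φ.encode.length
  have hcs := φ.clausePairs_lt
  have hlen : φ.clausePairs.length ≤ n := by rw [φ.clauses_length_eq]; omega
  -- The number of main vertices is quadratic and the length of a ladder linear in the length of the
  -- input, so `B` is a cubic bound for the products computed by the machine.
  have hend : coreEnd φ.numVars φ.clausePairs 0 ≤ n * (4 * n + 6) + 4 * n + 4 := by
    have := Nat.mul_le_mul hlen (show 4 * φ.numVars + 6 ≤ 4 * n + 6 by omega)
    rw [coreEnd]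
    omega
  set B := graphBound n with hB'
  have hB : coreEnd φ.numVars φ.clausePairs 0 * (2 * φ.rungs + 5) ≤ B := by
    rw [hB', graphBound, hk]
    exact Nat.mul_le_mul hend (by omega)
  have hν : φ.numVars ≤ B := by
    have h1 : φ.numVars ≤ coreEnd φ.numVars φ.clausePairs 0 := by rw [coreEnd]; omega
    exact (h1.trans (Nat.le_mul_of_pos_right _ (by omega))).trans hB
  have h1 := run_measureProg φ.encode [] fun _ => 0
  have h2 := run_restoreProg φ.encode.reverse [] (update (fun _ => 0) .rungs φ.rungs)
  rw [List.append_nil, zero_add, ← hk] at h1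
  rw [List.reverse_reverse, List.append_nil, List.length_reverse] at h2
  have h3 := runs_lenProg φ.rungs φ.encode
  have h4 := runs_varsProg φ.numVars (encodeTally (φ.clausePairs.flatMap fun c => [c.1, c.2]))
    (top φ.rungs 0 0 0 0 0 0 0 0)
  rw [show update (top φ.rungs 0 0 0 0 0 0 0 0) .vars
      (top φ.rungs 0 0 0 0 0 0 0 0 .vars + φ.numVars) = top φ.rungs φ.numVars 0 0 0 0 0 0 0 by
      funext x; cases x <;> simp [top],
    show encodeTally [φ.numVars] ++ encodeTally (φ.clausePairs.flatMap fun c => [c.1, c.2]) =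
      φ.encode by rw [φ.encode_eq]; simp [encodeTally]] at h4
  have h5 := top_firstProg (k := φ.rungs) (B := B)
    (encodeTally (φ.clausePairs.flatMap fun c => [c.1, c.2])) hν
    ((Nat.mul_le_mul_right _ (by rw [coreEnd]; omega)).trans hB)
  have h6 := top_tailProg (k := φ.rungs) hν φ.clausePairs hcs 0 hB
  rw [zero_add, zero_add] at h6
  have h7 := top_endProg (k := φ.rungs) (m := coreEnd φ.numVars φ.clausePairs 0 - 1) (B := B) [] hν
    (by rwa [Nat.sub_add_cancel (by simp [coreEnd])])
  have h := (h1.seq h2).seq ((h3.seq (h4.seq (h5.seq (h6.seq h7)))) [])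
  have hw : φ.toGraph.encode = encodeTally [φ.order] ++
      partsWord φ.rungs (formulaParts φ.numVars φ.clausePairs) := by
    rw [MonotoneTwoSat.toGraph, WeightedGraph.ofList_encode, partsWord, ← MonotoneTwoSat.edgeList,
      edgesWord]
    simp [encodeTally]
  simp only [List.append_nil, List.append_assoc, ← partsWord_append] at h
  rw [hw]
  refine h.mono ?_
  have h8 : φ.clausePairs.length * (clauseTime B + 2) ≤ n * (clauseTime B + 2) :=
    Nat.mul_le_mul_right _ hlen
  rw [graphTime, ← hB']
  omega

theorem polyTimeComputable_toGraph :
    PolyTimeComputable MonotoneTwoSat.encode WeightedGraph.encode MonotoneTwoSat.toGraph := by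
  refine graphProg.polyTimeComputable Reg.inp Reg.out (Equiv.refl _) (Equiv.refl _)
    (graphTime Polynomial.X) fun φ => ?_
  have e1 : ∀ w, update (fun _ => []) Reg.inp w = st w [] fun _ => 0 := fun w => by
    funext r; cases r <;> rfl
  have e2 : ∀ w, update (fun _ => []) Reg.out w = st [] w fun _ => 0 := fun w => by
    funext r; cases r <;> rfl
  -- The time bounds are defined over any commutative semiring, so the same expression is a number
  -- and a polynomial, and evaluation turns one into the other.
  have e3 : (graphTime Polynomial.X : Polynomial ℕ).eval φ.encode.length =
      graphTime φ.encode.length := by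
    simp [graphTime, graphBound, firstTime, clauseTime, lastTime, rowTime, stepTime, wireTime,
      jumpTime]
  have := run_graphProg φ
  rw [← e1, ← e2, ← e3] at this
  simpa using this

end Counters

/-! ### Numbers as lists of bits -/

/-- The number with the given bits, the lowest bit first. -/
def bitsVal : List Bool → ℕ
  | [] => 0
  | b :: l => b.toNat + 2 * bitsVal l

/-- Zero is excluded because its code is the empty list and not a single digit 0. -/
theorem encodeNat_bit {n : ℕ} (b : Bool) (h : 0 < b.toNat + 2 * n) :
    encodeNat (b.toNat + 2 * n) = b :: encodeNat n := by
  rw [encodeNat, encodeNat]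
  cases b with
  | false =>
    have hn : 0 < n := by simpa using h
    have e : (((false.toNat + 2 * n : ℕ)) : Num) = (n : Num).bit0 := by
      apply Num.to_nat_inj.1
      simp [two_mul]
    rw [e]
    cases hN : (n : Num) with
    | zero =>
      have := congrArg (fun x : Num => (x : ℕ)) hN
      simp at this
      omega
    | pos p => rfl
  | true =>
    have e : (((true.toNat + 2 * n : ℕ)) : Num) = (n : Num).bit1 := by
      apply Num.to_nat_inj.1
      simp [two_mul]
      omega
    rw [e]
    cases (n : Num) <;> rfl

theorem bitsVal_encodeNat (n : ℕ) : bitsVal (encodeNat n) = n := by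
  induction n using Nat.strong_induction_on with
  | _ n ih =>
    rcases Nat.eq_zero_or_pos n with rfl | hn
    · rfl
    · have h : n = (n.testBit 0).toNat + 2 * (n / 2) := by
        rw [Nat.toNat_testBit]
        omega
      rw [h, encodeNat_bit _ (h ▸ hn), bitsVal, ih _ (by omega)]

theorem bitsVal_append (l l' : List Bool) :
    bitsVal (l ++ l') = bitsVal l + 2 ^ l.length * bitsVal l' := by
  induction l with
  | nil => simp [bitsVal]
  | cons b l ih =>
    rw [List.cons_append, bitsVal, bitsVal, ih, List.length_cons, pow_succ]
    ring

/-- A list of bits is the canonical code of its value as soon as the highest bit is 1. -/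
theorem encodeNat_bitsVal (l : List Bool) : encodeNat (bitsVal (l ++ [true])) = l ++ [true] := by
  induction l with
  | nil => exact encodeNat_bit (n := 0) true one_pos
  | cons b l ih =>
    have : 0 < bitsVal (l ++ [true]) := by rw [bitsVal_append]; simp [bitsVal]
    rw [List.cons_append, bitsVal, encodeNat_bit _ (by omega), ih]

theorem bitsVal_drop (l : List Bool) (a : ℕ) : bitsVal (l.drop a) = bitsVal l / 2 ^ a := by
  induction a generalizing l with
  | zero => simp
  | succ a ih =>
    cases l with
    | nil => simp [bitsVal]
    | cons b l =>
      rw [List.drop_succ_cons, ih, bitsVal, pow_succ', ← Nat.div_div_eq_div_mul]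
      congr 1
      have := b.toNat_lt
      omega

theorem bitsVal_take (l : List Bool) (a : ℕ) : bitsVal (l.take a) = bitsVal l % 2 ^ a := by
  induction a generalizing l with
  | zero => simp [bitsVal, Nat.mod_one]
  | succ a ih =>
    cases l with
    | nil => simp [bitsVal]
    | cons b l =>
      have h : (b.toNat + 2 * bitsVal l) / 2 = bitsVal l := by
        have := b.toNat_lt
        omega
      have h' : (b.toNat + 2 * bitsVal l) % 2 = b.toNat := by
        have := b.toNat_lt
        omega
      rw [List.take_succ_cons, bitsVal, ih, bitsVal, pow_succ', Nat.mod_mul, h, h']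

/-! ### Extracting bits in polynomial time -/

/-- The stacks of bits of the machine that extracts bits. -/
inductive BitStack
  | tmp | word | skipped | kept | result | out
  deriving DecidableEq

instance : Fintype BitStack where
  elems := {.tmp, .word, .skipped, .kept, .result, .out}
  complete x := by cases x <;> decide

/-- The stacks of the machine that extracts bits. -/
inductive BitReg
  | inp | bin (x : BitStack)
  deriving DecidableEq, Fintype

namespace BitReg

open StackProg Function

/-- The letters on the stacks. -/
def Letter : BitReg → Type
  | inp => Option Bool
  | bin _ => Bool

instance : ∀ k, Fintype (Letter k)
  | inp => inferInstanceAs (Fintype (Option Bool))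
  | bin _ => inferInstanceAs (Fintype Bool)

/-- The stacks with their contents. -/
def bst (I : List (Option Bool)) (c : BitStack → List Bool) : ∀ k, List (Letter k)
  | inp => I
  | bin x => c x

theorem update_bst_inp (I I' : List (Option Bool)) (c : BitStack → List Bool) :
    update (bst I c) inp I' = bst I' c := by
  funext k
  cases k with
  | inp => exact update_self ..
  | bin x => exact update_of_ne (by simp) ..

theorem update_bst_bin (I : List (Option Bool)) (c : BitStack → List Bool) (x : BitStack)
    (l : List Bool) : update (bst I c) (bin x) l = bst I (update c x l) := by
  funext k
  cases k with
  | inp => exact update_of_ne (by simp) ..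
  | bin y =>
    by_cases h : y = x
    · subst h
      exact (update_self (bin y) _ _).trans (update_self (β := fun _ => List Bool) y l c).symm
    · refine (update_of_ne (by simpa using h) _ _).trans ?_
      exact (update_of_ne (β := fun _ => List Bool) h l c).symm

theorem run_push (I : List (Option Bool)) (c : BitStack → List Bool) (x : BitStack) (b : Bool) :
    Run (.push (bin x) b) (bst I c) (bst I (update c x (b :: c x))) 1 := by
  rw [← update_bst_bin]
  exact Run.push (Γ := Letter) (bin x) b (bst I c)

/-- Pop the stack `x`, and start again as long as `again` says so. -/
def popLoop (x : BitStack) (body : Option Bool → StackProg Letter) (again : Option Bool → Bool) :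
    StackProg Letter := .loop (bin x) body again

theorem run_popLoop_exit {I : List (Option Bool)} {c : BitStack → List Bool} {x : BitStack}
    {body : Option Bool → StackProg Letter} {again : Option Bool → Bool} {S : ∀ k, List (Letter k)}
    {t : ℕ} (h : again (c x).head? = false)
    (hr : Run (body (c x).head?) (bst I (update c x (c x).tail)) S t) :
    Run (popLoop x body again) (bst I c) S (t + 1) := by
  rw [← update_bst_bin] at hr
  exact Run.loop_exit (Γ := Letter) (k := bin x) h hr

theorem run_popLoop_again {I : List (Option Bool)} {c : BitStack → List Bool} {x : BitStack}
    {body : Option Bool → StackProg Letter} {again : Option Bool → Bool}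
    {S S' : ∀ k, List (Letter k)} {t t' : ℕ} (h : again (c x).head? = true)
    (hr : Run (body (c x).head?) (bst I (update c x (c x).tail)) S t)
    (hr' : Run (popLoop x body again) S S' t') :
    Run (popLoop x body again) (bst I c) S' (t + 1 + t') := by
  rw [← update_bst_bin] at hr
  exact Run.loop_again (Γ := Letter) (k := bin x) h hr hr'

/-- Move the stack `x` onto the stack `y`, in reverse order. -/
def move (x y : BitStack) : StackProg Letter :=
  popLoop x (fun
    | some b => .push (bin y) b
    | none => .skip) Option.isSome

theorem run_move {x y : BitStack} (hxy : x ≠ y) (I : List (Option Bool))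
    (c : BitStack → List Bool) :
    Run (move x y) (bst I c) (bst I (update (update c x []) y ((c x).reverse ++ c y)))
      (2 * (c x).length + 2) := by
  generalize hl : c x = l
  induction l generalizing c with
  | nil =>
    refine (run_popLoop_exit (t := 1) (by rw [hl]; rfl) ?_).mono (by simp)
    have e : update (update c x []) y ([].reverse ++ c y) = update c x [] := by
      rw [update_eq_iff]
      simp [hxy.symm]
    rw [hl, e]
    exact Run.skip _
  | cons b l ih =>
    have h := ih (update (update c x l) y (b :: c y)) (by simp [hxy])
    refine (run_popLoop_again (t := 1) (S := bst I (update (update c x l) y (b :: c y)))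
      (by rw [hl]; rfl) ?_ ?_).mono (t := 1 + 1 + (2 * l.length + 2))
      (le_of_eq (by rw [List.length_cons]; ring))
    · rw [hl]
      have := run_push I (update c x l) y b
      rwa [update_of_ne hxy.symm] at this
    · have e : update (update (update (update c x l) y (b :: c y)) x []) y
          (l.reverse ++ update (update c x l) y (b :: c y) y) =
          update (update c x []) y ((b :: l).reverse ++ c y) := by
        rw [update_comm hxy.symm, update_idem, update_idem, update_self]
        simp
      rwa [e] at h

/-- Empty the stack `x`. -/
def empty (x : BitStack) : StackProg Letter := popLoop x (fun _ => .skip) Option.isSome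

theorem run_empty (x : BitStack) (I : List (Option Bool)) (c : BitStack → List Bool) :
    Run (empty x) (bst I c) (bst I (update c x [])) (2 * (c x).length + 2) := by
  generalize hl : c x = l
  induction l generalizing c with
  | nil =>
    refine (run_popLoop_exit (t := 1) (by rw [hl]; rfl) ?_).mono (by simp)
    rw [hl]
    exact Run.skip _
  | cons b l ih =>
    have h := ih (update c x l) (by simp)
    rw [update_idem] at h
    refine (run_popLoop_again (t := 1) (S := bst I (update c x l)) (by rw [hl]; rfl) ?_ h).mono
      (le_of_eq (by rw [List.length_cons]; ring))
    rw [hl]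
    exact Run.skip _

/-- Decrease the number on the stack `y` and continue with `s`, or if it is `0`, continue with `f`.
-/
def decElse (y : BitStack) (s f : StackProg Letter) : StackProg Letter :=
  popLoop y (fun
    | some false => .push (bin .tmp) true
    | some true => .seq (.push (bin y) false) (.seq (move .tmp y) s)
    | none => .seq (empty .tmp) f) fun o => o == some false

/-- All digits are 0, so the search for a digit to borrow from reaches the bottom. The ones put
aside on `tmp` are discarded; `y` is left empty, which still represents 0. -/
theorem run_decElse_zero {y : BitStack} (hy : y ≠ .tmp) {s f : StackProg Letter}
    {I : List (Option Bool)} {c : BitStack → List Bool} (hc : bitsVal (c y) = 0)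
    {S : ∀ k, List (Letter k)} {t : ℕ}
    (h : Run f (bst I (update (update c .tmp []) y [])) S t) :
    Run (decElse y s f) (bst I c) S
      (t + 4 * (c y).length + 2 * (c .tmp).length + 3) := by
  generalize hl : c y = l at hc
  induction l generalizing c with
  | nil =>
    refine (run_popLoop_exit (t := 2 * (c .tmp).length + 2 + t) (by rw [hl]; rfl) ?_).mono
      (by simp; omega)
    rw [hl]
    refine Run.seq (S' := bst I (update (update c y []) .tmp [])) ?_ ?_
    · have := run_empty .tmp I (update c y [])
      rwa [update_of_ne hy.symm] at this
    · rwa [update_comm hy]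
  | cons b l ih =>
    simp only [bitsVal] at hc
    obtain rfl : b = false := by cases b <;> simp at hc ⊢
    have h' := ih (c := update (update c y l) .tmp (true :: c .tmp)) (by
      convert h using 2
      funext z
      by_cases hzy : z = y
      · subst hzy
        simp
      · by_cases hz : z = .tmp
        · subst hz
          simp [hzy]
        · simp [hz, hzy]) (by simp [hy]) (by simpa using hc)
    refine (run_popLoop_again (t := 1) (by rw [hl]; rfl) ?_ h').mono (by simp; omega)
    rw [hl]
    have := run_push I (update c y l) .tmp true
    rwa [update_of_ne hy.symm] at this

/-- Decrement with borrow: the low digits 0 become ones, kept on `tmp`, the first digit 1 becomes 0,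
and the ones are put back. For the induction `j` ones are already on `tmp`. Leading zeros are kept,
so the length does not change. -/
theorem run_decElse_succ {y : BitStack} (hy : y ≠ .tmp) {s f : StackProg Letter}
    {I : List (Option Bool)} {c : BitStack → List Bool} {v j : ℕ} (hc : bitsVal (c y) = v + 1)
    (hj : c .tmp = List.replicate j true) :
    ∃ l, bitsVal l = v ∧ l.length = (c y).length ∧ ∀ (S : ∀ k, List (Letter k)) (t : ℕ),
      Run s (bst I (update (update c .tmp []) y (List.replicate j true ++ l))) S t →
      Run (decElse y s f) (bst I c) S (t + 4 * (c y).length + 2 * j + 4) := by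
  generalize hl : c y = l at hc
  induction l generalizing c v j with
  | nil => simp [bitsVal] at hc
  | cons b l ih =>
    cases b with
    | true =>
      refine ⟨false :: l, by simp [bitsVal] at hc ⊢; omega, rfl, fun S t h => ?_⟩
      refine (run_popLoop_exit (t := 1 + (2 * j + 2 + t)) (by rw [hl]; rfl) ?_).mono
        (by simp; omega)
      rw [hl]
      refine Run.seq (S' := bst I (update c y (false :: l))) ?_ (Run.seq (S' := _) ?_ h)
      · have := run_push I (update c y l) y false
        rwa [update_self, update_idem] at this
      · have := run_move hy.symm I (update c y (false :: l))
        rw [update_of_ne hy.symm, update_self, hj, List.length_replicate, List.reverse_replicate]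
          at this
        convert this using 2
        funext z
        by_cases hzy : z = y
        · subst hzy
          simp
        · simp [update_apply, hzy]
    | false =>
      -- With lowest digit 0 the number `v + 1` is even, so the lowest digit of `v` is 1 and the
      -- rest is the decremented rest.
      obtain ⟨v', rfl⟩ : ∃ v', v = 2 * v' + 1 := by
        simp [bitsVal] at hc
        exact ⟨v / 2, by omega⟩
      obtain ⟨l', h1, h2, h3⟩ := ih (c := update (update c y l) .tmp (true :: c .tmp)) (v := v')
        (j := j + 1) (by simp [hj, List.replicate_succ]) (by simp [hy])
        (by simp [bitsVal] at hc; omega)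
      refine ⟨true :: l', by simp [bitsVal, h1]; omega, by simp [h2], fun S t h => ?_⟩
      refine (run_popLoop_again (t := 1) (by rw [hl]; rfl) ?_ (h3 S t ?_)).mono
        (by simp; omega)
      · rw [hl]
        have := run_push I (update c y l) .tmp true
        rwa [update_of_ne hy.symm] at this
      · convert h using 2
        rw [show List.replicate (j + 1) true ++ l' = List.replicate j true ++ true :: l' by
          rw [List.replicate_succ', List.append_assoc]; rfl]
        funext z
        by_cases hzy : z = y
        · subst hzy
          simp
        · by_cases hz : z = .tmp
          · subst hz
            simp [hzy]
          · simp [hz, hzy]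

end BitReg

/-! ### Selecting a window of bits. -/

namespace BitReg

open StackProg Function

/-- The stacks of bits between the steps. -/
def bits (w a b r o : List Bool) : BitStack → List Bool
  | .tmp => []
  | .word => w
  | .skipped => a
  | .kept => b
  | .result => r
  | .out => o

section Bits

variable {w a b r o : List Bool} (l : List Bool)

theorem update_bits_tmp : update (bits w a b r o) .tmp [] = bits w a b r o := by
  funext x; cases x <;> rfl

theorem update_bits_word : update (bits w a b r o) .word l = bits l a b r o := by
  funext x; cases x <;> rfl

theorem update_bits_skipped : update (bits w a b r o) .skipped l = bits w l b r o := by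
  funext x; cases x <;> rfl

theorem update_bits_kept : update (bits w a b r o) .kept l = bits w a l r o := by
  funext x; cases x <;> rfl

theorem update_bits_result : update (bits w a b r o) .result l = bits w a b l o := by
  funext x; cases x <;> rfl

theorem update_bits_out : update (bits w a b r o) .out l = bits w a b r l := by
  funext x; cases x <;> rfl

end Bits

/-- Read a number from the input onto the stack `tmp`, in reverse order. -/
def readLoop : StackProg Letter :=
  .loop inp (fun o : Option (Option Bool) => (match o with
    | some (some b) => .push (bin .tmp) b
    | _ => .skip : StackProg Letter)) fun o : Option (Option Bool) => o.join.isSome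

/-- The hypothesis on `I` covers both ways in which a number ends: at a separator, and at the end of
the input. -/
theorem run_readLoop (l : List Bool) {I : List (Option Bool)} (hI : I.head?.join = none)
    (c : BitStack → List Bool) :
    Run readLoop (bst (l.map some ++ I) c) (bst I.tail (update c .tmp (l.reverse ++ c .tmp)))
      (2 * l.length + 2) := by
  induction l generalizing c with
  | nil =>
    refine (Run.loop_exit (t := 1) ?_ ?_).mono (by simp)
    · change I.head?.join.isSome = false
      rw [hI]
      rfl
    · rw [show (bst (([] : List Bool).map some ++ I) c inp).tail = I.tail from rfl,
        update_bst_inp, List.reverse_nil, List.nil_append, update_eq_self]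
      change Run (match I.head? with
        | some (some b) => .push (bin .tmp) b
        | _ => .skip : StackProg Letter) _ _ _
      split
      · rename_i h
        rw [h] at hI
        simp at hI
      · exact Run.skip _
  | cons b l ih =>
    have h := ih (update c .tmp (b :: c .tmp))
    rw [update_idem, update_self] at h
    rw [List.reverse_cons, List.append_assoc]
    refine (Run.loop_again (t := 1) (S' := bst (l.map some ++ I) (update c .tmp (b :: c .tmp)))
      rfl ?_ h).mono (le_of_eq (by rw [List.length_cons]; ring))
    rw [show (bst ((b :: l).map some ++ I) c inp).tail = l.map some ++ I from rfl, update_bst_inp]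
    exact run_push _ c .tmp b

/-- Read a number from the input onto the stack `x`. -/
def readTo (x : BitStack) : StackProg Letter := .seq readLoop (move .tmp x)

theorem run_readTo {x : BitStack} (hx : x ≠ .tmp) (l : List Bool) {I : List (Option Bool)}
    (hI : I.head?.join = none) {c : BitStack → List Bool} (hc : c .tmp = []) (hc' : c x = []) :
    Run (readTo x) (bst (l.map some ++ I) c) (bst I.tail (update c x l)) (4 * l.length + 4) := by
  have h1 := run_readLoop l hI c
  have h2 := run_move hx.symm I.tail (update c .tmp (l.reverse ++ c .tmp))
  have hself : update c .tmp [] = c := by rw [← hc, update_eq_self]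
  rw [update_self, update_of_ne hx, update_idem, hc, hc', hself, List.append_nil, List.append_nil,
    List.reverse_reverse, List.length_reverse] at h2
  rw [hc, List.append_nil] at h1
  exact (h1.seq h2).mono (by omega)

/-- Skip as many bits as the stack `skipped` says, and then keep as many as the stack `kept` says.
-/
def selectLoop : StackProg Letter :=
  popLoop .word (fun
    | some b => decElse .skipped .skip (decElse .kept (.push (bin .result) b) .skip)
    | none => .skip) Option.isSome

/-- Each bit of the word decrements `skipped`, or if this is zero, `kept`; it is retained only in
the latter case while `kept` is positive. The counters never grow in length, so a round takes linear
time and the loop quadratic time. -/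
theorem run_selectLoop (w : List Bool) (a b r : List Bool) :
    ∃ a' b', a'.length ≤ a.length ∧ b'.length ≤ b.length ∧
      Run selectLoop (bst [] (bits w a b r []))
        (bst [] (bits [] a' b' (((w.drop (bitsVal a)).take (bitsVal b)).reverse ++ r) []))
        (w.length * (4 * a.length + 4 * b.length + 12) + 2) := by
  induction w generalizing a b r with
  | nil =>
    refine ⟨a, b, le_rfl, le_rfl, (run_popLoop_exit (t := 1) rfl ?_).mono (by simp)⟩
    rw [show (bits [] a b r [] .word).tail = [] from rfl, update_bits_word]
    rw [List.drop_nil, List.take_nil]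
    exact Run.skip _
  | cons d w ih =>
    have step : ∀ {a' b' r' : List Bool}, a'.length ≤ a.length → b'.length ≤ b.length →
        ((w.drop (bitsVal a')).take (bitsVal b')).reverse ++ r' =
          (((d :: w).drop (bitsVal a)).take (bitsVal b)).reverse ++ r →
        Run (decElse .skipped .skip (decElse .kept (.push (bin .result) d) .skip))
          (bst [] (bits w a b r [])) (bst [] (bits w a' b' r' []))
          (4 * a.length + 4 * b.length + 11) →
        ∃ a' b', a'.length ≤ a.length ∧ b'.length ≤ b.length ∧
          Run selectLoop (bst [] (bits (d :: w) a b r []))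
          (bst [] (bits [] a' b'
            ((((d :: w).drop (bitsVal a)).take (bitsVal b)).reverse ++ r) []))
          ((d :: w).length * (4 * a.length + 4 * b.length + 12) + 2) := by
      intro a' b' r' ha hb hr hrun
      obtain ⟨a'', b'', ha', hb', h⟩ := ih a' b' r'
      rw [hr] at h
      refine ⟨a'', b'', ha'.trans ha, hb'.trans hb, (run_popLoop_again rfl ?_ h).mono ?_
        (t := 4 * a.length + 4 * b.length + 11 + 1 +
          (w.length * (4 * a'.length + 4 * b'.length + 12) + 2))⟩
      · rw [show (bits (d :: w) a b r [] .word).tail = w from rfl, update_bits_word]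
        exact hrun
      · have := Nat.mul_le_mul_left w.length
          (show 4 * a'.length + 4 * b'.length + 12 ≤ 4 * a.length + 4 * b.length + 12 by omega)
        rw [List.length_cons, add_mul]
        omega
    have cases0 : ∀ n : ℕ, n = 0 ∨ ∃ m, n = m + 1 := fun n => by cases n <;> simp
    rcases cases0 (bitsVal a) with ha | ⟨v, ha⟩
    · rcases cases0 (bitsVal b) with hb | ⟨u, hb⟩
      · refine step (a' := []) (b' := []) (r' := r) (by simp) (by simp) (by simp [hb, bitsVal]) ?_
        refine (run_decElse_zero (by decide) ha (run_decElse_zero (y := .kept) (by decide)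
          (c := update (update (bits w a b r []) .tmp []) .skipped []) hb (t := 1) ?_)).mono ?_
        · rw [update_bits_tmp, update_bits_skipped, update_bits_tmp, update_bits_kept]
          exact Run.skip _
        · rw [update_bits_tmp, update_bits_skipped]
          simp only [bits, List.length_nil]
          omega
      · obtain ⟨b', hb1, hb2, h⟩ := run_decElse_succ (y := .kept) (j := 0) (by decide)
          (s := .push (bin .result) d) (f := .skip) (I := [])
          (c := update (update (bits w a b r []) .tmp []) .skipped []) hb rfl
        rw [update_bits_tmp, update_bits_skipped] at hb2 h
        have h := h (bst [] (bits w [] b' (d :: r) [])) 1 (by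
          rw [update_bits_tmp, update_bits_kept]
          have := run_push [] (bits w [] b' r []) .result d
          rwa [update_bits_result] at this)
        refine step (a' := []) (b' := b') (r' := d :: r) (by simp) hb2.le
          (by simp [ha, hb, hb1, bitsVal]) ?_
        refine (run_decElse_zero (by decide) ha (by
          rw [update_bits_tmp, update_bits_skipped]; exact h)).mono ?_
        simp only [bits, List.length_nil]
        omega
    · obtain ⟨a', ha1, ha2, h⟩ := run_decElse_succ (y := .skipped) (j := 0) (by decide)
        (s := .skip) (f := decElse .kept (.push (bin .result) d) .skip) (I := [])
        (c := bits w a b r []) ha rfl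
      have h := h (bst [] (bits w a' b r [])) 1 (by
        rw [update_bits_tmp, update_bits_skipped]
        exact Run.skip _)
      refine step (a' := a') (b' := b) (r' := r) ha2.le le_rfl
        (by simp [ha, ha1]) (h.mono ?_)
      simp only [bits]
      omega

/-- Move the stack `result` to the output, without leading zeros. -/
def outputLoop : StackProg Letter :=
  popLoop .result (fun
    | some false => .skip
    | some true => .seq (.push (bin .out) true) (move .result .out)
    | none => .skip) fun o => o == some false

/-- The highest bit is on top, so zeros are dropped up to the first 1; moving the rest reverses it
and brings the lowest bit to the top, as the code of a number requires. -/
theorem run_outputLoop (r a b : List Bool) :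
    Run outputLoop (bst [] (bits [] a b r []))
      (bst [] (bits [] a b [] (encodeNat (bitsVal r.reverse)))) (2 * r.length + 4) := by
  induction r with
  | nil =>
    refine (run_popLoop_exit (t := 1) rfl ?_).mono (by simp)
    rw [show (bits [] a b [] [] .result).tail = [] from rfl, update_bits_result]
    exact Run.skip _
  | cons d r ih =>
    have e : (bits [] a b (d :: r) [] .result).tail = r := rfl
    cases d with
    | false =>
      have h : bitsVal (false :: r).reverse = bitsVal r.reverse := by
        rw [List.reverse_cons, bitsVal_append]
        simp [bitsVal]
      rw [h]
      refine (run_popLoop_again (t := 1) rfl ?_ ih).mono (by rw [List.length_cons]; omega)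
      rw [e, update_bits_result]
      exact Run.skip _
    | true =>
      rw [List.reverse_cons, encodeNat_bitsVal]
      refine (run_popLoop_exit (t := 1 + (2 * r.length + 2)) rfl ?_).mono
        (by rw [List.length_cons]; omega)
      rw [e, update_bits_result]
      have h1 := run_push [] (bits [] a b r []) .out true
      have h2 := run_move (x := .result) (y := .out) (by decide) [] (bits [] a b r [true])
      rw [update_bits_out] at h1
      rw [update_bits_result, update_bits_out] at h2
      exact h1.seq h2

/-- Extract bits of a number. -/
def extractProg : StackProg Letter :=
  .seq (readTo .word) (.seq (readTo .skipped) (.seq (readTo .kept) (.seq (.push (bin .kept) true)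
    (.seq selectLoop (.seq outputLoop (.seq (empty .skipped) (empty .kept)))))))

theorem run_extractProg (x : ℕ × ℕ × ℕ) :
    Run extractProg (bst (encodeTriple x) fun _ => [])
      (bst [] (bits [] [] [] [] (encodeNat (extractBits x))))
      (4 * (encodeTriple x).length ^ 2 + 30 * (encodeTriple x).length + 40) := by
  obtain ⟨W, μ, ν⟩ := x
  set w := encodeNat W with hw
  set a := encodeNat μ with ha
  set b := encodeNat ν with hb
  have hx : encodeTriple (W, μ, ν) = w.map some ++ none :: (a.map some ++
    none :: (b.map some ++ [])) := by rw [List.append_nil]; rfl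
  have hlen : (encodeTriple (W, μ, ν)).length = w.length + a.length + b.length + 2 := by
    rw [hx]
    simp
    omega
  have e0 : (fun _ => [] : BitStack → List Bool) = bits [] [] [] [] [] := by
    funext y; cases y <;> rfl
  have h1 := run_readTo (x := .word) (by decide) w (I := none :: (a.map some ++
    none :: (b.map some ++ []))) rfl (c := bits [] [] [] [] []) rfl rfl
  have h2 := run_readTo (x := .skipped) (by decide) a (I := none :: (b.map some ++ [])) rfl
    (c := bits w [] [] [] []) rfl rfl
  have h3 := run_readTo (x := .kept) (by decide) b (I := []) rfl
    (c := bits w a [] [] []) rfl rfl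
  -- The digit 1 pushed on top is a new lowest digit, so the stack `kept` then holds `2 * ν + 1`.
  have h4 := run_push [] (bits w a b [] []) .kept true
  rw [update_bits_word, List.tail_cons] at h1
  rw [update_bits_skipped, List.tail_cons] at h2
  rw [update_bits_kept, List.tail_nil] at h3
  rw [update_bits_kept] at h4
  obtain ⟨a', b', ha', hb', h5⟩ := run_selectLoop w a (true :: b) []
  have hval : bitsVal (((w.drop (bitsVal a)).take (bitsVal (true :: b))).reverse ++ []).reverse =
      extractBits (W, μ, ν) := by
    rw [List.append_nil, List.reverse_reverse, bitsVal_take, bitsVal_drop, bitsVal, hw, ha, hb,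
      bitsVal_encodeNat, bitsVal_encodeNat, bitsVal_encodeNat, extractBits, add_comm (2 * ν) 1]
    rfl
  have hr : (((w.drop (bitsVal a)).take (bitsVal (true :: b))).reverse ++ []).length ≤
      w.length := by
    simp
  generalize (((w.drop (bitsVal a)).take (bitsVal (true :: b))).reverse ++ []) = r at h5 hval hr
  have h6 := run_outputLoop r a' b'
  rw [hval] at h6
  have h7 := run_empty .skipped [] (bits [] a' b' [] (encodeNat (extractBits (W, μ, ν))))
  have h8 := run_empty .kept [] (bits [] [] b' [] (encodeNat (extractBits (W, μ, ν))))
  rw [update_bits_skipped] at h7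
  rw [update_bits_kept] at h8
  rw [e0, hlen, hx]
  refine (h1.seq (h2.seq (h3.seq (h4.seq (h5.seq (h6.seq (h7.seq h8))))))).mono ?_
  simp only [bits, List.length_cons] at ha' hb' ⊢
  nlinarith

theorem polyTimeComputable_extractBits :
    PolyTimeComputable encodeTriple encodeNat extractBits := by
  refine extractProg.polyTimeComputable inp (bin .out) (Equiv.refl _) (Equiv.refl _)
    (4 * Polynomial.X ^ 2 + 30 * Polynomial.X + 40) fun x => ?_
  have e1 : ∀ w, update (β := fun k => List (Letter k)) (fun _ => []) inp w = bst w fun _ => [] := fun w => by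
    funext r; cases r <;> rfl
  have e2 : ∀ w, update (β := fun k => List (Letter k)) (fun _ => []) (bin .out) w =
       bst [] (bits [] [] [] [] w) := fun w => by
    funext r
    rcases r with _ | y
    · rfl
    · cases y <;> rfl
  convert run_extractProg x using 1
  · exact (e1 _).trans (congrArg (fun w => bst w fun _ => []) (List.map_id (encodeTriple x)))
  · exact (e2 _).trans (congrArg (fun w => bst [] (bits [] [] [] [] w)) (List.map_id _))
  · simp

end BitReg

theorem mainTheorem6 :
    ∃ A : MonotoneTwoSat → WeightedGraph, ∃ B : ℕ × ℕ × ℕ → ℕ,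
      PolyTimeComputable MonotoneTwoSat.encode WeightedGraph.encode A ∧
      PolyTimeComputable encodeTriple encodeNat B ∧
      ∀ φ : MonotoneTwoSat,
        (∀ e ∈ (A φ).graph.edgeSet, (A φ).weight e ∈ ({1, 2, 3} : Set ℕ)) ∧
        B ((A φ).totalWeight, φ.clauses.length, φ.numVars) = φ.numSat ∧
        (A φ).HasHamiltonianPath :=
  ⟨MonotoneTwoSat.toGraph, extractBits, Counters.polyTimeComputable_toGraph,
    BitReg.polyTimeComputable_extractBits, fun φ =>
    ⟨φ.toGraph_weight_mem, φ.extractBits_totalWeight, φ.toGraph_hasHamiltonianPath⟩⟩
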